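/- **Setting.** For each sample size $n=|\mathcal S|$ there are $n$ units with controls $X_i\in\mathbb R^p$, treated status $D_i\in\{0,1\}$ and outcome $Y_i\in\mathbb R$. The subsample $\mathcal S^*\subseteq\mathcal S$, the covariate function $s:\mathbb R^p\to\mathbb R^q$ and the conditional law $F$ of $Y$ given $(X,D)$ are functions of $\{(X_i,D_i)\}_{i\in\mathcal S}$; given $\{(X_i,D_i)\}_{i\in\mathcal S}$ the $Y_i$ are independent with laws $F(\cdot\mid X_i,D_i)$. All statements below are conditional on a fixed realization $\{(x_i,d_i)\}_{i\in\mathcal S}$ for each $n$, limits are as $n\to\infty$, and "bounded" means bounded by a constant not depending on $n$ (for all large $n$). Write $f(x,d)=E_F[Y\mid X=x,D=d]$, $U=Y-f(X,D)$, $Z=(1,D,s(X)')'$, $\mathcal S^{*d}=\{i\in\mathcal S^*:D_i=d\}$, $\mathbb X^{*d}=\{X_i:i\in\mathcal S^{*d}\}$, and let $\mathbb G^{*d}$ be the empirical distribution of $X_i$, $i\in\mathcal S^{*d}$. The means $f(X_i,D_i)$, $f(X_i,0)$, $i\in\mathcal S^*$, are assumed to exist. Let $$\Gamma^*=\tfrac1{|\mathcal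 S^*|}\sum_{i\in\mathcal S^*}Z_iZ_i',\qquad \Delta^*=\tfrac1{|\mathcal S^*|}\sum_{i\in\mathcal S^*}Z_iZ_i'E_F[U^2\mid X=X_i,D=D_i],$$ $$\hat\theta^*=(\Gamma^*)^{-1}\tfrac1{|\mathcal S^*|}\sum_{i\in\mathcal S^*}Z_iY_i,\qquad \theta^*=(\Gamma^*)^{-1}\tfrac1{|\mathcal S^*|}\sum_{i\in\mathcal S^*}Z_if(X_i,D_i),$$ let $\hat\beta^*$ be the second component of $\hat\theta^*$, and $$\tau^*=\tau_{\mathbb G^{*1},F}=\tfrac1{|\mathcal S^{*1}|}\sum_{i\in\mathcal S^{*1}}\bigl(f(X_i,1)-f(X_i,0)\bigr).$$ **Standard error.** Let $\psi$ be a metric on $\mathbb R^p$ with $\psi(x,y)\le K\|x-y\|$ for a constant $K$, and $\kappa>0$. For $i\in\mathcal S^*$ let $l(i)$ be a minimizer of $\psi(x_i,x_j)+\kappa|d_i-d_j|$ over $j\in\mathcal S^*\setminus\{i\}$. With $\hat E_i=Y_i-Z_i'\hat\theta^*$ let $$\hat\Delta^*=\tfrac1{2|\mathcal S^*|}\sum_{i\in\mathcal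 S^*}(Z_i\hat E_i-Z_{l(i)}\hat E_{l(i)})(Z_i\hat E_i-Z_{l(i)}\hat E_{l(i)})',$$ and let $se^*$ be $|\mathcal S^*|^{-1/2}$ times the square root of the second diagonal entry of $(\Gamma^*)^{-1}\hat\Delta^*(\Gamma^*)^{-1}$. **Assumptions.** (a) $|\mathcal S^*|\to\infty$. (b) $\liminf\lambda_{\min}[\Gamma^*]>0$ and $\liminf\lambda_{\min}[\Delta^*]>0$. (c) For some $\delta>0$ and each $d$, $E_F[\|ZU\|^{2}\mid X=x,D=d]$ and $E_F[\|ZU\|^{2+\delta}\mid X=x,D=d]$ are bounded over $x\in\mathbb X^{*d}$. (d) For each $d$, all components $Z_j,Z_k$ and all integers $0\le a,b\le2$, $0\le c\le a+b$, the moment $E_F[Z_j^aZ_k^b(Y-Z'\theta^*)^c\mid X=x,D=d]$ exists, is bounded over $x\in\mathbb X^{*d}$, and is $\psi$-Lipschitz in $x\in\mathbb X^{*d}$ with a bounded Lipschitz constant; the diameters of $\mathbb X^{*d}$ are bounded. (e) Either $\psi$ is induced by a norm and, for all large $n$, the minimizers $l(i)$ are unique; or no unit $j$ is the match $l(i)$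 of more than $K'$ units $i\in\mathcal S^*$, for a constant $K'$ and all large $n$. (The first alternative implies the second.) **Misspecification and imbalance.** Let $h^*(x)=f(x,0)-(1,0,s(x)')\theta^*$. The pair $(m^*,c^*)=(m_{\mathbb G^*,F},c_{\mathbb G^*})$ is one of the following: * *Kolmogorov–Smirnov* ($p=1$): $c^*=\sup_{t}|\mathbb G^{*1}((-\infty,t])-\mathbb G^{*0}((-\infty,t])|$, and $m^*$ is the infimum of the total variations on $\mathbb R$ of all continuous bounded extensions of $h^*|_{\mathbb X^{*1}\cup\mathbb X^{*0}}$. * *Monge–Kantorovich/Wasserstein*: $c^*$ is the infimum of $\int\|x_1-x_2\|\,d\pi$ over the couplings $\pi$ of $\mathbb G^{*1}$ and $\mathbb G^{*0}$, and $m^*$ is the Lipschitz seminorm of $h^*$ on $\mathbb X^{*1}\cup\mathbb X^{*0}$. * *Mean difference*, with summaries $r=(r_1,\dots,r_J)$ (which may be functions of $\{(X_i,D_i)\}_{i\in\mathcal S}$) and $L\in[0,\infty]$: $c^*_j=|E_{\mathbb G^{*1}}[r_j]-E_{\mathbb G^{*0}}[r_j]|$ and $m^*_j=\max(|\zeta_{1,j}|,|\zeta_{-1,j}|)$,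 where for $\sigma=\pm1$, $\zeta_\sigma$ is part of a solution of: minimize $\|\zeta\|^2+L\sum_{d}\sum_{x\in\mathbb X^{*d}}\xi^d(x)$ over $\zeta\in\mathbb R^J$, $\xi^d\ge0$ subject to $\sigma h^*\le\sigma r'\zeta+\xi^1$ on $\mathbb X^{*1}$ and $\sigma h^*\ge\sigma r'\zeta-\xi^0$ on $\mathbb X^{*0}$; it is assumed that these solutions have zero slacks $\xi^d$ (sharp separation). Here $m\,c$ denotes the product, or the inner product for mean differences. Assume the local-misspecification condition $m^*c^*=v/\sqrt{|\mathcal S^*|}$ for all large $n$, where $v$ is a positive function of $\{(X_i,D_i)\}_{i\in\mathcal S}$. **Conclusion.** (1) Let $\tau_0^*$ be a function of $\{(X_i,D_i)\}_{i\in\mathcal S}$, and $t^*=(\hat\beta^*-\tau_0^*)/se^*$. Under $H_0:\tau^*=\tau_0^*$, for all $z\in\mathbb R$, $$\Phi(z)\le\liminf_{n\to\infty}\Pr_F\Bigl[t^*-\frac{v}{\sqrt{|\mathcal S^*|}\,se^*}\le z\Bigm|\{(X_i,D_i)\}_{i\in\mathcal S}\Bigr],\qquad \limsup_{n\to\infty}\Pr_F\Bigl[t^*+\frac{v}{\sqrt{|\mathcal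 S^*|}\,se^*}\le z\Bigm|\{(X_i,D_i)\}_{i\in\mathcal S}\Bigr]\le\Phi(z),$$ where $\Phi$ is the standard normal distribution function. (2) Let $\alpha\in(0,1)$, $z_a=\Phi^{-1}(a)$, and $$C_\alpha(m)=\bigl\{\tau:\hat\beta^*-z_{1-\alpha/2}\,se^*-m\,c^*<\tau\le\hat\beta^*-z_{\alpha/2}\,se^*+m\,c^*\bigr\}.$$ If $m\ge m^*$ for all large $n$ (componentwise for mean differences; $m$ may vary with $n$), then $$\liminf_{n\to\infty}\Pr_F\bigl[\tau^*\in C_\alpha(m)\bigm|\{(X_i,D_i)\}_{i\in\mathcal S}\bigr]\ge1-\alpha.$$ -/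

import Mathlib

open MeasureTheory ProbabilityTheory Filter Topology
open scoped ENNReal Matrix

namespace DesignPhase

noncomputable section

/-! ### Samples, subsamples, conditional law of the outcomes -/

/-- The space `ℝ^p` of controls, with its Euclidean norm. -/
abbrev Ctrl (p : ℕ) : Type := EuclideanSpace ℝ (Fin p)

/-- Values of `(X, D)`: controls and treated status (`true` is treated, `false` is untreated). -/
abbrev Obs (p : ℕ) : Type := Ctrl p × Bool

/-- The indicator `D ∈ {0, 1}` as a real number. -/
def treat (d : Bool) : ℝ := if d then 1 else 0

/-- All that is fixed once the controls and the treated statuses of the `n` units are given: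
their values, the selected subsample, the covariate function `s : ℝ^p → ℝ^q`, and the
conditional distribution `F` of `Y` given `(X, D)`. -/
structure Given (p q n : ℕ) where
  obs : Fin n → Obs p
  sub : Finset (Fin n)
  cov : Ctrl p → Fin q → ℝ
  law : Kernel (Obs p) ℝ
  markov : IsMarkovKernel law

/-- The subsample, the covariate function and the conditional distribution of the outcome, each
of them a function of the controls and treated statuses of all `n` units of the sample. -/
structure Setup (p q : ℕ) where
  sub : ∀ n : ℕ, (Fin n → Obs p) → Finset (Fin n)
  cov : ∀ n : ℕ, (Fin n → Obs p) → Ctrl p → Fin q → ℝ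
  law : ∀ n : ℕ, (Fin n → Obs p) → Kernel (Obs p) ℝ
  markov : ∀ (n : ℕ) (w : Fin n → Obs p), IsMarkovKernel (law n w)

/-- The setup, given the realized controls and treated statuses `w` of a sample of `n` units. -/
def Setup.given {p q : ℕ} (P : Setup p q) {n : ℕ} (w : Fin n → Obs p) : Given p q n where
  obs := w
  sub := P.sub n w
  cov := P.cov n w
  law := P.law n w
  markov := P.markov n w

/-- The smallest eigenvalue of a (symmetric) matrix. -/
def lambdaMin {k : ℕ} (A : Matrix (Fin k) (Fin k) ℝ) : ℝ := sInf (spectrum ℝ A)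

/-- The distribution function of the standard normal distribution. -/
def Phi (z : ℝ) : ℝ := cdf (gaussianReal 0 1) z

/-- The standard normal quantile `z_a`, for `a ∈ (0, 1)`. -/
def quantile (a : ℝ) : ℝ := sInf {z : ℝ | a ≤ Phi z}

namespace Given

variable {p q n : ℕ}

/-- The conditional joint law of the outcomes of a random sample, given all the controls and
treated statuses: the `Y i` are independent and `Y i` has law `F(· | X i, D i)`. -/
def condLaw (P : Given p q n) : Measure (Fin n → ℝ) := Measure.pi fun i => P.law (P.obs i)

/-- The controls `X i`. -/
def X (P : Given p q n) (i : Fin n) : Ctrl p := (P.obs i).1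

/-- The units of the subsample with treated status `d`. -/
def arm (P : Given p q n) (d : Bool) : Finset (Fin n) := {i ∈ P.sub | (P.obs i).2 = d}

/-- The size of the subsample, as a real number. -/
def size (P : Given p q n) : ℝ := (P.sub.card : ℝ)

/-- `f(x, d)`, the conditional expectation of `Y` given `(X, D) = (x, d)`. -/
def cexp (P : Given p q n) (o : Obs p) : ℝ := ∫ y, y ∂(P.law o)

/-- The conditional expectation of `U ^ 2`, `U = Y - f(X, D)`, given `(X, D)`. -/
def cvar (P : Given p q n) (o : Obs p) : ℝ := ∫ y, (y - P.cexp o) ^ 2 ∂(P.law o)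

/-- The regressors `Z = (1, D, s(X)')'`. The component with index `1` is `D`. -/
def Z (P : Given p q n) (o : Obs p) : Fin (q + 2) → ℝ :=
  Matrix.vecCons 1 (Matrix.vecCons (treat o.2) (P.cov o.1))

/-- The regressors of unit `i`. -/
def reg (P : Given p q n) (i : Fin n) : Fin (q + 2) → ℝ := P.Z (P.obs i)

/-- The conditional moment `E[‖Z U‖ ^ r | X, D]` (Euclidean norm). -/
def momentZU (P : Given p q n) (r : ℝ) (o : Obs p) : ℝ≥0∞ :=
  ∫⁻ y, ‖WithLp.toLp 2 ((y - P.cexp o) • P.Z o)‖ₑ ^ r ∂(P.law o)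

/-! ### Least squares within the subsample -/

/-- `Γ*`, the average of `Z Z'` over the subsample. -/
def Gam (P : Given p q n) : Matrix (Fin (q + 2)) (Fin (q + 2)) ℝ :=
  P.size⁻¹ • ∑ i ∈ P.sub, Matrix.vecMulVec (P.reg i) (P.reg i)

/-- `Δ*`, the average of `Z Z' E[U ^ 2 | X, D]` over the subsample. -/
def Del (P : Given p q n) : Matrix (Fin (q + 2)) (Fin (q + 2)) ℝ :=
  P.size⁻¹ • ∑ i ∈ P.sub, P.cvar (P.obs i) • Matrix.vecMulVec (P.reg i) (P.reg i)

/-- The least squares coefficients from regressing `y` on `Z` within the subsample. -/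
def lsq (P : Given p q n) (y : Fin n → ℝ) : Fin (q + 2) → ℝ :=
  P.Gam⁻¹ *ᵥ (P.size⁻¹ • ∑ i ∈ P.sub, y i • P.reg i)

/-- The least squares estimator of the coefficient of `D`. -/
def betaHat (P : Given p q n) (Y : Fin n → ℝ) : ℝ := P.lsq Y 1

/-- The regression estimand: the coefficients from the hypothetical regression of
`f(X i, D i)` on `Z i` within the subsample. -/
def theta (P : Given p q n) : Fin (q + 2) → ℝ := P.lsq fun i => P.cexp (P.obs i)

/-- The parameter of interest: the average of `f(X i, 1) - f(X i, 0)` over the treated units of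
the subsample. -/
def tau (P : Given p q n) : ℝ :=
  ((P.arm true).card : ℝ)⁻¹ *
    ∑ i ∈ P.arm true, (P.cexp (P.X i, true) - P.cexp (P.X i, false))

/-- The misspecification function: `f(x, 0)` minus the value at `(x, 0)` of the regression
function at the regression estimand. -/
def dev (P : Given p q n) (x : Ctrl p) : ℝ :=
  P.cexp (x, false) - P.Z (x, false) ⬝ᵥ P.theta

/-! ### The standard error -/

/-- The distance `ψ(x_i, x_j) + κ |d_i - d_j|` between units. -/
def nu (P : Given p q n) (ψ : Ctrl p → Ctrl p → ℝ) (κ : ℝ) (i j : Fin n) : ℝ :=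
  ψ (P.X i) (P.X j) + κ * |treat (P.obs i).2 - treat (P.obs j).2|

/-- `l i` is, for every `i` in the subsample, a closest other unit of the subsample. -/
def IsMatch (P : Given p q n) (ψ : Ctrl p → Ctrl p → ℝ) (κ : ℝ) (l : Fin n → Fin n) : Prop :=
  ∀ i ∈ P.sub, l i ∈ P.sub ∧ l i ≠ i ∧ ∀ j ∈ P.sub, j ≠ i → P.nu ψ κ i (l i) ≤ P.nu ψ κ i j

/-- No ties: the closest other unit is unique. -/
def NoTies (P : Given p q n) (ψ : Ctrl p → Ctrl p → ℝ) (κ : ℝ) (l : Fin n → Fin n) : Prop :=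
  ∀ i ∈ P.sub, ∀ j ∈ P.sub, j ≠ i → j ≠ l i → P.nu ψ κ i (l i) < P.nu ψ κ i j

/-- The residuals of the least squares regression within the subsample. -/
def resid (P : Given p q n) (Y : Fin n → ℝ) (i : Fin n) : ℝ := Y i - P.reg i ⬝ᵥ P.lsq Y

/-- The matching estimator of `Δ*`. -/
def DelHat (P : Given p q n) (l : Fin n → Fin n) (Y : Fin n → ℝ) :
    Matrix (Fin (q + 2)) (Fin (q + 2)) ℝ :=
  (2 * P.size)⁻¹ • ∑ i ∈ P.sub,
    Matrix.vecMulVec (P.resid Y i • P.reg i - P.resid Y (l i) • P.reg (l i))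
      (P.resid Y i • P.reg i - P.resid Y (l i) • P.reg (l i))

/-- The estimator `(Γ*)⁻¹ Δ̂* (Γ*)⁻¹` of the asymptotic variance. -/
def SigHat (P : Given p q n) (l : Fin n → Fin n) (Y : Fin n → ℝ) :
    Matrix (Fin (q + 2)) (Fin (q + 2)) ℝ :=
  P.Gam⁻¹ * P.DelHat l Y * P.Gam⁻¹

/-- The standard error of `betaHat`. -/
def se (P : Given p q n) (l : Fin n → Fin n) (Y : Fin n → ℝ) : ℝ :=
  √(P.SigHat l Y 1 1) / √P.size

/-- The t-statistic for the null value `τ₀`. -/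
def tStat (P : Given p q n) (l : Fin n → Fin n) (τ₀ : ℝ) (Y : Fin n → ℝ) : ℝ :=
  (P.betaHat Y - τ₀) / P.se l Y

/-- The conditional moment `E[Z_j ^ a * Z_k ^ b * (Y - Z'θ) ^ c | X, D]`, with `θ` the regression
estimand. -/
def moment (P : Given p q n) (j k : Fin (q + 2)) (a b c : ℕ) (o : Obs p) : ℝ :=
  ∫ y, P.Z o j ^ a * P.Z o k ^ b * (y - P.Z o ⬝ᵥ P.theta) ^ c ∂(P.law o)

/-- Regularity of the conditional moments and of the supports of the controls in each arm of the
subsample, with constant `M` and with respect to the metric `ψ`. -/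
structure MomentRegular (P : Given p q n) (ψ : Ctrl p → Ctrl p → ℝ) (M : ℝ) : Prop where
  integrable : ∀ (j k : Fin (q + 2)) (a b c : ℕ), a ≤ 2 → b ≤ 2 → c ≤ a + b → ∀ i ∈ P.sub,
    Integrable (fun y : ℝ => P.Z (P.obs i) j ^ a * P.Z (P.obs i) k ^ b *
      (y - P.Z (P.obs i) ⬝ᵥ P.theta) ^ c) (P.law (P.obs i))
  bounded : ∀ (j k : Fin (q + 2)) (a b c : ℕ), a ≤ 2 → b ≤ 2 → c ≤ a + b → ∀ i ∈ P.sub,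
    |P.moment j k a b c (P.obs i)| ≤ M
  lipschitz : ∀ (j k : Fin (q + 2)) (a b c : ℕ), a ≤ 2 → b ≤ 2 → c ≤ a + b →
    ∀ d : Bool, ∀ i ∈ P.arm d, ∀ i' ∈ P.arm d,
    |P.moment j k a b c (P.obs i) - P.moment j k a b c (P.obs i')| ≤ M * ψ (P.X i) (P.X i')
  diam : ∀ d : Bool, ∀ i ∈ P.arm d, ∀ i' ∈ P.arm d, dist (P.X i) (P.X i') ≤ M

/-! ### Covariate imbalance and model misspecification -/

/-- The empirical conditional distribution of `X` given `D = d` within the subsample. -/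
def empirical (P : Given p q n) (d : Bool) : Measure (Ctrl p) :=
  ((P.arm d).card : ℝ≥0∞)⁻¹ • ∑ i ∈ P.arm d, Measure.dirac (P.X i)

/-- Kolmogorov-Smirnov distance between the empirical conditional distributions (`p = 1`). -/
def cKS (P : Given 1 q n) : ℝ :=
  ⨆ t : ℝ, |(P.empirical true).real {x | x 0 ≤ t} - (P.empirical false).real {x | x 0 ≤ t}|

/-- The infimum of the total variations over `ℝ` of the continuous and bounded extensions of the
misspecification function from the controls in the subsample to `ℝ` (`p = 1`). -/
def mKS (P : Given 1 q n) : ℝ :=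
  (⨅ h ∈ {h : ℝ → ℝ | Continuous h ∧ (∃ B : ℝ, ∀ x, |h x| ≤ B) ∧
    ∀ i ∈ P.sub, h (P.X i 0) = P.dev (P.X i)}, eVariationOn h Set.univ).toReal

/-- Monge-Kantorovich/Wasserstein distance between the empirical conditional distributions. -/
def cMKW (P : Given p q n) : ℝ :=
  (⨅ π ∈ {π : Measure (Ctrl p × Ctrl p) |
      π.map Prod.fst = P.empirical true ∧ π.map Prod.snd = P.empirical false},
    ∫⁻ x, ENNReal.ofReal ‖x.1 - x.2‖ ∂π).toReal

/-- The Lipschitz seminorm of the misspecification function on the controls in the subsample. -/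
def mMKW (P : Given p q n) : ℝ :=
  (⨆ x ∈ {x : Ctrl p × Ctrl p | x.1 ≠ x.2 ∧ x.1 ∈ P.X '' P.sub ∧ x.2 ∈ P.X '' P.sub},
    ENNReal.ofReal (|P.dev x.1 - P.dev x.2| / ‖x.1 - x.2‖)).toReal

/-- Absolute values of the mean differences of the summaries `r`. -/
def cMD (P : Given p q n) {J : ℕ} (r : Ctrl p → Fin J → ℝ) (j : Fin J) : ℝ :=
  |∫ x, r x j ∂(P.empirical true) - ∫ x, r x j ∂(P.empirical false)|

open scoped Classical in
/-- The support of the empirical conditional distribution of `X` given `D = d`. -/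
def supp (P : Given p q n) (d : Bool) : Finset (Ctrl p) := (P.arm d).image P.X

/-- The constraints of the separation problem with sign `σ`, summaries `r`, separating vector
`ζ` and slacks `ξ d`. -/
def SepFeasible (P : Given p q n) {J : ℕ} (r : Ctrl p → Fin J → ℝ) (σ : ℝ)
    (ζ : Fin J → ℝ) (ξ : Bool → Ctrl p → NNReal) : Prop :=
  (∀ x ∈ P.supp true, σ * P.dev x ≤ σ * (r x ⬝ᵥ ζ) + ξ true x) ∧
  (∀ x ∈ P.supp false, σ * (r x ⬝ᵥ ζ) - ξ false x ≤ σ * P.dev x)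

/-- The objective `‖ζ‖ ^ 2 + L * (sum of all slacks)` of the separation problem, `L ∈ [0, ∞]`. -/
def sepObjective (P : Given p q n) {J : ℕ} (L : ℝ≥0∞)
    (ζ : Fin J → ℝ) (ξ : Bool → Ctrl p → NNReal) : ℝ≥0∞ :=
  ENNReal.ofReal (∑ j, ζ j ^ 2) + L * ∑ d : Bool, ∑ x ∈ P.supp d, (ξ d x : ℝ≥0∞)

/-- `(ζ, ξ)` solves the separation problem with sign `σ`. -/
def SepSolution (P : Given p q n) {J : ℕ} (r : Ctrl p → Fin J → ℝ) (L : ℝ≥0∞) (σ : ℝ)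
    (ζ : Fin J → ℝ) (ξ : Bool → Ctrl p → NNReal) : Prop :=
  P.SepFeasible r σ ζ ξ ∧
    ∀ ζ' ξ', P.SepFeasible r σ ζ' ξ' → P.sepObjective L ζ ξ ≤ P.sepObjective L ζ' ξ'

end Given

/-- The three ways of measuring imbalance and misspecification: Kolmogorov-Smirnov (for
one-dimensional controls), Monge-Kantorovich/Wasserstein, and mean differences of `J` summaries
(which may be functions of the controls and treated statuses in the sample), with slack penalty
`L ∈ [0, ∞]`. -/
inductive BalanceMetric : ℕ → Type
  | ks : BalanceMetric 1
  | mkw {p : ℕ} : BalanceMetric p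
  | md {p : ℕ} (J : ℕ) (r : ∀ n : ℕ, (Fin n → Obs p) → Ctrl p → Fin J → ℝ) (L : ℝ≥0∞) :
      BalanceMetric p

/-- Number of components of the measurements of imbalance and misspecification. -/
def BalanceMetric.dim : {p : ℕ} → BalanceMetric p → ℕ
  | _, .ks => 1
  | _, .mkw => 1
  | _, .md J _ _ => J

/-- The covariate imbalance `c` of the subsample. -/
def BalanceMetric.imbalance {q n : ℕ} : {p : ℕ} → (κ : BalanceMetric p) → Given p q n → Fin κ.dim → ℝ
  | _, .ks, P => fun _ => P.cKS
  | _, .mkw, P => fun _ => P.cMKW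
  | _, .md _ r _, P => P.cMD (r n P.obs)

/-- `m` is the degree of misspecification within the subsample. For mean differences it is
`|ζ₁| ∨ |ζ₋₁|` componentwise, where `ζ₁` and `ζ₋₁` solve the two separation problems with zero
slacks, i.e. both attain sharp separation. -/
def BalanceMetric.IsMisspec {q n : ℕ} : {p : ℕ} → (κ : BalanceMetric p) → Given p q n → (Fin κ.dim → ℝ) → Prop
  | _, .ks, P, m => ∀ j, m j = P.mKS
  | _, .mkw, P, m => ∀ j, m j = P.mMKW
  | _, .md J r L, P, m => ∃ ζ₁ ζ₂ : Fin J → ℝ,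
      P.SepSolution (r n P.obs) L 1 ζ₁ 0 ∧ P.SepSolution (r n P.obs) L (-1) ζ₂ 0 ∧
      ∀ j : Fin J, m j = max |ζ₁ j| |ζ₂ j|

/-- The robustified interval `C_α(m)`; `mc` stands for the (inner) product of `m` and `c`. -/
def Given.robustCI {p q n : ℕ} (P : Given p q n) (l : Fin n → Fin n) (α mc : ℝ)
    (Y : Fin n → ℝ) : Set ℝ :=
  Set.Ioc (P.betaHat Y - quantile (1 - α / 2) * P.se l Y - mc)
    (P.betaHat Y - quantile (α / 2) * P.se l Y + mc)

/-- `ψ` is a metric. -/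
structure IsMetric {E : Type} (ψ : E → E → ℝ) : Prop where
  eq_zero_iff : ∀ x y, ψ x y = 0 ↔ x = y
  symm : ∀ x y, ψ x y = ψ y x
  triangle : ∀ x y z, ψ x z ≤ ψ x y + ψ y z

end

end DesignPhase

open DesignPhase

namespace DesignPhase

/-! ### Quadratic forms -/

/-! Write β̂ - τ = (β̂ - θ₁) + (θ₁ - τ), where θ₁ is the `D`-coefficient of the regression estimand.
The second term is a deterministic bias, the first is noise.

Bias. The normal equations, tested against D and 1 - D, make the residuals of f(X, D) sum to zero in
each arm. Hence θ₁ - τ is exactly the treated-minus-untreated mean difference of the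
misspecification function (`theta_sub_tau`). Each of the three balance metrics then bounds it by the
easy half of a duality: summation by parts for Kolmogorov-Smirnov, integration against a coupling
for Wasserstein, sandwiching between linear functions of the summaries for mean differences. The
result is |θ₁ - τ| ≤ m·c (`abs_theta_sub_tau_le`).

Noise. β̂ - θ₁ is an average of independent centred terms `infl i` * U_i. The moment assumptions
bound the regressors and the fourth moments of the errors, and the eigenvalue assumptions keep the
average variance away from zero. A characteristic function argument gives normality
(`tendsto_measureReal_normalized_sum_le`).

Standard error. Under misspecification the errors e_i = `infl i` * (Y_i - Z_i'θ) need not be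
centred, but differencing with a close match removes the mean, so E(e_i - e_l)² is nearly 2
Var(e_i). Only boundedly many units lack a close match in their own arm, by covering the covariate
space with finitely many small pieces. As no unit is matched too often, the variance of the sum of
squared differences is of order N, and Chebyshev's inequality applies. Replacing θ by its estimate
costs O(N^{-1/2}) in probability, by Minkowski's inequality (`tendsto_measureReal_sqrt_SigHat`).

Slutsky's lemma combines noise and standard error. Shifting by at least the bias bound then yields
the one-sided limits and the coverage. -/

theorem mul_dotProduct_self_le_of_le_lambdaMin {k : ℕ} {A : Matrix (Fin k) (Fin k) ℝ}
    (hA : A.IsHermitian) {c : ℝ} (hc : c ≤ lambdaMin A) (x : Fin k → ℝ) :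
    c * (x ⬝ᵥ x) ≤ x ⬝ᵥ A *ᵥ x := by
  have hpsd : (A - algebraMap ℝ _ c).PosSemidef := by
    rw [Matrix.posSemidef_iff_isHermitian_and_spectrum_nonneg]
    refine ⟨hA.sub ?_, ?_⟩
    · simp [Matrix.IsHermitian, Matrix.algebraMap_eq_diagonal]
    · intro μ hμ
      rw [← spectrum.sub_singleton_eq] at hμ
      obtain ⟨a, ha, b, rfl, rfl⟩ := Set.mem_sub.1 hμ
      have hbdd : BddBelow (spectrum ℝ A) := by
        rw [hA.spectrum_real_eq_range_eigenvalues]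
        exact (Set.finite_range _).bddBelow
      have : lambdaMin A ≤ a := csInf_le hbdd ha
      simp only [Set.mem_ofPred_eq]
      linarith
  have h := hpsd.dotProduct_mulVec_nonneg x
  rw [Matrix.sub_mulVec, dotProduct_sub, Algebra.algebraMap_eq_smul_one, Matrix.smul_mulVec,
    Matrix.one_mulVec, dotProduct_smul] at h
  simp only [star_trivial, smul_eq_mul] at h
  linarith

/-- Halving `lam` turns the bound on the liminf into a strict one, which then holds eventually. -/
theorem eventually_quadForm_le_of_liminf_lambdaMin {k : ℕ → ℕ}
    {A : ∀ n, Matrix (Fin (k n)) (Fin (k n)) ℝ} (hA : ∀ n, (A n).IsHermitian) {lam : ℝ}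
    (hlam : 0 < lam)
    (h : (lam : EReal) ≤ liminf (fun n : ℕ => (lambdaMin (A n) : EReal)) atTop) :
    ∀ᶠ n in atTop, ∀ x, lam / 2 * (x ⬝ᵥ x) ≤ x ⬝ᵥ A n *ᵥ x := by
  have hlt : ((lam / 2 : ℝ) : EReal) < liminf (fun n : ℕ => (lambdaMin (A n) : EReal)) atTop :=
    lt_of_lt_of_le (by exact_mod_cast half_lt_self hlam) h
  filter_upwards [eventually_lt_of_lt_liminf hlt] with n hn x
  exact mul_dotProduct_self_le_of_le_lambdaMin (hA n) (by exact_mod_cast hn.le) x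

theorem isUnit_of_quadForm_le {k : ℕ} {A : Matrix (Fin k) (Fin k) ℝ} {lam : ℝ} (hlam : 0 < lam)
    (h : ∀ x, lam * (x ⬝ᵥ x) ≤ x ⬝ᵥ A *ᵥ x) : IsUnit A := by
  rw [← Matrix.mulVec_injective_iff_isUnit]
  intro x y hxy
  have h1 := h (x - y)
  rw [Matrix.mulVec_sub, show A *ᵥ x = A *ᵥ y from hxy, sub_self, dotProduct_zero] at h1
  have h2 : (x - y) ⬝ᵥ (x - y) ≤ 0 := by
    by_contra h3
    push Not at h3
    nlinarith
  have h3 : (x - y) ⬝ᵥ (x - y) = 0 :=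
    le_antisymm h2 (Finset.sum_nonneg fun _ _ => mul_self_nonneg _)
  exact sub_eq_zero.1 (dotProduct_self_eq_zero.1 h3)

theorem dotProduct_sq_le {k : ℕ} (x y : Fin k → ℝ) : (x ⬝ᵥ y) ^ 2 ≤ (x ⬝ᵥ x) * (y ⬝ᵥ y) := by
  have := Finset.sum_mul_sq_le_sq_mul_sq Finset.univ x y
  simpa [dotProduct, sq] using this

theorem dotProduct_self_nonneg' {k : ℕ} (x : Fin k → ℝ) : 0 ≤ x ⬝ᵥ x :=
  Finset.sum_nonneg fun _ _ => mul_self_nonneg _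

/-- The solution of a linear system with coercive matrix is bounded by the right-hand side. -/
theorem sq_mul_dotProduct_self_le_of_quadForm_le {k : ℕ} {A : Matrix (Fin k) (Fin k) ℝ} {lam : ℝ}
    (hlam : 0 < lam) (h : ∀ x, lam * (x ⬝ᵥ x) ≤ x ⬝ᵥ A *ᵥ x) (x : Fin k → ℝ) :
    lam ^ 2 * (x ⬝ᵥ x) ≤ (A *ᵥ x) ⬝ᵥ (A *ᵥ x) := by
  have h1 := h x
  have h2 := dotProduct_sq_le x (A *ᵥ x)
  have h3 := dotProduct_self_nonneg' x
  have h4 := dotProduct_self_nonneg' (A *ᵥ x)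
  rcases h3.eq_or_lt with h0 | h0
  · rw [← h0]; simpa using h4
  -- Coercivity squared, against Cauchy-Schwarz for x and Ax; one factor x·x cancels.
  · have h5 : (lam * (x ⬝ᵥ x)) ^ 2 ≤ (x ⬝ᵥ A *ᵥ x) ^ 2 :=
      pow_le_pow_left₀ (by positivity) h1 2
    have h6 : (x ⬝ᵥ x) * (lam ^ 2 * (x ⬝ᵥ x)) ≤ (x ⬝ᵥ x) * ((A *ᵥ x) ⬝ᵥ (A *ᵥ x)) := by nlinarith
    exact le_of_mul_le_mul_left h6 h0

/-! ### Normal equations and the bias of the regression estimand -/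

namespace Given

variable {p q n : ℕ} (P : Given p q n)

theorem dotProduct_sum_vecMulVec_mulVec {k : ℕ} {ι : Type*} (s : Finset ι) (c : ι → ℝ)
    (z z' : ι → Fin k → ℝ) (x y : Fin k → ℝ) :
    x ⬝ᵥ (∑ i ∈ s, c i • Matrix.vecMulVec (z i) (z' i)) *ᵥ y =
      ∑ i ∈ s, c i * ((z i ⬝ᵥ x) * (z' i ⬝ᵥ y)) := by
  rw [Matrix.sum_mulVec, dotProduct_sum]
  refine Finset.sum_congr rfl fun i _ => ?_
  rw [Matrix.smul_mulVec, dotProduct_smul, Matrix.vecMulVec_mulVec, dotProduct_smul,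
    dotProduct_comm x]
  simp

theorem dotProduct_Gam_mulVec (x y : Fin (q + 2) → ℝ) :
    x ⬝ᵥ P.Gam *ᵥ y = P.size⁻¹ * ∑ i ∈ P.sub, (P.reg i ⬝ᵥ x) * (P.reg i ⬝ᵥ y) := by
  have := dotProduct_sum_vecMulVec_mulVec P.sub (fun _ => 1) P.reg P.reg x y
  simp only [one_smul, one_mul] at this
  rw [Gam, Matrix.smul_mulVec, dotProduct_smul, this, smul_eq_mul]

theorem dotProduct_Del_mulVec (x y : Fin (q + 2) → ℝ) :
    x ⬝ᵥ P.Del *ᵥ y =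
      P.size⁻¹ * ∑ i ∈ P.sub, P.cvar (P.obs i) * ((P.reg i ⬝ᵥ x) * (P.reg i ⬝ᵥ y)) := by
  rw [Del, Matrix.smul_mulVec, dotProduct_smul, dotProduct_sum_vecMulVec_mulVec, smul_eq_mul]

theorem isHermitian_Gam : P.Gam.IsHermitian := by
  ext i j
  simp [Gam, Matrix.sum_apply, Matrix.vecMulVec_apply, mul_comm]

theorem isHermitian_Del : P.Del.IsHermitian := by
  ext i j
  simp [Del, Matrix.sum_apply, Matrix.vecMulVec_apply, mul_comm]

/-- Normal equations. -/
theorem Gam_mulVec_lsq (h : IsUnit P.Gam) (y : Fin n → ℝ) :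
    P.Gam *ᵥ P.lsq y = P.size⁻¹ • ∑ i ∈ P.sub, y i • P.reg i := by
  rw [lsq, Matrix.mulVec_mulVec, Matrix.mul_nonsing_inv _ ((Matrix.isUnit_iff_isUnit_det _).1 h),
    Matrix.one_mulVec]

/-- The normal equations tested against x. The useful choices make `P.reg i ⬝ᵥ x` equal to D or 1 -
D, the indicators of the two arms. -/
theorem sum_resid_mul_reg (h : IsUnit P.Gam) (y : Fin n → ℝ) (x : Fin (q + 2) → ℝ)
    (hs : P.size ≠ 0) :
    ∑ i ∈ P.sub, (y i - P.reg i ⬝ᵥ P.lsq y) * (P.reg i ⬝ᵥ x) = 0 := by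
  have h1 := congrArg (fun v => x ⬝ᵥ v) (P.Gam_mulVec_lsq h y)
  simp only [dotProduct_Gam_mulVec, dotProduct_smul, dotProduct_sum, smul_eq_mul] at h1
  have h2 := mul_left_cancel₀ (inv_ne_zero hs) h1
  simp only [sub_mul, Finset.sum_sub_distrib]
  rw [sub_eq_zero]
  calc _ = ∑ i ∈ P.sub, y i * (x ⬝ᵥ P.reg i) := by simp only [dotProduct_comm x]
    _ = _ := by rw [← h2]; exact Finset.sum_congr rfl fun i _ => mul_comm _ _

theorem reg_zero (i : Fin n) : P.reg i 0 = 1 := rfl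

theorem reg_one (i : Fin n) : P.reg i 1 = treat (P.obs i).2 := rfl

theorem mem_arm {d : Bool} {i : Fin n} : i ∈ P.arm d ↔ i ∈ P.sub ∧ (P.obs i).2 = d := by
  simp [arm]

theorem arm_subset (d : Bool) : P.arm d ⊆ P.sub := Finset.filter_subset _ _

theorem sum_mul_treat (f : Fin n → ℝ) :
    ∑ i ∈ P.sub, f i * treat (P.obs i).2 = ∑ i ∈ P.arm true, f i := by
  rw [arm, Finset.sum_filter]
  refine Finset.sum_congr rfl fun i _ => ?_
  by_cases h : (P.obs i).2 = true <;> simp [treat, h]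

theorem sum_mul_one_sub_treat (f : Fin n → ℝ) :
    ∑ i ∈ P.sub, f i * (1 - treat (P.obs i).2) = ∑ i ∈ P.arm false, f i := by
  rw [arm, Finset.sum_filter]
  refine Finset.sum_congr rfl fun i _ => ?_
  by_cases h : (P.obs i).2 = true <;> simp [treat, h]

/-- If an arm is empty, then D or 1 - D vanishes on the whole subsample, so the corresponding
nonzero coefficient vector annihilates the quadratic form of Γ. -/
theorem arm_nonempty {lam : ℝ} (hlam : 0 < lam)
    (h : ∀ x, lam * (x ⬝ᵥ x) ≤ x ⬝ᵥ P.Gam *ᵥ x) (d : Bool) : (P.arm d).Nonempty := by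
  by_contra hne
  rw [Finset.not_nonempty_iff_eq_empty] at hne
  have key : ∀ x : Fin (q + 2) → ℝ, x ≠ 0 → (∀ i ∈ P.sub, P.reg i ⬝ᵥ x = 0) → False := by
    intro x hx0 hx
    have h1 := h x
    rw [dotProduct_Gam_mulVec, Finset.sum_eq_zero (fun i hi => by rw [hx i hi, zero_mul]),
      mul_zero] at h1
    have h2 : 0 < x ⬝ᵥ x :=
      lt_of_le_of_ne (dotProduct_self_nonneg' x) fun h => hx0 (dotProduct_self_eq_zero.1 h.symm)
    nlinarith
  have hd : ∀ i ∈ P.sub, (P.obs i).2 ≠ d := by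
    intro i hi hid
    have : i ∈ P.arm d := P.mem_arm.2 ⟨hi, hid⟩
    simp [hne] at this
  cases d with
  | true =>
    refine key (Pi.single 1 1) (by simp) fun i hi => ?_
    rw [dotProduct_single, reg_one, treat, if_neg (hd i hi), zero_mul]
  | false =>
    refine key (Pi.single 0 1 - Pi.single 1 1) (fun h0 => ?_) fun i hi => ?_
    · have := congrFun h0 0
      simp at this
    · rw [dotProduct_sub, dotProduct_single, dotProduct_single, reg_zero, reg_one, treat,
        if_pos (by simpa using hd i hi)]
      simp

/-- The average of a function of the controls over one arm of the subsample. -/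
noncomputable def armMean (d : Bool) (h : Ctrl p → ℝ) : ℝ :=
  ((P.arm d).card : ℝ)⁻¹ * ∑ i ∈ P.arm d, h (P.X i)

theorem Z_true_dotProduct (x : Ctrl p) (θ : Fin (q + 2) → ℝ) :
    P.Z (x, true) ⬝ᵥ θ = P.Z (x, false) ⬝ᵥ θ + θ 1 := by
  simp only [Z, dotProduct, Fin.sum_univ_succ]
  simp [treat]
  ring

/-- The bias of the regression estimand is the mean difference of the misspecification. -/
theorem theta_sub_tau (hG : IsUnit P.Gam) (hne : (P.arm true).Nonempty) :
    P.theta 1 - P.tau = P.armMean true P.dev - P.armMean false P.dev := by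
  have hs : P.size ≠ 0 := by
    obtain ⟨i, hi⟩ := hne
    have : 0 < P.sub.card := Finset.card_pos.2 ⟨i, P.arm_subset _ hi⟩
    simp only [size]
    positivity
  set r : Fin n → ℝ := fun i => P.cexp (P.obs i) - P.reg i ⬝ᵥ P.theta with hr
  -- Residuals of f are orthogonal to D, and below to 1 - D.
  have h1 : ∑ i ∈ P.arm true, r i = 0 := by
    rw [← sum_mul_treat]
    have := P.sum_resid_mul_reg hG (fun i => P.cexp (P.obs i)) (Pi.single 1 1) hs
    simp only [dotProduct_single, reg_one, mul_one] at this
    exact this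
  have h0 : ∑ i ∈ P.arm false, r i = 0 := by
    rw [← sum_mul_one_sub_treat]
    have := P.sum_resid_mul_reg hG (fun i => P.cexp (P.obs i)) (Pi.single 0 1 - Pi.single 1 1) hs
    simp only [dotProduct_sub, dotProduct_single, reg_zero, reg_one, mul_one] at this
    exact this
  have hobs : ∀ d, ∀ i ∈ P.arm d, P.obs i = (P.X i, d) := by
    intro d i hi
    have := (P.mem_arm.1 hi).2
    rw [← this]; rfl
  have h0' : ∑ i ∈ P.arm false, P.dev (P.X i) = 0 := by
    rw [← h0]
    refine Finset.sum_congr rfl fun i hi => ?_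
    simp only [hr, reg, dev]
    rw [hobs _ i hi]
  -- For a treated unit the residual equals f(x,1) - f(x,0) + `dev` x - θ₁; for an untreated one it
  -- is `dev` x itself.
  have h1' : ∑ i ∈ P.arm true, (P.cexp (P.X i, true) - P.cexp (P.X i, false)) =
      ∑ i ∈ P.arm true, (P.theta 1 - P.dev (P.X i)) := by
    rw [← sub_eq_zero, ← Finset.sum_sub_distrib, ← h1]
    refine Finset.sum_congr rfl fun i hi => ?_
    simp only [hr, reg, dev]
    rw [hobs _ i hi, Z_true_dotProduct]
    ring
  have hc : ((P.arm true).card : ℝ) ≠ 0 := by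
    have := Finset.card_pos.2 hne
    positivity
  rw [tau, h1', armMean, armMean, h0', Finset.sum_sub_distrib, Finset.sum_const, nsmul_eq_mul]
  field_simp
  ring

end Given

/-- Summation by parts: a sum of values of a function of bounded variation is controlled by the
partial sums of the weights. -/
theorem abs_sum_mul_sub_le_of_partial_sums (h F : ℝ → ℝ)
    (hF : ∀ x y, x ≤ y → |h y - h x| ≤ F y - F x) {c : ℝ} (hc : 0 ≤ c) (w : ℝ → ℝ) (s : Finset ℝ) :
    (∀ t ∈ s, |∑ x ∈ s with x ≤ t, w x| ≤ c) → ∀ L a, L ≤ a → (∀ x ∈ s, L ≤ x ∧ x ≤ a) →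
    |∑ x ∈ s, w x * h x - (∑ x ∈ s, w x) * h a| ≤ c * (F a - F L) := by
  induction s using Finset.induction_on_max with
  | empty =>
    intro _ L a hLa _
    have := (abs_nonneg _).trans (hF L a hLa)
    simpa using mul_nonneg hc this
  | insert b s hb ih =>
    intro hw L a _ hs
    have hbs : b ∉ s := fun hmem => lt_irrefl _ (hb b hmem)
    obtain ⟨hLb, hba⟩ := hs b (Finset.mem_insert_self _ _)
    have hw' : ∀ t ∈ s, |∑ x ∈ s with x ≤ t, w x| ≤ c := by
      intro t ht
      have := hw t (Finset.mem_insert_of_mem ht)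
      rwa [Finset.filter_insert, if_neg (not_le.2 (hb t ht))] at this
    have h1 := ih hw' L b hLb fun x hx =>
      ⟨(hs x (Finset.mem_insert_of_mem hx)).1, (hb x hx).le⟩
    have h2 : |∑ x ∈ insert b s, w x| ≤ c := by
      have := hw b (Finset.mem_insert_self _ _)
      rwa [Finset.filter_true_of_mem] at this
      intro x hx
      rcases Finset.mem_insert.1 hx with rfl | hx
      · exact le_rfl
      · exact (hb x hx).le
    have h3 := hF b a hba
    have h4 : |(∑ x ∈ insert b s, w x) * (h a - h b)| ≤ c * (F a - F b) := by
      rw [abs_mul]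
      exact mul_le_mul h2 h3 (abs_nonneg _) hc
    -- Abel summation: the new largest point b contributes nothing relative to the reference value h
    -- b, and moving the reference on to h a costs the full partial sum times h a - h b.
    have h5 : ∑ x ∈ insert b s, w x * h x - (∑ x ∈ insert b s, w x) * h a =
        (∑ x ∈ s, w x * h x - (∑ x ∈ s, w x) * h b) -
          (∑ x ∈ insert b s, w x) * (h a - h b) := by
      rw [Finset.sum_insert hbs, Finset.sum_insert hbs]
      ring
    rw [h5]
    calc _ ≤ _ := abs_sub _ _
      _ ≤ c * (F b - F L) + c * (F a - F b) := add_le_add h1 h4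
      _ = _ := by ring

/-- The cumulative variation serves as the dominating function F in the summation by parts. -/
theorem abs_sub_le_variationOnFromTo_sub {h : ℝ → ℝ} (hh : LocallyBoundedVariationOn h Set.univ)
    (x y : ℝ) (hxy : x ≤ y) :
    |h y - h x| ≤ variationOnFromTo h Set.univ 0 y - variationOnFromTo h Set.univ 0 x := by
  have h1 := variationOnFromTo.add hh (Set.mem_univ 0) (Set.mem_univ x) (Set.mem_univ y)
  rw [← h1, add_sub_cancel_left, variationOnFromTo.eq_of_le _ _ hxy, ← Real.dist_eq, dist_edist]
  refine ENNReal.toReal_mono (hh x y (Set.mem_univ _) (Set.mem_univ _)) ?_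
  exact eVariationOn.edist_le _ (by simp [hxy]) (by simp [hxy])

/-! ### Bias bounds from imbalance and misspecification -/

namespace Given

variable {p q n : ℕ} (P : Given p q n)

theorem integral_empirical (d : Bool) (h : Ctrl p → ℝ) :
    ∫ x, h x ∂(P.empirical d) = P.armMean d h := by
  rw [empirical, integral_smul_measure, integral_finsetSum_measure
    (fun i _ => integrable_dirac (by finiteness))]
  simp [armMean]

theorem isProbabilityMeasure_empirical {d : Bool} (h : (P.arm d).Nonempty) :
    IsProbabilityMeasure (P.empirical d) := by
  constructor
  have : ((P.arm d).card : ℝ≥0∞) ≠ 0 := by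
    simpa using h.ne_empty
  simp [empirical, ENNReal.inv_mul_cancel this]

theorem empirical_real_eq (d : Bool) {A : Set (Ctrl p)} (hA : MeasurableSet A) :
    (P.empirical d).real A = P.armMean d (A.indicator 1) := by
  rw [← integral_empirical, integral_indicator_one hA]

theorem armMean_mem_Icc (d : Bool) {h : Ctrl p → ℝ} (h0 : ∀ x, h x ∈ Set.Icc (0 : ℝ) 1) :
    P.armMean d h ∈ Set.Icc (0 : ℝ) 1 := by
  constructor
  · exact mul_nonneg (by positivity) (Finset.sum_nonneg fun i _ => (h0 _).1)
  · rw [armMean]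
    have : ∑ i ∈ P.arm d, h (P.X i) ≤ ((P.arm d).card : ℝ) := by
      calc _ ≤ ∑ i ∈ P.arm d, (1 : ℝ) := Finset.sum_le_sum fun i _ => (h0 _).2
        _ = _ := by simp
    calc _ ≤ ((P.arm d).card : ℝ)⁻¹ * ((P.arm d).card : ℝ) := by gcongr
      _ ≤ 1 := inv_mul_le_one

theorem armMean_congr {d : Bool} {h h' : Ctrl p → ℝ} (hh : ∀ i ∈ P.arm d, h (P.X i) = h' (P.X i)) :
    P.armMean d h = P.armMean d h' := by
  rw [armMean, armMean, Finset.sum_congr rfl hh]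

theorem armMean_one {d : Bool} (h : (P.arm d).Nonempty) : P.armMean d (fun _ => 1) = 1 := by
  have : ((P.arm d).card : ℝ) ≠ 0 := by
    have := Finset.card_pos.2 h
    positivity
  simp [armMean, this]

/-- The signed weights of the difference of the two empirical distributions. -/
noncomputable def signedWeight (i : Fin n) : ℝ :=
  if (P.obs i).2 then ((P.arm true).card : ℝ)⁻¹ else -((P.arm false).card : ℝ)⁻¹

theorem armMean_sub_armMean (h : Ctrl p → ℝ) :
    P.armMean true h - P.armMean false h = ∑ i ∈ P.sub, P.signedWeight i * h (P.X i) := by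
  simp only [armMean, arm]
  rw [Finset.mul_sum, Finset.mul_sum, Finset.sum_filter, Finset.sum_filter,
    ← Finset.sum_sub_distrib]
  refine Finset.sum_congr rfl fun i _ => ?_
  by_cases hi : (P.obs i).2 = true <;> simp [signedWeight, hi, arm]

theorem abs_armMean_sub_le_cKS (P : Given 1 q n) (t : ℝ) :
    |P.armMean true ({x : Ctrl 1 | x 0 ≤ t}.indicator 1) -
      P.armMean false ({x : Ctrl 1 | x 0 ≤ t}.indicator 1)| ≤ P.cKS := by
  have hm : ∀ t : ℝ, MeasurableSet {x : Ctrl 1 | x 0 ≤ t} := fun t =>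
    measurableSet_le (by fun_prop) measurable_const
  have hI : ∀ (t : ℝ) (x : Ctrl 1), ({x : Ctrl 1 | x 0 ≤ t}.indicator (1 : Ctrl 1 → ℝ) x) ∈
      Set.Icc (0 : ℝ) 1 := fun t x => by
    by_cases hx : x ∈ {x : Ctrl 1 | x 0 ≤ t} <;> simp [Set.indicator, hx]
  rw [← empirical_real_eq _ _ (hm t), ← empirical_real_eq _ _ (hm t), cKS]
  refine le_ciSup (f := fun t : ℝ => |(P.empirical true).real {x | x 0 ≤ t} -
    (P.empirical false).real {x | x 0 ≤ t}|) ⟨1, ?_⟩ t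
  rintro _ ⟨t, rfl⟩
  simp only
  rw [empirical_real_eq _ _ (hm t), empirical_real_eq _ _ (hm t), abs_le]
  have h1 := P.armMean_mem_Icc true (hI t)
  have h2 := P.armMean_mem_Icc false (hI t)
  constructor <;> linarith [h1.1, h1.2, h2.1, h2.2]

theorem cKS_nonneg (P : Given 1 q n) : 0 ≤ P.cKS := Real.iSup_nonneg fun _ => abs_nonneg _

/-- Summation by parts on the line, with the signed weights of tied controls merged. Their total is
zero, so the boundary term drops out, and their partial sums are differences of the two empirical
distribution functions. -/
theorem abs_armMean_sub_le_eVariationOn_mul_cKS (P : Given 1 q n) (hne : ∀ d, (P.arm d).Nonempty)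
    (h : ℝ → ℝ) (hv : eVariationOn h Set.univ ≠ ⊤) :
    |P.armMean true (fun x => h (x 0)) - P.armMean false (fun x => h (x 0))| ≤
      (eVariationOn h Set.univ).toReal * P.cKS := by
  classical
  have hh : LocallyBoundedVariationOn h Set.univ :=
    BoundedVariationOn.locallyBoundedVariationOn hv
  set s : Finset ℝ := P.sub.image fun i => P.X i 0 with hs
  set w : ℝ → ℝ := fun x => ∑ i ∈ P.sub with P.X i 0 = x, P.signedWeight i with hw
  have hmap : ∀ i ∈ P.sub, P.X i 0 ∈ s := fun i hi => Finset.mem_image_of_mem _ hi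
  have hfib : ∀ g : ℝ → ℝ, ∑ x ∈ s, w x * g x = ∑ i ∈ P.sub, P.signedWeight i * g (P.X i 0) := by
    intro g
    rw [← Finset.sum_fiberwise_of_maps_to hmap]
    refine Finset.sum_congr rfl fun x _ => ?_
    rw [hw, Finset.sum_mul]
    refine Finset.sum_congr rfl fun i hi => ?_
    rw [(Finset.mem_filter.1 hi).2]
  have hsum : ∑ x ∈ s, w x = 0 := by
    have h1 := hfib fun _ => 1
    simp only [mul_one] at h1
    have h2 := P.armMean_sub_armMean fun _ => 1
    simp only [mul_one, armMean_one _ (hne _), sub_self] at h2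
    rw [h1, ← h2]
  have hpart : ∀ t ∈ s, |∑ x ∈ s with x ≤ t, w x| ≤ P.cKS := by
    intro t _
    have h1 := P.abs_armMean_sub_le_cKS t
    rw [armMean_sub_armMean] at h1
    rw [Finset.sum_filter]
    convert h1 using 2
    calc _ = ∑ x ∈ s, w x * (if x ≤ t then 1 else 0) := by simp
      _ = _ := by
        rw [hfib]
        refine Finset.sum_congr rfl fun i _ => ?_
        simp [Set.indicator_apply]
  have hsne : s.Nonempty := by
    obtain ⟨i, hi⟩ := hne true
    exact ⟨_, hmap i (P.arm_subset _ hi)⟩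
  have hle : s.min' hsne ≤ s.max' hsne := Finset.min'_le_max' _ _
  have hmain := abs_sum_mul_sub_le_of_partial_sums h (variationOnFromTo h Set.univ 0)
    (abs_sub_le_variationOnFromTo_sub hh) P.cKS_nonneg w s hpart _ _ hle
    fun x hx => ⟨Finset.min'_le _ _ hx, Finset.le_max' _ _ hx⟩
  rw [hsum, zero_mul, sub_zero, hfib, ← armMean_sub_armMean P (fun x => h (x 0))] at hmain
  refine hmain.trans ?_
  rw [mul_comm]
  refine mul_le_mul_of_nonneg_right ?_ P.cKS_nonneg
  rw [← variationOnFromTo.add hh (Set.mem_univ 0) (Set.mem_univ (s.min' hsne))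
    (Set.mem_univ (s.max' hsne)), add_sub_cancel_left, variationOnFromTo.eq_of_le _ _ hle]
  exact ENNReal.toReal_mono hv (eVariationOn.mono _ (Set.subset_univ _))

/-- The bound holds for every extension and so passes to the infimum of the variations. Since
`toReal` sends ∞ to 0, positivity of the product is what rules out an infinite infimum; it also
permits division by the imbalance. -/
theorem abs_armMean_dev_le_ks (P : Given 1 q n) (hne : ∀ d, (P.arm d).Nonempty)
    (hpos : 0 < P.mKS * P.cKS) :
    |P.armMean true P.dev - P.armMean false P.dev| ≤ P.mKS * P.cKS := by
  have hc : 0 < P.cKS := lt_of_le_of_ne P.cKS_nonneg fun h => by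
    rw [← h, mul_zero] at hpos; exact lt_irrefl _ hpos
  rw [← div_le_iff₀ hc, mKS]
  set V := ⨅ h ∈ {h : ℝ → ℝ | Continuous h ∧ (∃ B : ℝ, ∀ x, |h x| ≤ B) ∧
    ∀ i ∈ P.sub, h (P.X i 0) = P.dev (P.X i)}, eVariationOn h Set.univ with hV
  have hVtop : V ≠ ⊤ := by
    intro h
    rw [mKS, ← hV, h] at hpos
    simp at hpos
  rw [← ENNReal.ofReal_le_iff_le_toReal hVtop]
  refine le_iInf₂ fun h hh => ?_
  by_cases hv : eVariationOn h Set.univ = ⊤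
  · rw [hv]; exact le_top
  rw [ENNReal.ofReal_le_iff_le_toReal hv, div_le_iff₀ hc]
  have := P.abs_armMean_sub_le_eVariationOn_mul_cKS hne h hv
  rwa [P.armMean_congr (d := true) fun i hi => hh.2.2 i (P.arm_subset _ hi),
    P.armMean_congr (d := false) fun i hi => hh.2.2 i (P.arm_subset _ hi)] at this

theorem cMKW_nonneg : 0 ≤ P.cMKW := ENNReal.toReal_nonneg

/-- A positive `toReal` certifies that the supremum of the slopes is finite; at ∞ the real value
would be 0 and the bound could fail. -/
theorem abs_dev_sub_le_mMKW (hm : 0 < P.mMKW) {x y : Ctrl p} (hx : x ∈ P.X '' P.sub)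
    (hy : y ∈ P.X '' P.sub) : |P.dev x - P.dev y| ≤ P.mMKW * ‖x - y‖ := by
  by_cases hxy : x = y
  · simp [hxy]
  have hpos : 0 < ‖x - y‖ := norm_pos_iff.2 (sub_ne_zero.2 hxy)
  have htop := (ENNReal.toReal_pos_iff.1 hm).2.ne
  rw [← div_le_iff₀ hpos, mMKW, ← ENNReal.ofReal_le_iff_le_toReal htop]
  exact le_iSup₂ (f := fun (x : Ctrl p × Ctrl p)
    (_ : x ∈ {x : Ctrl p × Ctrl p | x.1 ≠ x.2 ∧ x.1 ∈ P.X '' P.sub ∧ x.2 ∈ P.X '' P.sub}) =>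
    ENNReal.ofReal (|P.dev x.1 - P.dev x.2| / ‖x.1 - x.2‖)) (x, y) ⟨hxy, hx, hy⟩

theorem empirical_compl_image (d : Bool) : P.empirical d (P.X '' P.sub)ᶜ = 0 := by
  have hms : MeasurableSet (P.X '' P.sub)ᶜ := (P.sub.finite_toSet.image _).measurableSet.compl
  simp only [empirical, Measure.smul_apply, Measure.finsetSum_apply, smul_eq_mul]
  rw [Finset.sum_eq_zero, mul_zero]
  intro i hi
  rw [Measure.dirac_apply' _ hms]
  simp only [Set.indicator_apply_eq_zero]
  intro h
  exact absurd ⟨i, P.arm_subset _ hi, rfl⟩ h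

/-- The easy half of Kantorovich-Rubinstein duality: any coupling turns the mean difference into an
integral of increments, over a finite set of points where the Lipschitz bound is available. -/
theorem abs_armMean_dev_le_mkw (hne : ∀ d, (P.arm d).Nonempty) (hpos : 0 < P.mMKW * P.cMKW) :
    |P.armMean true P.dev - P.armMean false P.dev| ≤ P.mMKW * P.cMKW := by
  have hm : 0 < P.mMKW := lt_of_le_of_ne ENNReal.toReal_nonneg fun h => by
    rw [← h, zero_mul] at hpos; exact lt_irrefl _ hpos
  have hc : 0 < P.cMKW := lt_of_le_of_ne ENNReal.toReal_nonneg fun h => by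
    rw [← h, mul_zero] at hpos; exact lt_irrefl _ hpos
  have htop := (ENNReal.toReal_pos_iff.1 hc).2.ne
  rw [← div_le_iff₀' hm, cMKW, ← ENNReal.ofReal_le_iff_le_toReal htop]
  refine le_iInf₂ fun π hπ => ?_
  obtain ⟨h1, h2⟩ := hπ
  have := P.isProbabilityMeasure_empirical (hne true)
  have hπp : IsProbabilityMeasure π := by
    constructor
    have : π.map Prod.fst Set.univ = 1 := by rw [h1]; exact measure_univ
    rwa [Measure.map_apply measurable_fst MeasurableSet.univ, Set.preimage_univ] at this
  set A := P.X '' P.sub with hA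
  have hfin : A.Finite := P.sub.finite_toSet.image _
  have hAm : MeasurableSet A := hfin.measurableSet
  -- `dev` need not be measurable. Only its values on the finite set A matter, and cut off outside A
  -- it is measurable and bounded.
  set g := A.indicator P.dev with hg
  have hgm : Measurable g := by
    refine (measurable_zero (α := ℝ)).measurable_of_countable_ne (hfin.countable.mono ?_)
    intro x hx
    by_contra hxA
    exact hx (by simp [hg, hxA])
  have hgb : ∃ C, ∀ x, |g x| ≤ C := by
    obtain ⟨C, hC⟩ := (hfin.image fun x => |P.dev x|).bddAbove
    refine ⟨max C 0, fun x => ?_⟩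
    by_cases hx : x ∈ A
    · rw [hg, Set.indicator_of_mem hx]
      exact (hC ⟨x, hx, rfl⟩).trans (le_max_left _ _)
    · rw [hg, Set.indicator_of_notMem hx, abs_zero]
      exact le_max_right _ _
  obtain ⟨C, hC⟩ := hgb
  have hmean : ∀ d, P.armMean d P.dev = ∫ x, g x ∂(P.empirical d) := by
    intro d
    rw [integral_empirical]
    refine P.armMean_congr fun i hi => ?_
    rw [hg, Set.indicator_of_mem]
    exact ⟨i, P.arm_subset _ hi, rfl⟩
  have hint1 : Integrable (fun x : Ctrl p × Ctrl p => g x.1) π :=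
    Integrable.of_bound (hgm.comp measurable_fst).aestronglyMeasurable C
      (ae_of_all _ fun x => hC x.1)
  have hint2 : Integrable (fun x : Ctrl p × Ctrl p => g x.2) π :=
    Integrable.of_bound (hgm.comp measurable_snd).aestronglyMeasurable C
      (ae_of_all _ fun x => hC x.2)
  have hdiff : P.armMean true P.dev - P.armMean false P.dev = ∫ x, (g x.1 - g x.2) ∂π := by
    rw [integral_sub hint1 hint2, hmean, hmean, ← h1, ← h2,
      integral_map measurable_fst.aemeasurable hgm.aestronglyMeasurable,
      integral_map measurable_snd.aemeasurable hgm.aestronglyMeasurable]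
  have hae1 : ∀ᵐ x ∂π, x.1 ∈ A := by
    have := P.empirical_compl_image true
    rw [← h1, Measure.map_apply measurable_fst hAm.compl] at this
    exact this
  have hae2 : ∀ᵐ x ∂π, x.2 ∈ A := by
    have := P.empirical_compl_image false
    rw [← h2, Measure.map_apply measurable_snd hAm.compl] at this
    exact this
  have hmul : ENNReal.ofReal |P.armMean true P.dev - P.armMean false P.dev| ≤
      ENNReal.ofReal P.mMKW * ∫⁻ x, ENNReal.ofReal ‖x.1 - x.2‖ ∂π := by
    rw [hdiff, ← Real.norm_eq_abs]
    calc ENNReal.ofReal ‖∫ x, (g x.1 - g x.2) ∂π‖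
        ≤ ENNReal.ofReal (∫ x, ‖g x.1 - g x.2‖ ∂π) :=
          ENNReal.ofReal_le_ofReal (norm_integral_le_integral_norm _)
      _ = ∫⁻ x, ENNReal.ofReal ‖g x.1 - g x.2‖ ∂π :=
          ofReal_integral_eq_lintegral_ofReal (hint1.sub hint2).norm
            (ae_of_all _ fun _ => norm_nonneg _)
      _ ≤ ∫⁻ x, ENNReal.ofReal P.mMKW * ENNReal.ofReal ‖x.1 - x.2‖ ∂π := by
          refine lintegral_mono_ae ?_
          filter_upwards [hae1, hae2] with x hx1 hx2
          rw [← ENNReal.ofReal_mul hm.le, hg, Set.indicator_of_mem hx1, Set.indicator_of_mem hx2]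
          exact ENNReal.ofReal_le_ofReal (P.abs_dev_sub_le_mMKW hm hx1 hx2)
      _ = _ := lintegral_const_mul' _ _ ENNReal.ofReal_ne_top
  rw [ENNReal.ofReal_div_of_pos hm]
  exact ENNReal.div_le_of_le_mul' hmul

theorem sum_mul_le_abs_mul_cMD {J : ℕ} (r : Ctrl p → Fin J → ℝ) (ζ : Fin J → ℝ) :
    |P.armMean true (fun x => r x ⬝ᵥ ζ) - P.armMean false (fun x => r x ⬝ᵥ ζ)| ≤
      ∑ j, |ζ j| * P.cMD r j := by
  have h1 : P.armMean true (fun x => r x ⬝ᵥ ζ) - P.armMean false (fun x => r x ⬝ᵥ ζ) =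
      ∑ j, ζ j * (P.armMean true (fun x => r x j) - P.armMean false (fun x => r x j)) := by
    simp only [armMean_sub_armMean, dotProduct, Finset.mul_sum]
    rw [Finset.sum_comm]
    refine Finset.sum_congr rfl fun j _ => Finset.sum_congr rfl fun i _ => by ring
  rw [h1]
  refine (Finset.abs_sum_le_sum_abs _ _).trans (Finset.sum_le_sum fun j _ => ?_)
  rw [abs_mul, cMD, integral_empirical, integral_empirical]

/-- With zero slacks the linear function of the summaries lies above σ·`dev` on the treated and
below it on the untreated, so it has the larger mean difference. -/
theorem mul_armMean_dev_le_of_sepFeasible {J : ℕ} {r : Ctrl p → Fin J → ℝ} {σ : ℝ}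
    (hσ : |σ| = 1) {ζ : Fin J → ℝ} (h : P.SepFeasible r σ ζ 0) :
    σ * (P.armMean true P.dev - P.armMean false P.dev) ≤ ∑ j, |ζ j| * P.cMD r j := by
  classical
  have hsupp : ∀ d, ∀ i ∈ P.arm d, P.X i ∈ P.supp d := fun d i hi => by
    simp only [supp, Finset.mem_image]
    exact ⟨i, hi, rfl⟩
  have h1 : σ * P.armMean true P.dev ≤ σ * P.armMean true fun x => r x ⬝ᵥ ζ := by
    simp only [armMean]
    rw [mul_left_comm, mul_left_comm σ]
    refine mul_le_mul_of_nonneg_left ?_ (by positivity)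
    rw [Finset.mul_sum, Finset.mul_sum]
    refine Finset.sum_le_sum fun i hi => ?_
    simpa using h.1 _ (hsupp _ i hi)
  have h2 : σ * (P.armMean false fun x => r x ⬝ᵥ ζ) ≤ σ * P.armMean false P.dev := by
    simp only [armMean]
    rw [mul_left_comm, mul_left_comm σ]
    refine mul_le_mul_of_nonneg_left ?_ (by positivity)
    rw [Finset.mul_sum, Finset.mul_sum]
    refine Finset.sum_le_sum fun i hi => ?_
    simpa using h.2 _ (hsupp _ i hi)
  refine le_trans ?_ (P.sum_mul_le_abs_mul_cMD r ζ)
  rw [← one_mul |_|, ← hσ, ← abs_mul]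
  refine le_trans ?_ (le_abs_self _)
  rw [mul_sub, mul_sub]
  linarith

theorem cMD_nonneg {J : ℕ} (r : Ctrl p → Fin J → ℝ) (j : Fin J) : 0 ≤ P.cMD r j := abs_nonneg _

end Given

theorem BalanceMetric.imbalance_nonneg {p q n : ℕ} (B : BalanceMetric p) (P : Given p q n)
    (j : Fin B.dim) : 0 ≤ B.imbalance P j := by
  cases B with
  | ks => exact P.cKS_nonneg
  | mkw => exact P.cMKW_nonneg
  | md J r L => exact P.cMD_nonneg _ _

/-- The difference between the regression estimand and the parameter of interest is bounded by
the product of misspecification and imbalance. -/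
theorem abs_theta_sub_tau_le {p q n : ℕ} (B : BalanceMetric p) (P : Given p q n) {lam : ℝ}
    (hlam : 0 < lam) (hG : ∀ x, lam * (x ⬝ᵥ x) ≤ x ⬝ᵥ P.Gam *ᵥ x) {m : Fin B.dim → ℝ}
    (hm : B.IsMisspec P m) (hpos : 0 < m ⬝ᵥ B.imbalance P) :
    |P.theta 1 - P.tau| ≤ m ⬝ᵥ B.imbalance P := by
  have hne := P.arm_nonempty hlam hG
  rw [P.theta_sub_tau (isUnit_of_quadForm_le hlam hG) (hne true)]
  cases B with
  | ks =>
    have hm' : m ⬝ᵥ BalanceMetric.ks.imbalance P = P.mKS * P.cKS := by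
      rw [show m = fun _ => P.mKS from funext hm]
      exact Fin.sum_univ_one _
    rw [hm'] at hpos ⊢
    exact P.abs_armMean_dev_le_ks hne hpos
  | mkw =>
    have hm' : m ⬝ᵥ BalanceMetric.mkw.imbalance P = P.mMKW * P.cMKW := by
      rw [show m = fun _ => P.mMKW from funext hm]
      exact Fin.sum_univ_one _
    rw [hm'] at hpos ⊢
    exact P.abs_armMean_dev_le_mkw hne hpos
  | md J r L =>
    obtain ⟨ζ₁, ζ₂, h1, h2, hmj⟩ := hm
    have hle : ∀ ζ : Fin J → ℝ, (∀ j : Fin J, |ζ j| ≤ m j) →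
        ∑ j : Fin J, |ζ j| * P.cMD (r n P.obs) j ≤
          m ⬝ᵥ (BalanceMetric.md J r L).imbalance P := fun ζ hζ =>
      Finset.sum_le_sum fun j _ => mul_le_mul_of_nonneg_right (hζ j) (P.cMD_nonneg _ _)
    -- The signs +1 and -1 bound the mean difference from above and from below.
    have e1 := P.mul_armMean_dev_le_of_sepFeasible (by simp) h1.1
    have e2 := P.mul_armMean_dev_le_of_sepFeasible (by simp) h2.1
    have f1 := hle ζ₁ fun j => (le_max_left _ _).trans_eq (hmj j).symm
    have f2 := hle ζ₂ fun j => (le_max_right _ _).trans_eq (hmj j).symm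
    rw [abs_le]
    constructor <;> linarith

/-! ### A central limit theorem for triangular arrays -/

/-- Telescoping: factors are exchanged one at a time, while all others stay in the unit disc. This
replaces characteristic functions by Gaussian ones factor by factor. -/
theorem norm_prod_sub_prod_le_sum {ι : Type*} (s : Finset ι) (a b : ι → ℂ)
    (ha : ∀ i ∈ s, ‖a i‖ ≤ 1) (hb : ∀ i ∈ s, ‖b i‖ ≤ 1) :
    ‖∏ i ∈ s, a i - ∏ i ∈ s, b i‖ ≤ ∑ i ∈ s, ‖a i - b i‖ := by
  classical
  induction s using Finset.induction_on with
  | empty => simp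
  | insert j s hj ih =>
    have ih' := ih (fun i hi => ha i (Finset.mem_insert_of_mem hi))
      fun i hi => hb i (Finset.mem_insert_of_mem hi)
    have hprod : ‖∏ i ∈ s, b i‖ ≤ 1 := by
      rw [norm_prod]
      exact Finset.prod_le_one (fun _ _ => norm_nonneg _)
        fun i hi => hb i (Finset.mem_insert_of_mem hi)
    rw [Finset.prod_insert hj, Finset.prod_insert hj, Finset.sum_insert hj]
    calc ‖a j * ∏ i ∈ s, a i - b j * ∏ i ∈ s, b i‖
        = ‖a j * (∏ i ∈ s, a i - ∏ i ∈ s, b i) + (a j - b j) * ∏ i ∈ s, b i‖ := by ring_nf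
      _ ≤ ‖a j‖ * ‖∏ i ∈ s, a i - ∏ i ∈ s, b i‖ + ‖a j - b j‖ * ‖∏ i ∈ s, b i‖ := by
          refine (norm_add_le _ _).trans ?_
          rw [norm_mul, norm_mul]
      _ ≤ 1 * ‖∏ i ∈ s, a i - ∏ i ∈ s, b i‖ + ‖a j - b j‖ * 1 := by
          gcongr
          exact ha j (Finset.mem_insert_self _ _)
      _ ≤ _ := by linarith

/-- The constant 4 is crude but uniform in y. For |y| ≤ 1 it absorbs the Taylor remainder; for |y| ≥
1 the four terms are at most 1 + 1 + 1 + 1/2 times |y|³. -/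
theorem norm_exp_mul_I_taylor_two_le (y : ℝ) :
    ‖Complex.exp (y * Complex.I) - 1 - y * Complex.I + (y : ℂ) ^ 2 / 2‖ ≤ 4 * |y| ^ 3 := by
  rcases le_total |y| 1 with h | h
  · have hn : ‖(y : ℂ) * Complex.I‖ = |y| := by simp
    have := Complex.exp_bound (x := y * Complex.I) (by rw [hn]; exact h) (n := 3) (by norm_num)
    rw [hn] at this
    have heq : Complex.exp (y * Complex.I) - 1 - y * Complex.I + (y : ℂ) ^ 2 / 2 =
        Complex.exp (y * Complex.I) -
          ∑ m ∈ Finset.range 3, ((y : ℂ) * Complex.I) ^ m / (m.factorial : ℂ) := by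
      simp only [Finset.sum_range_succ, Finset.sum_range_zero, mul_pow, Complex.I_sq]
      simp
      ring
    rw [heq]
    refine this.trans ?_
    rw [mul_comm 4]
    refine mul_le_mul_of_nonneg_left ?_ (by positivity)
    norm_num [Nat.factorial]
  · have h1 : ‖Complex.exp (y * Complex.I) - 1 - y * Complex.I + (y : ℂ) ^ 2 / 2‖ ≤
        1 + 1 + |y| + |y| ^ 2 / 2 := by
      refine (norm_add_le _ _).trans (add_le_add ((norm_sub_le _ _).trans (add_le_add
        ((norm_sub_le _ _).trans (add_le_add ?_ ?_)) ?_)) ?_)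
      · rw [Complex.norm_exp_ofReal_mul_I]
      · simp
      · simp
      · simp
    refine h1.trans ?_
    have h2 : |y| ≤ |y| ^ 2 := by nlinarith
    have h3 : |y| ^ 2 ≤ |y| ^ 3 := by nlinarith [sq_nonneg |y|]
    linarith

theorem abs_exp_neg_sub_le {x : ℝ} (hx : 0 ≤ x) : |Real.exp (-x) - (1 - x)| ≤ x ^ 2 := by
  rcases le_total x 1 with h | h
  · have := Real.abs_exp_sub_one_sub_id_le (x := -x) (by rwa [abs_neg, abs_of_nonneg hx])
    rw [show Real.exp (-x) - (1 - x) = Real.exp (-x) - 1 - -x by ring]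
    simpa using this
  · have h1 := Real.one_sub_le_exp_neg x
    have h2 : Real.exp (-x) ≤ 1 := by simpa using hx
    rw [abs_of_nonneg (by linarith)]
    nlinarith

section Moments

variable {Ω : Type*} {mΩ : MeasurableSpace Ω} {μ : Measure Ω} [IsProbabilityMeasure μ]

/-- Pointwise |x|^k ≤ 1 + x⁴ for k ≤ 4, so fourth moments control all lower ones. -/
theorem integrable_pow_of_integrable_pow_four {X : Ω → ℝ} (hX : AEStronglyMeasurable X μ)
    (h : Integrable (fun ω => X ω ^ 4) μ) {k : ℕ} (hk : k ≤ 4) :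
    Integrable (fun ω => |X ω| ^ k) μ := by
  refine ((integrable_const (1 : ℝ)).add h).mono' (hX.norm.pow k) (ae_of_all _ fun ω => ?_)
  simp only [Pi.add_apply, norm_pow, Real.norm_eq_abs, abs_abs]
  have h4 : X ω ^ 4 = |X ω| ^ 4 := by rw [← abs_pow, abs_of_nonneg (by positivity)]
  rw [h4]
  rcases le_total |X ω| 1 with h1 | h1
  · have := pow_le_one₀ (n := k) (abs_nonneg _) h1
    have : 0 ≤ |X ω| ^ 4 := by positivity
    linarith
  · have := pow_le_pow_right₀ h1 hk
    linarith

theorem integral_pow_le_of_integral_pow_four_le {X : Ω → ℝ} (hX : AEStronglyMeasurable X μ)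
    (h : Integrable (fun ω => X ω ^ 4) μ) {C : ℝ} (hC : ∫ ω, X ω ^ 4 ∂μ ≤ C) {k : ℕ} (hk : k ≤ 4) :
    ∫ ω, |X ω| ^ k ∂μ ≤ 1 + C := by
  calc ∫ ω, |X ω| ^ k ∂μ ≤ ∫ ω, (1 + X ω ^ 4) ∂μ := by
        refine integral_mono (integrable_pow_of_integrable_pow_four hX h hk)
          ((integrable_const (1 : ℝ)).add h) fun ω => ?_
        simp only
        have h4 : X ω ^ 4 = |X ω| ^ 4 := by rw [← abs_pow, abs_of_nonneg (by positivity)]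
        rw [h4]
        rcases le_total |X ω| 1 with h1 | h1
        · have := pow_le_one₀ (n := k) (abs_nonneg _) h1
          have : 0 ≤ |X ω| ^ 4 := by positivity
          linarith
        · have := pow_le_pow_right₀ h1 hk
          linarith
    _ = 1 + ∫ ω, X ω ^ 4 ∂μ := by
        rw [integral_add (integrable_const _) h]; simp
    _ ≤ 1 + C := by linarith

/-- Both functions are compared with 1 - u²v/2, v the second moment: the characteristic function
through its second-order expansion, whose linear term vanishes for a centred variable, the
exponential through |exp(-x) - (1 - x)| ≤ x². -/
theorem norm_charFun_sub_exp_le {X : Ω → ℝ} (hX : AEMeasurable X μ)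
    (h : Integrable (fun ω => X ω ^ 4) μ) {C : ℝ} (hC : ∫ ω, X ω ^ 4 ∂μ ≤ C)
    (h0 : ∫ ω, X ω ∂μ = 0) (u : ℝ) :
    ‖charFun (μ.map X) u - Complex.exp ((-(u ^ 2 * ∫ ω, X ω ^ 2 ∂μ) / 2 : ℝ) : ℂ)‖ ≤
      4 * (1 + C) * |u| ^ 3 + (1 + C) ^ 2 * |u| ^ 4 := by
  set v := ∫ ω, X ω ^ 2 ∂μ with hv
  have hXs := hX.aestronglyMeasurable
  have i1 : Integrable X μ := by
    have := integrable_pow_of_integrable_pow_four hXs h (k := 1) (by norm_num)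
    simp only [pow_one] at this
    exact (integrable_norm_iff hXs).1 this
  have i2 : Integrable (fun ω => X ω ^ 2) μ := by
    simpa only [sq_abs] using integrable_pow_of_integrable_pow_four hXs h (k := 2) (by norm_num)
  have i3 := integrable_pow_of_integrable_pow_four hXs h (k := 3) (by norm_num)
  have b3 := integral_pow_le_of_integral_pow_four_le hXs h hC (k := 3) (by norm_num)
  have b2 : v ≤ 1 + C := by
    simpa only [sq_abs] using integral_pow_le_of_integral_pow_four_le hXs h hC (k := 2) (by norm_num)
  have v0 : 0 ≤ v := integral_nonneg fun ω => sq_nonneg _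
  have ie : Integrable (fun ω => Complex.exp ((u * X ω : ℝ) * Complex.I)) μ := by
    refine Integrable.of_bound ?_ 1 (ae_of_all _ fun ω => ?_)
    · exact (Complex.continuous_exp.comp (by fun_prop : Continuous fun x : ℝ =>
        ((u * x : ℝ) : ℂ) * Complex.I)).comp_aestronglyMeasurable hXs
    · rw [Complex.norm_exp_ofReal_mul_I]
  have ic1 : Integrable (fun ω => ((u * X ω : ℝ) : ℂ) * Complex.I) μ :=
    ((i1.const_mul u).ofReal (𝕜 := ℂ)).mul_const _
  have ic2 : Integrable (fun ω => ((u * X ω : ℝ) : ℂ) ^ 2 / 2) μ := by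
    have := ((i2.const_mul (u ^ 2 / 2)).ofReal (𝕜 := ℂ))
    refine this.congr (ae_of_all _ fun ω => ?_)
    simp
    ring
  have h1 : charFun (μ.map X) u - (1 - (u ^ 2 * v / 2 : ℝ)) =
      ∫ ω, (Complex.exp ((u * X ω : ℝ) * Complex.I) - 1 - (u * X ω : ℝ) * Complex.I +
        ((u * X ω : ℝ) : ℂ) ^ 2 / 2) ∂μ := by
    have is1 : Integrable (fun ω => Complex.exp ((u * X ω : ℝ) * Complex.I) - 1) μ :=
      ie.sub (integrable_const _)
    have is2 : Integrable (fun ω => Complex.exp ((u * X ω : ℝ) * Complex.I) - 1 -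
        (u * X ω : ℝ) * Complex.I) μ := is1.sub ic1
    rw [integral_add is2 ic2, integral_sub is1 ic1, integral_sub ie (integrable_const _)]
    have e1 : ∫ ω, ((u * X ω : ℝ) : ℂ) * Complex.I ∂μ = 0 := by
      rw [integral_mul_const, integral_complex_ofReal, integral_const_mul, h0]; simp
    have e2 : ∫ ω, ((u * X ω : ℝ) : ℂ) ^ 2 / (2 : ℂ) ∂μ = ((u ^ 2 * v / 2 : ℝ) : ℂ) := by
      rw [hv, mul_div_right_comm, ← integral_const_mul, ← integral_complex_ofReal]
      refine integral_congr_ae (ae_of_all _ fun ω => ?_)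
      simp
      ring
    rw [e1, e2, charFun_apply_real, integral_map hX (by fun_prop)]
    simp
    ring
  have h2 : ‖charFun (μ.map X) u - (1 - (u ^ 2 * v / 2 : ℝ))‖ ≤ 4 * (1 + C) * |u| ^ 3 := by
    rw [h1]
    calc _ ≤ ∫ ω, 4 * |u| ^ 3 * |X ω| ^ 3 ∂μ := by
          refine norm_integral_le_of_norm_le (i3.const_mul _) (ae_of_all _ fun ω => ?_)
          refine (norm_exp_mul_I_taylor_two_le _).trans_eq ?_
          rw [abs_mul]; ring
      _ = 4 * |u| ^ 3 * ∫ ω, |X ω| ^ 3 ∂μ := integral_const_mul _ _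
      _ ≤ 4 * |u| ^ 3 * (1 + C) := by gcongr
      _ = _ := by ring
  have h3 : ‖(1 - (u ^ 2 * v / 2 : ℝ) : ℂ) - Complex.exp ((-(u ^ 2 * v) / 2 : ℝ) : ℂ)‖ ≤
      (1 + C) ^ 2 * |u| ^ 4 := by
    have := abs_exp_neg_sub_le (x := u ^ 2 * v / 2) (by positivity)
    rw [norm_sub_rev, ← Complex.ofReal_exp, ← Complex.ofReal_one, ← Complex.ofReal_sub,
      ← Complex.ofReal_sub, Complex.norm_real, Real.norm_eq_abs, neg_div]
    refine this.trans ?_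
    have hu : |u| ^ 4 = (u ^ 2) ^ 2 := by rw [← sq_abs u]; ring
    rw [hu]
    have hv2 : v ^ 2 ≤ (1 + C) ^ 2 := pow_le_pow_left₀ v0 b2 2
    have hu2 : 0 ≤ (u ^ 2) ^ 2 := by positivity
    have := mul_le_mul_of_nonneg_right hv2 hu2
    have h0' : 0 ≤ v ^ 2 * (u ^ 2) ^ 2 := by positivity
    calc (u ^ 2 * v / 2) ^ 2 = v ^ 2 * (u ^ 2) ^ 2 / 4 := by ring
      _ ≤ _ := by linarith
  calc _ = ‖(charFun (μ.map X) u - (1 - (u ^ 2 * v / 2 : ℝ))) +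
        ((1 - (u ^ 2 * v / 2 : ℝ) : ℂ) - Complex.exp ((-(u ^ 2 * v) / 2 : ℝ) : ℂ))‖ := by
          congr 1; ring
    _ ≤ _ := (norm_add_le _ _).trans (add_le_add h2 h3)

end Moments

/-- Central limit theorem for row-wise independent triangular arrays with bounded fourth moments
and average variances bounded away from zero. -/
theorem tendsto_measureReal_normalized_sum_le {Ω ι : ℕ → Type*} [∀ n, MeasurableSpace (Ω n)]
    (μ : ∀ n, Measure (Ω n)) [∀ n, IsProbabilityMeasure (μ n)] (s : ∀ n, Finset (ι n))
    (X : ∀ n, ι n → Ω n → ℝ) (hX : ∀ n i, Measurable (X n i)) (hind : ∀ n, iIndepFun (X n) (μ n))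
    (hs : Tendsto (fun n => (s n).card) atTop atTop) {C c : ℝ} (hc : 0 < c)
    (h0 : ∀ᶠ n in atTop, ∀ i ∈ s n, ∫ ω, X n i ω ∂(μ n) = 0)
    (h4 : ∀ᶠ n in atTop, ∀ i ∈ s n, Integrable (fun ω => X n i ω ^ 4) (μ n) ∧
      ∫ ω, X n i ω ^ 4 ∂(μ n) ≤ C)
    (σ : ℕ → ℝ) (hσ0 : ∀ n, 0 ≤ σ n)
    (hσ : ∀ᶠ n in atTop, σ n ^ 2 = ∑ i ∈ s n, ∫ ω, X n i ω ^ 2 ∂(μ n))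
    (hσc : ∀ᶠ n in atTop, c * (s n).card ≤ σ n ^ 2) (z : ℝ) :
    Tendsto (fun n => (μ n).real {ω | (σ n)⁻¹ * ∑ i ∈ s n, X n i ω ≤ z}) atTop (𝓝 (Phi z)) := by
  set S : ∀ n, Ω n → ℝ := fun n ω => (σ n)⁻¹ * ∑ i ∈ s n, X n i ω with hS
  have hSm : ∀ n, Measurable (S n) := fun n =>
    (Finset.measurable_fun_sum _ fun i _ => hX n i).const_mul _
  obtain ⟨ρ, hρ⟩ : ∃ ρ : ℕ → ProbabilityMeasure ℝ, ∀ n, (ρ n : Measure ℝ) = (μ n).map (S n) :=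
    ⟨fun n => ⟨(μ n).map (S n), Measure.isProbabilityMeasure_map (hSm n).aemeasurable⟩,
      fun _ => rfl⟩
  obtain ⟨γ, hγ⟩ : ∃ γ : ProbabilityMeasure ℝ, (γ : Measure ℝ) = gaussianReal 0 1 :=
    ⟨⟨gaussianReal 0 1, inferInstance⟩, rfl⟩
  have hC : 0 ≤ 1 + |C| := by positivity
  have hlim : Tendsto ρ atTop (𝓝 γ) := by
    rw [ProbabilityMeasure.tendsto_iff_tendsto_charFun]
    intro t
    simp only [hρ, hγ]
    rw [tendsto_iff_norm_sub_tendsto_zero]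
    have hbound : ∀ᶠ n in atTop, ‖charFun ((μ n).map (S n)) t - charFun (gaussianReal 0 1) t‖ ≤
        4 * (1 + |C|) * (|t| / √c) ^ 3 * (√((s n).card : ℝ))⁻¹ +
          (1 + |C|) ^ 2 * (|t| / √c) ^ 4 * ((s n).card : ℝ)⁻¹ := by
      filter_upwards [h0, h4, hσ, hσc, hs.eventually_gt_atTop 0] with n h0 h4 hσ hσc hpos
      have hN : (0 : ℝ) < (s n).card := by exact_mod_cast hpos
      have hσpos : 0 < σ n := lt_of_le_of_ne (hσ0 n) fun h => by
        rw [← h] at hσc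
        have := mul_pos hc hN
        norm_num at hσc
        linarith
      -- The rescaled argument is of order N^{-1/2}, because σ ≥ √(cN). Hence N errors of order |u|³
      -- and |u|⁴ add up to O(N^{-1/2}).
      set u := (σ n)⁻¹ * t with hu
      have hus : |u| ≤ |t| / √c * (√((s n).card : ℝ))⁻¹ := by
        have : √c * √((s n).card : ℝ) ≤ σ n := by
          rw [← Real.sqrt_mul hc.le]
          exact Real.sqrt_le_iff.2 ⟨hσ0 n, hσc⟩
        rw [hu, abs_mul, abs_of_pos (inv_pos.2 hσpos), mul_comm, div_mul_eq_mul_div, ← div_eq_mul_inv,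
          ← div_eq_mul_inv, div_div, mul_comm (√((s n).card : ℝ))]
        gcongr
      have hchar : charFun ((μ n).map (S n)) t = ∏ i ∈ s n, charFun ((μ n).map (X n i)) u := by
        rw [hS]
        simp only
        rw [charFun_map_mul_comp (Finset.measurable_fun_sum _ fun i _ => hX n i).aemeasurable,
          ((hind n).restrict _).charFun_map_fun_finsetSum_eq_prod
            (fun i _ => (hX n i).aemeasurable)]
        simp [hu]
      -- As σ² is the sum of the variances, exp(-t²/2) splits into one Gaussian factor per summand.
      have hgauss : charFun (gaussianReal 0 1) t =
          ∏ i ∈ s n, Complex.exp ((-(u ^ 2 * ∫ ω, X n i ω ^ 2 ∂(μ n)) / 2 : ℝ) : ℂ) := by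
        rw [charFun_gaussianReal, ← Complex.exp_sum, ← Complex.ofReal_sum]
        congr 1
        rw [← Finset.sum_div, Finset.sum_neg_distrib, ← Finset.mul_sum, ← hσ, hu,
          show ((σ n)⁻¹ * t) ^ 2 * σ n ^ 2 = t ^ 2 by field_simp]
        push_cast
        simp
        ring
      rw [hchar, hgauss]
      calc _ ≤ ∑ i ∈ s n, ‖charFun ((μ n).map (X n i)) u -
            Complex.exp ((-(u ^ 2 * ∫ ω, X n i ω ^ 2 ∂(μ n)) / 2 : ℝ) : ℂ)‖ := by
            refine norm_prod_sub_prod_le_sum _ _ _ (fun i _ => ?_) fun i _ => ?_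
            · have := Measure.isProbabilityMeasure_map (μ := μ n) (hX n i).aemeasurable
              exact norm_charFun_le_one _
            · rw [Complex.norm_exp, Complex.ofReal_re, Real.exp_le_one_iff]
              have : 0 ≤ ∫ ω, X n i ω ^ 2 ∂(μ n) := integral_nonneg fun ω => sq_nonneg _
              have := mul_nonneg (sq_nonneg u) this
              linarith
        _ ≤ ∑ i ∈ s n, (4 * (1 + |C|) * |u| ^ 3 + (1 + |C|) ^ 2 * |u| ^ 4) :=
            Finset.sum_le_sum fun i hi => norm_charFun_sub_exp_le (hX n i).aemeasurable
              (h4 i hi).1 ((h4 i hi).2.trans (le_abs_self C)) (h0 i hi) u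
        _ = (s n).card * (4 * (1 + |C|) * |u| ^ 3 + (1 + |C|) ^ 2 * |u| ^ 4) := by
            rw [Finset.sum_const, nsmul_eq_mul]
        _ ≤ (s n).card * (4 * (1 + |C|) * (|t| / √c * (√((s n).card : ℝ))⁻¹) ^ 3 +
              (1 + |C|) ^ 2 * (|t| / √c * (√((s n).card : ℝ))⁻¹) ^ 4) := by gcongr
        _ = _ := by
            have hsq : ((s n).card : ℝ) = √((s n).card : ℝ) ^ 2 := (Real.sq_sqrt hN.le).symm
            have hsp : 0 < √((s n).card : ℝ) := Real.sqrt_pos.2 hN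
            generalize √((s n).card : ℝ) = r at hsq hsp
            rw [hsq]
            field_simp
    have hNt : Tendsto (fun n => ((s n).card : ℝ)) atTop atTop :=
      tendsto_natCast_atTop_atTop.comp hs
    refine squeeze_zero' (Eventually.of_forall fun n => norm_nonneg _) hbound ?_
    have e1 := (tendsto_inv_atTop_zero.comp (Real.tendsto_sqrt_atTop.comp hNt)).const_mul
      (4 * (1 + |C|) * (|t| / √c) ^ 3)
    have e2 := (tendsto_inv_atTop_zero.comp hNt).const_mul ((1 + |C|) ^ 2 * (|t| / √c) ^ 4)
    simpa using e1.add e2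
  -- The normal law has no atoms, so half-lines are continuity sets.
  have hfr : (γ : Measure ℝ) (frontier (Set.Iic z)) = 0 := by
    have := nullSingletonClass_gaussianReal (μ := 0) (v := 1) one_ne_zero
    rw [hγ, frontier_Iic]
    exact measure_singleton z
  have hP := (ENNReal.tendsto_toReal (measure_ne_top _ _)).comp
    (ProbabilityMeasure.tendsto_measure_of_null_frontier_of_tendsto' hlim hfr)
  have e : Phi z = ((γ : Measure ℝ) (Set.Iic z)).toReal := by
    rw [Phi, cdf_eq_real, hγ]; rfl
  rw [e]
  refine hP.congr fun n => ?_
  simp only [Function.comp, hρ]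
  rw [Measure.map_apply (hSm n) measurableSet_Iic]
  rfl

/-! ### Geometry of nearest neighbours -/

/-- Sets of bounded diameter can be coloured, with a number of colours depending on the diameter
only, in such a way that points of the same colour are close. -/
theorem exists_colouring {E : Type*} [NormedAddCommGroup E] [ProperSpace E] (M : ℝ) {ε : ℝ}
    (hε : 0 < ε) : ∃ t : Finset E, ∀ {ι : Type} (s : Finset ι) (x : ι → E),
      (∀ i ∈ s, ∀ j ∈ s, dist (x i) (x j) ≤ M) → ∃ φ : ι → E, (∀ i ∈ s, φ i ∈ t) ∧
        ∀ i ∈ s, ∀ j ∈ s, φ i = φ j → dist (x i) (x j) ≤ ε := by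
  obtain ⟨t, ht, hcov⟩ := Metric.totallyBounded_iff.1
    (isCompact_closedBall (0 : E) M).totallyBounded (ε / 2) (half_pos hε)
  refine ⟨ht.toFinset, fun {ι} s x hx => ?_⟩
  rcases s.eq_empty_or_nonempty with rfl | ⟨i₀, hi₀⟩
  · exact ⟨fun _ => 0, by simp, by simp⟩
  -- Translating one point to the origin moves the set into a fixed ball, so the same finite net
  -- serves every set of diameter at most M.
  have h1 : ∀ i ∈ s, ∃ y ∈ t, dist (x i - x i₀) y < ε / 2 := by
    intro i hi
    have : x i - x i₀ ∈ Metric.closedBall (0 : E) M := by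
      rw [mem_closedBall_zero_iff, ← dist_eq_norm]
      exact hx i hi i₀ hi₀
    simpa using hcov this
  choose! φ hφt hφ using h1
  refine ⟨φ, fun i hi => by simpa using hφt i hi, fun i hi j hj hij => ?_⟩
  have := dist_triangle_right (x i - x i₀) (x j - x i₀) (φ i)
  rw [dist_sub_right] at this
  have h2 := hφ i hi
  have h3 := hφ j hj
  rw [← hij] at h3
  linarith

theorem IsMetric.nonneg {E : Type} {ψ : E → E → ℝ} (h : IsMetric ψ) (x y : E) : 0 ≤ ψ x y := by
  have h1 := h.triangle x y x
  rw [(h.eq_zero_iff x x).2 rfl, h.symm y x] at h1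
  linarith

theorem treat_sub_treat_abs (d d' : Bool) : |treat d - treat d'| = if d = d' then 0 else 1 := by
  cases d <;> cases d' <;> simp [treat]

namespace Given

/-- All but a bounded number of units are matched to a close unit of the same arm. -/
theorem exists_card_not_close_match_le {p : ℕ} (M : ℝ) {K κ ε : ℝ} (hκ : 0 < κ) (hε : 0 < ε)
    {ψ : Ctrl p → Ctrl p → ℝ} (hψ : IsMetric ψ) (hdom : ∀ x y, ψ x y ≤ K * dist x y) :
    ∃ N : ℕ, ∀ {q n : ℕ} (P : Given p q n) (l : Fin n → Fin n), P.IsMatch ψ κ l →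
      (∀ d : Bool, ∀ i ∈ P.arm d, ∀ i' ∈ P.arm d, dist (P.X i) (P.X i') ≤ M) →
      (P.sub.filter fun i =>
        ¬((P.obs (l i)).2 = (P.obs i).2 ∧ ψ (P.X i) (P.X (l i)) ≤ ε)).card ≤ N := by
  classical
  -- Within Euclidean distance η, ψ is at most ε and strictly below κ. A nearby unit of the same arm
  -- then beats every unit of the other arm.
  set η := min (ε / (|K| + 1)) (κ / 2 / (|K| + 1)) with hη
  have hK : 0 < |K| + 1 := by positivity
  have hηpos : 0 < η := lt_min (by positivity) (by positivity)
  have hKη : ∀ x y : Ctrl p, dist x y ≤ η → ψ x y ≤ ε ∧ ψ x y < κ := by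
    intro x y hxy
    have h1 : ψ x y ≤ (|K| + 1) * η := by
      calc ψ x y ≤ K * dist x y := hdom x y
        _ ≤ (|K| + 1) * dist x y := by
          gcongr
          linarith [le_abs_self K]
        _ ≤ _ := by gcongr
    have h2 : (|K| + 1) * η ≤ ε := by
      rw [mul_comm, ← le_div_iff₀ hK]; exact min_le_left _ _
    have h3 : (|K| + 1) * η ≤ κ / 2 := by
      rw [mul_comm, ← le_div_iff₀ hK]; exact min_le_right _ _
    exact ⟨h1.trans h2, by linarith⟩
  obtain ⟨t, ht⟩ := exists_colouring (E := Ctrl p) M hηpos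
  refine ⟨t.card * 2, fun {q n} P l hl hdiam => ?_⟩
  choose φ hφt hφ using fun d => ht (P.arm d) P.X (hdiam d)
  have hcard : (t ×ˢ (Finset.univ : Finset Bool)).card = t.card * 2 := by simp
  rw [← hcard]
  -- Each colour holds at most one bad unit per arm: of two, each would be a close candidate match
  -- for the other, forcing a close match.
  refine Finset.card_le_card_of_injOn (fun i => (φ (P.obs i).2 i, (P.obs i).2)) ?_ ?_
  · intro i hi
    have hi' := (Finset.mem_filter.1 hi).1
    simpa using hφt _ i (P.mem_arm.2 ⟨hi', rfl⟩)
  · intro i hi j hj hij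
    by_contra hne
    obtain ⟨hi', hbad⟩ := Finset.mem_filter.1 hi
    have hj' := (Finset.mem_filter.1 hj).1
    simp only [Prod.mk.injEq] at hij
    obtain ⟨h1, h2⟩ := hij
    rw [← h2] at h1
    have hclose := hKη _ _ (hφ _ i (P.mem_arm.2 ⟨hi', rfl⟩) j (P.mem_arm.2 ⟨hj', h2.symm⟩) h1)
    have hmin := (hl i hi').2.2 j hj' (Ne.symm hne)
    simp only [nu, treat_sub_treat_abs, h2, if_true, mul_zero, add_zero] at hmin
    apply hbad
    have hnn := hψ.nonneg (P.X i) (P.X (l i))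
    by_cases hd : (P.obs j).2 = (P.obs (l i)).2
    · rw [if_pos hd] at hmin
      exact ⟨by rw [← hd, h2], by linarith [hclose.1]⟩
    · rw [if_neg hd] at hmin
      linarith [hclose.2]

end Given

/-- The seminorm is continuous, hence attains a positive minimum on the compact unit sphere. The
sphere is empty in dimension zero, which is treated apart. -/
theorem exists_mul_norm_le_seminorm {p : ℕ} (N : Seminorm ℝ (Ctrl p)) {K : ℝ}
    (hK : ∀ x, N x ≤ K * ‖x‖) (h0 : ∀ x, N x = 0 → x = 0) : ∃ c > 0, ∀ x, c * ‖x‖ ≤ N x := by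
  rcases subsingleton_or_nontrivial (Ctrl p) with hs | hn
  · exact ⟨1, one_pos, fun x => by rw [Subsingleton.elim x 0]; simp⟩
  have hcont : Continuous N := by
    have : LipschitzWith (Real.toNNReal K) N := LipschitzWith.of_dist_le' fun x y => by
      rw [Real.dist_eq, dist_eq_norm]
      exact (abs_sub_map_le_sub N x y).trans (hK _)
    exact this.continuous
  obtain ⟨x₀, hx₀, hmin⟩ := (isCompact_sphere (0 : Ctrl p) 1).exists_isMinOn
    (NormedSpace.sphere_nonempty.2 zero_le_one) hcont.continuousOn
  have hx₀' : x₀ ≠ 0 := fun h => by simp [h] at hx₀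
  refine ⟨N x₀, lt_of_le_of_ne (apply_nonneg N _) fun h => hx₀' (h0 _ h.symm), fun x => ?_⟩
  by_cases hx : x = 0
  · simp [hx]
  have hpos : 0 < ‖x‖ := norm_pos_iff.2 hx
  have h1 : N x₀ ≤ N (‖x‖⁻¹ • x) := hmin (by simp [norm_smul, hpos.ne'])
  rw [map_smul_eq_mul, norm_inv, norm_norm] at h1
  rwa [← div_eq_inv_mul, le_div_iff₀ hpos] at h1

/-- If two vectors are further apart than they are from the origin, then so are their
normalizations. -/
theorem one_lt_seminorm_normalize_sub {E : Type*} [AddCommGroup E] [Module ℝ E] (N : Seminorm ℝ E)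
    {u u' : E} (h : N u < N (u - u')) (h' : N u' < N (u - u')) :
    1 < N ((N u)⁻¹ • u - (N u')⁻¹ • u') := by
  have main : ∀ u u' : E, N u' ≤ N u → N u < N (u - u') →
      1 < N ((N u)⁻¹ • u - (N u')⁻¹ • u') := by
    intro u u' hle h
    have hu' : 0 < N u' := by
      by_contra hneg
      have h0 : N u' = 0 := le_antisymm (not_lt.1 hneg) (apply_nonneg N _)
      have := map_sub_le_add N u u'
      linarith
    have hu : 0 < N u := hu'.trans_le hle
    -- The first summand has length N u - N u'. If the normalizations were at distance at most 1,
    -- the triangle inequality would give N(u - u') ≤ N u.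
    have h1 : u - u' = (N u - N u') • ((N u)⁻¹ • u) + N u' • ((N u)⁻¹ • u - (N u')⁻¹ • u') := by
      rw [smul_sub, smul_smul (N u') (N u')⁻¹, mul_inv_cancel₀ hu'.ne', one_smul, sub_smul,
        smul_smul (N u), mul_inv_cancel₀ hu.ne', one_smul]
      abel
    have h2 : N (u - u') ≤ (N u - N u') + N u' * N ((N u)⁻¹ • u - (N u')⁻¹ • u') := by
      conv_lhs => rw [h1]
      refine (map_add_le_add N _ _).trans (le_of_eq ?_)
      rw [map_smul_eq_mul, map_smul_eq_mul, map_smul_eq_mul, Real.norm_of_nonneg (sub_nonneg.2 hle),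
        Real.norm_of_nonneg hu'.le, norm_inv, Real.norm_of_nonneg hu.le, inv_mul_cancel₀ hu.ne',
        mul_one]
    by_contra hcon
    have := mul_le_mul_of_nonneg_left (not_lt.1 hcon) hu'.le
    linarith
  rcases le_total (N u') (N u) with hle | hle
  · exact main u u' hle h
  · rw [map_sub_rev] at h' ⊢
    exact main u' u hle h'

/-- In a normed space, a unit can be the unique nearest neighbour of boundedly many others. -/
theorem exists_card_matched_le {p : ℕ} {K κ : ℝ} (hκ : 0 ≤ κ) {ψ : Ctrl p → Ctrl p → ℝ}
    (hψ : IsMetric ψ) (hdom : ∀ x y, ψ x y ≤ K * dist x y) (N : Seminorm ℝ (Ctrl p))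
    (hN : ∀ x y, ψ x y = N (x - y)) :
    ∃ B : ℕ, ∀ {q n : ℕ} (P : Given p q n) (l : Fin n → Fin n), P.IsMatch ψ κ l →
      P.NoTies ψ κ l → ∀ j : Fin n, (P.sub.filter fun i => l i = j).card ≤ B := by
  classical
  have hK : ∀ x, N x ≤ K * ‖x‖ := fun x => by
    have := hdom x 0
    rwa [hN, sub_zero, dist_zero_right] at this
  obtain ⟨c, hc, hcN⟩ := exists_mul_norm_le_seminorm N hK fun x hx =>
    (hψ.eq_zero_iff x 0).1 (by rw [hN, sub_zero, hx])
  have hK1 : 0 < |K| + 1 := by positivity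
  -- Normalized displacements have norm at most 1/c, hence the diameter 2/c. The mesh 1/(|K| + 1)
  -- makes equal colours at most 1 apart in the seminorm.
  obtain ⟨t, ht⟩ := exists_colouring (E := Ctrl p) (2 / c) (inv_pos.2 hK1)
  refine ⟨t.card * 2, fun {q n} P l hl hties j => ?_⟩
  set u : Fin n → Ctrl p := fun i => P.X i - P.X j with hu
  set v : Fin n → Ctrl p := fun i => (N (u i))⁻¹ • u i with hv
  have hvn : ∀ i, ‖v i‖ ≤ 1 / c := by
    intro i
    rw [le_div_iff₀ hc, mul_comm]
    refine (hcN _).trans ?_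
    rw [hv, map_smul_eq_mul, norm_inv, Real.norm_of_nonneg (apply_nonneg N _)]
    exact inv_mul_le_one
  obtain ⟨φ, hφt, hφ⟩ := ht (P.sub.filter fun i => l i = j) v fun i _ i' _ => by
    rw [dist_eq_norm]
    calc _ ≤ ‖v i‖ + ‖v i'‖ := norm_sub_le _ _
      _ ≤ 1 / c + 1 / c := add_le_add (hvn i) (hvn i')
      _ = 2 / c := by ring
  have hcard : (t ×ˢ (Finset.univ : Finset Bool)).card = t.card * 2 := by simp
  rw [← hcard]
  refine Finset.card_le_card_of_injOn (fun i => (φ i, (P.obs i).2)) ?_ ?_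
  · intro i hi
    simpa using hφt i hi
  · intro i hi i' hi' heq
    by_contra hne
    simp only [Prod.mk.injEq] at heq
    obtain ⟨h1, h2⟩ := heq
    have hclose := hφ i hi i' hi' h1
    obtain ⟨his, hij⟩ := Finset.mem_filter.1 hi
    obtain ⟨his', hij'⟩ := Finset.mem_filter.1 hi'
    -- If a and b are matched to j, then b was a rejected candidate for a. With a and b in the same
    -- arm the penalty only helps, so a is strictly closer to j than to b.
    have hkey : ∀ a ∈ P.sub, ∀ b ∈ P.sub, a ≠ b → l a = j → l b = j → (P.obs a).2 = (P.obs b).2 →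
        N (u a) < N (u a - u b) := by
      intro a ha b hb hab hla hlb hd
      have hba : b ≠ l a := by
        rw [hla, ← hlb]
        exact (hl b hb).2.1.symm
      have := hties a ha b hb hab.symm hba
      simp only [Given.nu, treat_sub_treat_abs, hd, if_true, mul_zero, add_zero, hla, hN] at this
      have h0 : 0 ≤ κ * (if (P.obs b).2 = (P.obs j).2 then (0 : ℝ) else 1) := by
        split_ifs <;> simp [hκ]
      have e : u a - u b = P.X a - P.X b := by simp [hu]
      rw [e]
      simp only [hu]
      linarith
    have k1 := hkey i his i' his' hne hij hij' h2
    have k2 := hkey i' his' i his (Ne.symm hne) hij' hij h2.symm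
    rw [map_sub_rev N (u i')] at k2
    have k3 := one_lt_seminorm_normalize_sub N k1 k2
    have k4 : N (v i - v i') ≤ 1 := by
      calc _ ≤ K * ‖v i - v i'‖ := hK _
        _ ≤ (|K| + 1) * ‖v i - v i'‖ := by
          gcongr
          linarith [le_abs_self K]
        _ ≤ (|K| + 1) * (|K| + 1)⁻¹ := by
          gcongr
          rw [← dist_eq_norm]; exact hclose
        _ = 1 := mul_inv_cancel₀ hK1.ne'
    exact absurd k3 (not_lt.2 k4)

/-! ### Matched differences of independent variables -/

theorem sub_pow_four_le (a b : ℝ) : (a - b) ^ 4 ≤ 8 * (a ^ 4 + b ^ 4) := by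
  have h1 : (a - b) ^ 2 ≤ 2 * (a ^ 2 + b ^ 2) := by nlinarith [sq_nonneg (a + b)]
  have h2 : ((a - b) ^ 2) ^ 2 ≤ (2 * (a ^ 2 + b ^ 2)) ^ 2 := pow_le_pow_left₀ (sq_nonneg _) h1 2
  nlinarith [sq_nonneg (a ^ 2 - b ^ 2)]

theorem integrable_sub_pow_four {Ω : Type*} {mΩ : MeasurableSpace Ω} {μ : Measure Ω}
    {X Y : Ω → ℝ} (hX : AEStronglyMeasurable X μ)
    (hY : AEStronglyMeasurable Y μ) (h : Integrable (fun ω => X ω ^ 4) μ)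
    (h' : Integrable (fun ω => Y ω ^ 4) μ) : Integrable (fun ω => (X ω - Y ω) ^ 4) μ := by
  refine ((h.add h').const_mul 8).mono' ((hX.sub hY).pow 4) (ae_of_all _ fun ω => ?_)
  rw [Real.norm_of_nonneg (by positivity)]
  exact sub_pow_four_le _ _

theorem integral_sub_pow_four_le {Ω : Type*} {mΩ : MeasurableSpace Ω} {μ : Measure Ω}
    {X Y : Ω → ℝ} (hX : AEStronglyMeasurable X μ)
    (hY : AEStronglyMeasurable Y μ) (h : Integrable (fun ω => X ω ^ 4) μ)
    (h' : Integrable (fun ω => Y ω ^ 4) μ) :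
    ∫ ω, (X ω - Y ω) ^ 4 ∂μ ≤ 8 * (∫ ω, X ω ^ 4 ∂μ + ∫ ω, Y ω ^ 4 ∂μ) := by
  rw [← integral_add h h', ← integral_const_mul]
  exact integral_mono (integrable_sub_pow_four hX hY h h') ((h.add h').const_mul 8)
    fun ω => sub_pow_four_le _ _

theorem memLp_sq_matched_difference {Ω : Type*} {mΩ : MeasurableSpace Ω}
    {μ : Measure Ω} {ι : Type*} {s : Finset ι} {e : ι → Ω → ℝ} {l : ι → ι}
    (he : ∀ i, Measurable (e i)) (hl : ∀ i ∈ s, l i ∈ s)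
    (h4 : ∀ i ∈ s, Integrable (fun ω => e i ω ^ 4) μ) {i : ι} (hi : i ∈ s) :
    MemLp (fun ω => (e i ω - e (l i) ω) ^ 2) 2 μ := by
  refine (memLp_two_iff_integrable_sq (f := fun ω => (e i ω - e (l i) ω) ^ 2)
    (((he i).sub (he _)).pow_const 2).aestronglyMeasurable).2 ?_
  have := integrable_sub_pow_four (he i).aestronglyMeasurable (he (l i)).aestronglyMeasurable
    (h4 i hi) (h4 _ (hl i hi))
  refine this.congr (ae_of_all _ fun ω => ?_)
  simp only
  ring

section MatchedDifferences

variable {Ω : Type*} {mΩ : MeasurableSpace Ω} {μ : Measure Ω} [IsProbabilityMeasure μ]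

theorem covariance_le_half_add {X Y : Ω → ℝ} (hX : MemLp X 2 μ) (hY : MemLp Y 2 μ) :
    cov[X, Y; μ] ≤ (Var[X; μ] + Var[Y; μ]) / 2 := by
  have h1 := variance_nonneg (X - Y) μ
  rw [variance_sub hX hY] at h1
  linarith

theorem memLp_two_of_integrable_pow_four {X : Ω → ℝ} (hX : AEStronglyMeasurable X μ)
    (h : Integrable (fun ω => X ω ^ 4) μ) : MemLp X 2 μ := by
  rw [memLp_two_iff_integrable_sq hX]
  simpa only [sq_abs] using integrable_pow_of_integrable_pow_four hX h (k := 2) (by norm_num)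

variable {ι : Type*} {s : Finset ι} {e : ι → Ω → ℝ} {l : ι → ι} {C : ℝ} {B : ℕ}

/-- The variance of the sum of squared matched differences grows linearly with sample size. -/
theorem variance_sum_sq_matched_difference_le [DecidableEq ι] (he : ∀ i, Measurable (e i)) (hind : iIndepFun e μ)
    (hl : ∀ i ∈ s, l i ∈ s)
    (h4 : ∀ i ∈ s, Integrable (fun ω => e i ω ^ 4) μ ∧ ∫ ω, e i ω ^ 4 ∂μ ≤ C)
    (hB : ∀ j, (s.filter fun i => l i = j).card ≤ B) :
    Var[fun ω => ∑ i ∈ s, (e i ω - e (l i) ω) ^ 2; μ] ≤ s.card * ((2 + 2 * B) * (16 * C)) := by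
  set W : ι → Ω → ℝ := fun i ω => (e i ω - e (l i) ω) ^ 2 with hW
  have hWm : ∀ i ∈ s, MemLp (W i) 2 μ := fun i hi =>
    memLp_sq_matched_difference he hl (fun i hi => (h4 i hi).1) hi
  have hvar : ∀ i ∈ s, Var[W i; μ] ≤ 16 * C := by
    intro i hi
    refine (variance_le_expectation_sq (hWm i hi).1).trans ?_
    have h1 := integral_sub_pow_four_le (he i).aestronglyMeasurable (he (l i)).aestronglyMeasurable
      (h4 i hi).1 (h4 _ (hl i hi)).1
    have h2 := (h4 i hi).2
    have h3 := (h4 _ (hl i hi)).2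
    calc ∫ ω, (W i ^ 2) ω ∂μ = ∫ ω, (e i ω - e (l i) ω) ^ 4 ∂μ := by
          refine integral_congr_ae (ae_of_all _ fun ω => ?_)
          simp only [Pi.pow_apply, hW]
          ring
      _ ≤ _ := by linarith
  rcases s.eq_empty_or_nonempty with rfl | ⟨i₀, hi₀⟩
  · simp only [Finset.sum_empty, Finset.card_empty, Nat.cast_zero, zero_mul]
    exact (variance_zero μ).le
  have hC : 0 ≤ 16 * C := (variance_nonneg _ _).trans (hvar i₀ hi₀)
  rw [variance_fun_sum' hWm]
  rw [← nsmul_eq_mul]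
  refine Finset.sum_le_card_nsmul _ _ _ fun i hi => ?_
  -- Squared differences are independent unless {i, l i} and {j, l j} meet. For fixed i this leaves
  -- i, l i and the units matched to either, at most 2 + 2B indices.
  have hcov : ∀ j ∈ s, cov[W i, W j; μ] ≤
      if j = i ∨ j = l i ∨ l j = i ∨ l j = l i then 16 * C else 0 := by
    intro j hj
    split_ifs with h
    · refine (covariance_le_half_add (hWm i hi) (hWm j hj)).trans ?_
      linarith [hvar i hi, hvar j hj]
    · push Not at h
      have h1 := hind.indepFun_prodMk_prodMk he i (l i) j (l j) (Ne.symm h.1) (Ne.symm h.2.2.1)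
        (Ne.symm h.2.1) (Ne.symm h.2.2.2)
      have h2 : W i ⟂ᵢ[μ] W j := h1.comp (φ := fun x : ℝ × ℝ => (x.1 - x.2) ^ 2)
        (ψ := fun x : ℝ × ℝ => (x.1 - x.2) ^ 2) (by fun_prop) (by fun_prop)
      exact (h2.covariance_eq_zero (hWm i hi) (hWm j hj)).le
  refine (Finset.sum_le_sum hcov).trans ?_
  rw [← Finset.sum_filter, Finset.sum_const, nsmul_eq_mul]
  refine mul_le_mul_of_nonneg_right ?_ hC
  have hsub : (s.filter fun j => j = i ∨ j = l i ∨ l j = i ∨ l j = l i) ⊆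
      ({i} ∪ {l i}) ∪ ((s.filter fun j => l j = i) ∪ (s.filter fun j => l j = l i)) := by
    intro j hj
    simp only [Finset.mem_filter, Finset.mem_union, Finset.mem_singleton] at hj ⊢
    tauto
  have hcard : (s.filter fun j => j = i ∨ j = l i ∨ l j = i ∨ l j = l i).card ≤
      (1 + 1) + (B + B) :=
    (Finset.card_le_card hsub).trans <| (Finset.card_union_le _ _).trans <| add_le_add
      ((Finset.card_union_le _ _).trans (by simp))
      ((Finset.card_union_le _ _).trans (add_le_add (hB _) (hB _)))
  have : ((s.filter fun j => j = i ∨ j = l i ∨ l j = i ∨ l j = l i).card : ℝ) ≤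
      (((1 + 1) + (B + B) : ℕ) : ℝ) := by exact_mod_cast hcard
  refine this.trans (le_of_eq ?_)
  push_cast
  ring

/-- The mean of the sum of squared matched differences is close to twice the sum of variances, if
most matches have similar first and second moments. -/
theorem abs_integral_sum_sq_matched_difference_sub_le (he : ∀ i, Measurable (e i))
    (hind : iIndepFun e μ) (hl : ∀ i ∈ s, l i ∈ s ∧ l i ≠ i)
    (h4 : ∀ i ∈ s, Integrable (fun ω => e i ω ^ 4) μ ∧ ∫ ω, e i ω ^ 4 ∂μ ≤ C) (hC : 0 ≤ C)
    (η : ℝ) (hη : 0 ≤ η) :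
    |∫ ω, ∑ i ∈ s, (e i ω - e (l i) ω) ^ 2 ∂μ - 2 * ∑ i ∈ s, Var[e i; μ]| ≤
      s.card * (η * (1 + 2 * (1 + C))) +
        (s.filter fun i => ¬(|∫ ω, e (l i) ω ^ 2 ∂μ - ∫ ω, e i ω ^ 2 ∂μ| ≤ η ∧
          |∫ ω, e i ω ∂μ - ∫ ω, e (l i) ω ∂μ| ≤ η)).card *
            ((1 + C) + 4 * (1 + C) ^ 2) := by
  have hm : ∀ i ∈ s, MemLp (e i) 2 μ := fun i hi =>
    memLp_two_of_integrable_pow_four (he i).aestronglyMeasurable (h4 i hi).1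
  have hμ : ∀ i ∈ s, |∫ ω, e i ω ∂μ| ≤ 1 + C := fun i hi => by
    refine (abs_integral_le_integral_abs).trans ?_
    simpa using integral_pow_le_of_integral_pow_four_le (he i).aestronglyMeasurable (h4 i hi).1
      (h4 i hi).2 (k := 1) (by norm_num)
  have hν : ∀ i ∈ s, ∫ ω, e i ω ^ 2 ∂μ ≤ 1 + C := fun i hi => by
    simpa only [sq_abs] using integral_pow_le_of_integral_pow_four_le (he i).aestronglyMeasurable
      (h4 i hi).1 (h4 i hi).2 (k := 2) (by norm_num)
  have hν0 : ∀ i, 0 ≤ ∫ ω, e i ω ^ 2 ∂μ := fun i => integral_nonneg fun ω => sq_nonneg _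
  -- By independence the cross moment factors, so the gap is controlled by the differences of first
  -- and second moments between a unit and its match.
  have hint : ∀ i ∈ s, ∫ ω, (e i ω - e (l i) ω) ^ 2 ∂μ - 2 * Var[e i; μ] =
      (∫ ω, e (l i) ω ^ 2 ∂μ - ∫ ω, e i ω ^ 2 ∂μ) +
        2 * (∫ ω, e i ω ∂μ) * (∫ ω, e i ω ∂μ - ∫ ω, e (l i) ω ∂μ) := by
    intro i hi
    obtain ⟨hli, hne⟩ := hl i hi
    have h1 := (hm i hi).integrable_sq
    have h2 := (hm _ hli).integrable_sq
    have h3 : Integrable (fun ω => e i ω * e (l i) ω) μ := (hm i hi).integrable_mul (hm _ hli)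
    have h5 : ∫ ω, e i ω * e (l i) ω ∂μ = (∫ ω, e i ω ∂μ) * ∫ ω, e (l i) ω ∂μ :=
      (hind.indepFun hne.symm).integral_fun_mul_eq_mul_integral (he i).aestronglyMeasurable
        (he _).aestronglyMeasurable
    have h6 : ∫ ω, (e i ω - e (l i) ω) ^ 2 ∂μ = ∫ ω, e i ω ^ 2 ∂μ + ∫ ω, e (l i) ω ^ 2 ∂μ -
        2 * ((∫ ω, e i ω ∂μ) * ∫ ω, e (l i) ω ∂μ) := by
      have h12 : Integrable (fun ω => e i ω ^ 2 + e (l i) ω ^ 2) μ := h1.add h2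
      rw [← h5, ← integral_const_mul, ← integral_add h1 h2, ← integral_sub h12 (h3.const_mul 2)]
      refine integral_congr_ae (ae_of_all _ fun ω => ?_)
      simp only
      ring
    rw [h6, variance_eq_sub (hm i hi)]
    simp only [Pi.pow_apply]
    ring
  rw [integral_finsetSum _ fun i hi =>
    (memLp_sq_matched_difference he (fun i hi => (hl i hi).1) (fun i hi => (h4 i hi).1) hi).integrable
      (by norm_num), Finset.mul_sum, ← Finset.sum_sub_distrib]
  refine (Finset.abs_sum_le_sum_abs _ _).trans ?_
  rw [Finset.card_filter]
  push_cast
  rw [← nsmul_eq_mul, ← Finset.sum_const, Finset.sum_mul, ← Finset.sum_add_distrib]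
  refine Finset.sum_le_sum fun i hi => ?_
  obtain ⟨hli, -⟩ := hl i hi
  rw [hint i hi]
  have a1 := hμ i hi
  have a2 := hμ _ hli
  have hC1 : 0 ≤ 1 + C := by linarith
  refine (abs_add_le _ _).trans ?_
  rw [abs_mul, abs_mul, abs_two]
  split_ifs with hgood
  · obtain ⟨g1, g2⟩ := hgood
    have b3 := mul_le_mul a1 g2 (abs_nonneg _) hC1
    nlinarith
  · have h5 : 0 ≤ η * (1 + 2 * (1 + C)) := by positivity
    have b1 : |∫ ω, e (l i) ω ^ 2 ∂μ - ∫ ω, e i ω ^ 2 ∂μ| ≤ 1 + C := by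
      rw [abs_le]
      constructor <;> linarith [hν i hi, hν _ hli, hν0 i, hν0 (l i)]
    have b2 : |∫ ω, e i ω ∂μ - ∫ ω, e (l i) ω ∂μ| ≤ 2 * (1 + C) := by
      refine (abs_sub _ _).trans ?_
      linarith
    have b3 := mul_le_mul a1 b2 (abs_nonneg _) hC1
    nlinarith

end MatchedDifferences

/-- Half the average squared matched difference estimates the average variance consistently. -/
theorem tendsto_measureReal_matched_difference {Ω ι : ℕ → Type*} [∀ n, MeasurableSpace (Ω n)]
    [∀ n, DecidableEq (ι n)]
    (μ : ∀ n, Measure (Ω n)) [∀ n, IsProbabilityMeasure (μ n)] (s : ∀ n, Finset (ι n))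
    (e : ∀ n, ι n → Ω n → ℝ) (he : ∀ n i, Measurable (e n i)) (hind : ∀ n, iIndepFun (e n) (μ n))
    (hs : Tendsto (fun n => (s n).card) atTop atTop) (l : ∀ n, ι n → ι n)
    (hl : ∀ᶠ n in atTop, ∀ i ∈ s n, l n i ∈ s n ∧ l n i ≠ i) {C : ℝ} (hC : 0 ≤ C)
    (h4 : ∀ᶠ n in atTop, ∀ i ∈ s n, Integrable (fun ω => e n i ω ^ 4) (μ n) ∧
      ∫ ω, e n i ω ^ 4 ∂(μ n) ≤ C)
    {B : ℕ} (hB : ∀ᶠ n in atTop, ∀ j, ((s n).filter fun i => l n i = j).card ≤ B)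
    (hbad : ∀ η > 0, ∃ N : ℕ, ∀ᶠ n in atTop, ((s n).filter fun i =>
      ¬(|∫ ω, e n (l n i) ω ^ 2 ∂(μ n) - ∫ ω, e n i ω ^ 2 ∂(μ n)| ≤ η ∧
        |∫ ω, e n i ω ∂(μ n) - ∫ ω, e n (l n i) ω ∂(μ n)| ≤ η)).card ≤ N)
    (ε : ℝ) (hε : 0 < ε) :
    Tendsto (fun n => (μ n).real {ω | ε ≤
      |(2 * ((s n).card : ℝ))⁻¹ * ∑ i ∈ s n, (e n i ω - e n (l n i) ω) ^ 2 -
        ((s n).card : ℝ)⁻¹ * ∑ i ∈ s n, Var[e n i; μ n]|}) atTop (𝓝 0) := by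
  set D := 1 + 2 * (1 + C) with hD
  have hDpos : 0 < D := by positivity
  -- With this tolerance the well-matched units contribute at most half of the allowed error; the at
  -- most N others contribute a constant A, negligible against the sample size.
  obtain ⟨N, hN⟩ := hbad (ε / (2 * D)) (by positivity)
  set A := (N : ℝ) * ((1 + C) + 4 * (1 + C) ^ 2) with hA
  have hcard : Tendsto (fun n => ((s n).card : ℝ)) atTop atTop :=
    tendsto_natCast_atTop_atTop.comp hs
  have hlim : Tendsto (fun n => (2 + 2 * B) * (16 * C) * (4 / ε ^ 2) * ((s n).card : ℝ)⁻¹) atTop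
      (𝓝 0) := by
    simpa using (tendsto_inv_atTop_zero.comp hcard).const_mul
      ((2 + 2 * (B : ℝ)) * (16 * C) * (4 / ε ^ 2))
  refine squeeze_zero' (Eventually.of_forall fun n => measureReal_nonneg) ?_ hlim
  filter_upwards [hl, h4, hB, hN, hcard.eventually_gt_atTop 0, hcard.eventually_ge_atTop (2 * A / ε)]
    with n hl h4 hB hN hpos hlarge
  set c := ((s n).card : ℝ) with hc
  set T : Ω n → ℝ := fun ω => ∑ i ∈ s n, (e n i ω - e n (l n i) ω) ^ 2 with hT
  set V := ∑ i ∈ s n, Var[e n i; μ n] with hV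
  have hTm : MemLp T 2 (μ n) := memLp_finsetSum _ fun i hi =>
    memLp_sq_matched_difference (he n) (fun i hi => (hl i hi).1) (fun i hi => (h4 i hi).1) hi
  have hvar := variance_sum_sq_matched_difference_le (he n) (hind n) (fun i hi => (hl i hi).1) h4 hB
  have hmean := abs_integral_sum_sq_matched_difference_sub_le (he n) (hind n) hl h4 hC
    (ε / (2 * D)) (by positivity)
  rw [← hc] at hvar hmean
  change |∫ ω, T ω ∂(μ n) - 2 * V| ≤ _ at hmean
  have hmean' : |∫ ω, T ω ∂(μ n) - 2 * V| ≤ c * ε := by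
    refine hmean.trans ?_
    have h1 : ε / (2 * D) * D = ε / 2 := by field_simp
    rw [h1]
    have h2 : A ≤ c * (ε / 2) := by
      rw [div_le_iff₀ hε] at hlarge
      linarith
    have h3 : (((s n).filter fun i =>
      ¬(|∫ ω, e n (l n i) ω ^ 2 ∂(μ n) - ∫ ω, e n i ω ^ 2 ∂(μ n)| ≤ ε / (2 * D) ∧
        |∫ ω, e n i ω ∂(μ n) - ∫ ω, e n (l n i) ω ∂(μ n)| ≤ ε / (2 * D))).card : ℝ) *
          ((1 + C) + 4 * (1 + C) ^ 2) ≤ A := by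
      rw [hA]
      gcongr
    linarith
  -- The event means |T - 2V| ≥ 2cε, of which the bias of T takes at most cε. Chebyshev's inequality
  -- handles the rest.
  have hsub : {ω | ε ≤ |(2 * c)⁻¹ * T ω - c⁻¹ * V|} ⊆
      {ω | c * ε ≤ |T ω - ∫ ω, T ω ∂(μ n)|} := by
    intro ω hω
    simp only [Set.mem_ofPred_eq] at hω ⊢
    have h1 : (2 * c)⁻¹ * T ω - c⁻¹ * V = (2 * c)⁻¹ * (T ω - 2 * V) := by field_simp
    rw [h1, abs_mul, abs_of_pos (by positivity), ← div_eq_inv_mul,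
      le_div_iff₀ (by positivity)] at hω
    have h2 : |T ω - 2 * V| ≤ |T ω - ∫ ω, T ω ∂(μ n)| + |∫ ω, T ω ∂(μ n) - 2 * V| :=
      abs_sub_le _ _ _
    linarith
  refine (measureReal_mono hsub).trans ?_
  have hcheb := meas_ge_le_variance_div_sq hTm (mul_pos hpos hε)
  refine (ENNReal.toReal_mono ENNReal.ofReal_ne_top hcheb).trans ?_
  rw [ENNReal.toReal_ofReal (div_nonneg (variance_nonneg _ _) (sq_nonneg _)),
    div_le_iff₀ (by positivity)]
  refine hvar.trans ?_
  have : 0 ≤ c * ((2 + 2 * B) * (16 * C)) := by positivity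
  calc c * ((2 + 2 * ↑B) * (16 * C)) ≤ 4 * (c * ((2 + 2 * B) * (16 * C))) := by linarith
    _ = _ := by field_simp

/-- Minkowski's inequality, in the form of a bound on the difference of two `ℓ²` norms. -/
theorem abs_sqrt_sum_sub_sq_sub_le {ι : Type*} (s : Finset ι) (x b : ι → ℝ) :
    |√(∑ i ∈ s, (x i - b i) ^ 2) - √(∑ i ∈ s, x i ^ 2)| ≤ √(∑ i ∈ s, b i ^ 2) := by
  have key : ∀ x b : ι → ℝ,
      √(∑ i ∈ s, (x i - b i) ^ 2) ≤ √(∑ i ∈ s, x i ^ 2) + √(∑ i ∈ s, b i ^ 2) := by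
    intro x b
    have hX : 0 ≤ ∑ i ∈ s, x i ^ 2 := Finset.sum_nonneg fun i _ => sq_nonneg _
    have hB : 0 ≤ ∑ i ∈ s, b i ^ 2 := Finset.sum_nonneg fun i _ => sq_nonneg _
    refine Real.sqrt_le_iff.2 ⟨by positivity, ?_⟩
    have hcs : |∑ i ∈ s, x i * b i| ≤ √(∑ i ∈ s, x i ^ 2) * √(∑ i ∈ s, b i ^ 2) := by
      rw [← Real.sqrt_mul hX]
      exact Real.abs_le_sqrt (Finset.sum_mul_sq_le_sq_mul_sq _ _ _)
    have hexp : ∑ i ∈ s, (x i - b i) ^ 2 =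
        ∑ i ∈ s, x i ^ 2 - 2 * ∑ i ∈ s, x i * b i + ∑ i ∈ s, b i ^ 2 := by
      rw [Finset.mul_sum, ← Finset.sum_sub_distrib, ← Finset.sum_add_distrib]
      exact Finset.sum_congr rfl fun i _ => by ring
    rw [hexp, add_sq, Real.sq_sqrt hX, Real.sq_sqrt hB]
    linarith [neg_abs_le (∑ i ∈ s, x i * b i)]
  rw [abs_le]
  constructor
  -- The reverse bound is the first one applied to x - b and -b.
  · have h := key (fun i => x i - b i) (fun i => -b i)
    simp only [sub_neg_eq_add, sub_add_cancel, neg_sq] at h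
    linarith
  · linarith [key x b]

theorem abs_sqrt_sub_le {x y c : ℝ} (hx : 0 ≤ x) (hc : 0 < c) (hy : c ≤ y) :
    |√x - √y| ≤ |x - y| / √c := by
  have hy0 : 0 < y := hc.trans_le hy
  rw [le_div_iff₀ (Real.sqrt_pos.2 hc)]
  have h1 : |x - y| = |√x - √y| * (√x + √y) := by
    rw [← abs_of_nonneg (show 0 ≤ √x + √y by positivity), ← abs_mul]
    congr 1
    nlinarith [Real.sq_sqrt hx, Real.sq_sqrt hy0.le]
  rw [h1]
  refine mul_le_mul_of_nonneg_left ?_ (abs_nonneg _)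
  have := Real.sqrt_le_sqrt hy
  linarith [Real.sqrt_nonneg x]

namespace Given

variable {p q n : ℕ} (P : Given p q n)

instance isProbabilityMeasure_law (o : Obs p) : IsProbabilityMeasure (P.law o) := by
  have := P.markov
  infer_instance

instance isProbabilityMeasure_condLaw : IsProbabilityMeasure P.condLaw := by
  unfold condLaw
  infer_instance

/-! ### The least squares estimator -/

/-- The row of the inverse design matrix that belongs to the coefficient of `D`. -/
noncomputable def slope : Fin (q + 2) → ℝ := P.Gam⁻¹ *ᵥ Pi.single 1 1

/-- The weight of unit `i` in the least squares estimator of the coefficient of `D`. -/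
noncomputable def infl (i : Fin n) : ℝ := P.reg i ⬝ᵥ P.slope

theorem inv_Gam_transpose : P.Gam⁻¹ᵀ = P.Gam⁻¹ := by
  have := P.isHermitian_Gam
  rw [Matrix.IsHermitian, Matrix.conjTranspose_eq_transpose_of_trivial] at this
  rw [Matrix.transpose_nonsing_inv, this]

theorem lsq_sub_lsq (y y' : Fin n → ℝ) :
    P.lsq y - P.lsq y' = P.Gam⁻¹ *ᵥ (P.size⁻¹ • ∑ i ∈ P.sub, (y i - y' i) • P.reg i) := by
  rw [lsq, lsq, ← Matrix.mulVec_sub, ← smul_sub, ← Finset.sum_sub_distrib]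
  simp only [sub_smul]

theorem inv_Gam_mulVec_one (v : Fin (q + 2) → ℝ) : (P.Gam⁻¹ *ᵥ v) 1 = P.slope ⬝ᵥ v := by
  rw [slope, dotProduct_comm, Matrix.dotProduct_mulVec, ← Matrix.mulVec_transpose,
    inv_Gam_transpose]
  simp

/-- Least squares is linear in the outcomes and Γ⁻¹ is symmetric, so the sampling error is a
weighted average of independent errors. -/
theorem betaHat_sub_theta (Y : Fin n → ℝ) : P.betaHat Y - P.theta 1 =
    P.size⁻¹ * ∑ i ∈ P.sub, P.infl i * (Y i - P.cexp (P.obs i)) := by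
  have h := congrFun (P.lsq_sub_lsq Y fun i => P.cexp (P.obs i)) 1
  rw [inv_Gam_mulVec_one, dotProduct_smul, dotProduct_sum] at h
  rw [betaHat, theta]
  simp only [Pi.sub_apply] at h
  rw [h, smul_eq_mul]
  congr 1
  refine Finset.sum_congr rfl fun i _ => ?_
  rw [dotProduct_smul, infl, dotProduct_comm, smul_eq_mul, mul_comm]

/-- The diagonal entry is the quadratic form of Δ̂ at `slope`, which reduces the matrix estimator to
scalar matched differences. -/
theorem SigHat_one_one (l : Fin n → Fin n) (Y : Fin n → ℝ) : P.SigHat l Y 1 1 =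
    (2 * P.size)⁻¹ * ∑ i ∈ P.sub,
      (P.resid Y i * P.infl i - P.resid Y (l i) * P.infl (l i)) ^ 2 := by
  have h1 : P.SigHat l Y 1 1 = P.slope ⬝ᵥ P.DelHat l Y *ᵥ P.slope := by
    rw [← inv_Gam_mulVec_one]
    conv_rhs => rw [slope, Matrix.mulVec_mulVec, Matrix.mulVec_mulVec]
    rw [SigHat, Matrix.mul_assoc, Matrix.mulVec_single_one]
    rfl
  have h2 := dotProduct_sum_vecMulVec_mulVec P.sub (fun _ => 1)
    (fun i => P.resid Y i • P.reg i - P.resid Y (l i) • P.reg (l i))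
    (fun i => P.resid Y i • P.reg i - P.resid Y (l i) • P.reg (l i)) P.slope P.slope
  simp only [one_smul, one_mul] at h2
  rw [h1, DelHat, Matrix.smul_mulVec, dotProduct_smul, h2, smul_eq_mul]
  congr 1
  refine Finset.sum_congr rfl fun i _ => ?_
  rw [sub_dotProduct, smul_dotProduct, smul_dotProduct, smul_eq_mul, smul_eq_mul, infl, infl, sq]

/-- The error of the outcome of unit `i` with respect to the regression estimand. -/
noncomputable def err (i : Fin n) (y : ℝ) : ℝ := y - P.reg i ⬝ᵥ P.theta

theorem resid_eq (Y : Fin n → ℝ) (i : Fin n) :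
    P.resid Y i = P.err i (Y i) - P.reg i ⬝ᵥ (P.lsq Y - P.theta) := by
  rw [resid, err, dotProduct_sub]
  ring

theorem measurable_err (i : Fin n) : Measurable (P.err i) := by
  unfold err
  fun_prop

/-- The square root of the asymptotic variance of the estimator. -/
noncomputable def sd : ℝ := √(P.slope ⬝ᵥ P.Del *ᵥ P.slope)

/-- Uniform bounds on the design and on the fourth moments of the errors. -/
structure Bounded (P : Given p q n) (lam R C : ℝ) : Prop where
  size_pos : 0 < P.size
  lam_pos : 0 < lam
  gam : ∀ x, lam * (x ⬝ᵥ x) ≤ x ⬝ᵥ P.Gam *ᵥ x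
  del : ∀ x, lam * (x ⬝ᵥ x) ≤ x ⬝ᵥ P.Del *ᵥ x
  reg : ∀ i ∈ P.sub, P.reg i ⬝ᵥ P.reg i ≤ R
  integrable_err : ∀ i ∈ P.sub, Integrable (fun y => P.err i y ^ 4) (P.law (P.obs i))
  integral_err : ∀ i ∈ P.sub, ∫ y, P.err i y ^ 4 ∂(P.law (P.obs i)) ≤ C

theorem integral_condLaw {i : Fin n} {f : ℝ → ℝ} (hf : Measurable f) :
    ∫ Y, f (Y i) ∂P.condLaw = ∫ y, f y ∂(P.law (P.obs i)) :=
  integral_comp_eval hf.aestronglyMeasurable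

theorem integrable_condLaw {i : Fin n} {f : ℝ → ℝ} (hf : Integrable f (P.law (P.obs i))) :
    Integrable (fun Y => f (Y i)) P.condLaw :=
  integrable_comp_eval hf

theorem iIndepFun_condLaw {f : Fin n → ℝ → ℝ} (hf : ∀ i, Measurable (f i)) :
    iIndepFun (fun i Y => f i (Y i)) P.condLaw :=
  iIndepFun_pi fun i => (hf i).aemeasurable

namespace Bounded

variable {P} {lam R C : ℝ}

theorem isUnit_Gam (h : P.Bounded lam R C) : IsUnit P.Gam := isUnit_of_quadForm_le h.lam_pos h.gam

theorem Gam_mulVec_slope (h : P.Bounded lam R C) : P.Gam *ᵥ P.slope = Pi.single 1 1 := by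
  rw [slope, Matrix.mulVec_mulVec,
    Matrix.mul_nonsing_inv _ ((Matrix.isUnit_iff_isUnit_det _).1 h.isUnit_Gam), Matrix.one_mulVec]

theorem slope_dotProduct_slope_le (h : P.Bounded lam R C) :
    P.slope ⬝ᵥ P.slope ≤ (lam ^ 2)⁻¹ := by
  have h1 := sq_mul_dotProduct_self_le_of_quadForm_le h.lam_pos h.gam P.slope
  rw [h.Gam_mulVec_slope] at h1
  simp only [dotProduct_single, Pi.single_eq_same, mul_one] at h1
  rw [← one_div, le_div_iff₀ (pow_pos h.lam_pos 2), mul_comm]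
  exact h1

theorem R_nonneg (h : P.Bounded lam R C) : 0 ≤ R := by
  have : P.sub.Nonempty := by
    have := h.size_pos
    rw [size, Nat.cast_pos, Finset.card_pos] at this
    exact this
  obtain ⟨i, hi⟩ := this
  exact (dotProduct_self_nonneg' _).trans (h.reg i hi)

theorem infl_sq_le (h : P.Bounded lam R C) {i : Fin n} (hi : i ∈ P.sub) :
    P.infl i ^ 2 ≤ R / lam ^ 2 :=
  calc P.infl i ^ 2 ≤ (P.reg i ⬝ᵥ P.reg i) * (P.slope ⬝ᵥ P.slope) := dotProduct_sq_le _ _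
    _ ≤ R * (lam ^ 2)⁻¹ := mul_le_mul (h.reg i hi) h.slope_dotProduct_slope_le
        (dotProduct_self_nonneg' _) h.R_nonneg
    _ = _ := (div_eq_mul_inv _ _).symm

/-- Γ·`slope` is the unit vector of D, so D_i·`infl i` averages to 1. Then 2ab ≤ a² + b² and D² ≤ 1
keep `slope` away from zero, and with it the asymptotic variance. -/
theorem one_le_mul_slope_dotProduct_slope (h : P.Bounded lam R C) :
    1 ≤ R * (P.slope ⬝ᵥ P.slope) := by
  have h1 : (1 : ℝ) = P.size⁻¹ * ∑ i ∈ P.sub, P.reg i 1 * P.infl i := by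
    have := P.dotProduct_Gam_mulVec (Pi.single 1 1) P.slope
    rw [h.Gam_mulVec_slope] at this
    simpa [infl] using this
  have h2 : ∑ i ∈ P.sub, P.reg i 1 * P.infl i ≤
      P.sub.card • ((1 + R * (P.slope ⬝ᵥ P.slope)) / 2) := by
    refine Finset.sum_le_card_nsmul _ _ _ fun i hi => ?_
    have h3 : P.infl i ^ 2 ≤ R * (P.slope ⬝ᵥ P.slope) := (dotProduct_sq_le _ _).trans
      (mul_le_mul_of_nonneg_right (h.reg i hi) (dotProduct_self_nonneg' _))
    have h4 : P.reg i 1 ^ 2 ≤ 1 := by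
      rw [reg_one, treat]
      split_ifs <;> norm_num
    nlinarith [sq_nonneg (P.reg i 1 - P.infl i)]
  have hs := h.size_pos
  have h5 : 1 ≤ (1 + R * (P.slope ⬝ᵥ P.slope)) / 2 := by
    rw [nsmul_eq_mul, ← size] at h2
    calc (1 : ℝ) = P.size⁻¹ * ∑ i ∈ P.sub, P.reg i 1 * P.infl i := h1
      _ ≤ P.size⁻¹ * (P.size * ((1 + R * (P.slope ⬝ᵥ P.slope)) / 2)) := by gcongr
      _ = _ := inv_mul_cancel_left₀ hs.ne' _
  linarith

theorem R_pos (h : P.Bounded lam R C) : 0 < R := by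
  have h1 := h.one_le_mul_slope_dotProduct_slope
  rcases h.R_nonneg.eq_or_lt with h0 | h0
  · rw [← h0, zero_mul] at h1; linarith
  · exact h0

theorem le_slope_Del_slope (h : P.Bounded lam R C) :
    lam / R ≤ P.slope ⬝ᵥ P.Del *ᵥ P.slope := by
  refine le_trans ?_ (h.del _)
  rw [div_le_iff₀ h.R_pos, mul_assoc, mul_comm _ R]
  have := mul_le_mul_of_nonneg_left h.one_le_mul_slope_dotProduct_slope h.lam_pos.le
  linarith

theorem sqrt_le_sd (h : P.Bounded lam R C) : √(lam / R) ≤ P.sd :=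
  Real.sqrt_le_sqrt h.le_slope_Del_slope

theorem sd_pos (h : P.Bounded lam R C) : 0 < P.sd :=
  (Real.sqrt_pos.2 (div_pos h.lam_pos h.R_pos)).trans_le h.sqrt_le_sd

theorem sd_sq (h : P.Bounded lam R C) : P.sd ^ 2 = P.slope ⬝ᵥ P.Del *ᵥ P.slope :=
  Real.sq_sqrt ((div_pos h.lam_pos h.R_pos).le.trans h.le_slope_Del_slope)

/-! Moments of the outcomes -/

theorem integrable_err_one (h : P.Bounded lam R C) {i : Fin n} (hi : i ∈ P.sub) :
    Integrable (P.err i) (P.law (P.obs i)) := by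
  have := integrable_pow_of_integrable_pow_four (P.measurable_err i).aestronglyMeasurable
    (h.integrable_err i hi) (k := 1) (by norm_num)
  simp only [pow_one] at this
  exact (integrable_norm_iff (P.measurable_err i).aestronglyMeasurable).1 this

theorem integral_err_eq (h : P.Bounded lam R C) {i : Fin n} (hi : i ∈ P.sub) :
    ∫ y, P.err i y ∂(P.law (P.obs i)) = P.cexp (P.obs i) - P.reg i ⬝ᵥ P.theta := by
  have h1 : Integrable (fun y : ℝ => y) (P.law (P.obs i)) := by
    have := (h.integrable_err_one hi).add (integrable_const (P.reg i ⬝ᵥ P.theta))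
    refine this.congr (ae_of_all _ fun y => ?_)
    simp [err]
  simp only [err]
  rw [integral_sub h1 (integrable_const _), cexp]
  simp

/-- U is the centred version of `err`, so it inherits integrability and moment bounds. -/
theorem sub_cexp_eq (h : P.Bounded lam R C) {i : Fin n} (hi : i ∈ P.sub) (y : ℝ) :
    y - P.cexp (P.obs i) = P.err i y - ∫ y, P.err i y ∂(P.law (P.obs i)) := by
  rw [h.integral_err_eq hi, err]
  ring

theorem integral_sub_cexp (h : P.Bounded lam R C) {i : Fin n} (hi : i ∈ P.sub) :
    ∫ y, (y - P.cexp (P.obs i)) ∂(P.law (P.obs i)) = 0 := by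
  simp only [h.sub_cexp_eq hi]
  rw [integral_sub (h.integrable_err_one hi) (integrable_const _)]
  simp

theorem abs_integral_err_le (h : P.Bounded lam R C) {i : Fin n} (hi : i ∈ P.sub) :
    |∫ y, P.err i y ∂(P.law (P.obs i))| ≤ 1 + C := by
  refine (abs_integral_le_integral_abs).trans ?_
  simpa using integral_pow_le_of_integral_pow_four_le (P.measurable_err i).aestronglyMeasurable
    (h.integrable_err i hi) (h.integral_err i hi) (k := 1) (by norm_num)

theorem integrable_sub_cexp_pow_four (h : P.Bounded lam R C) {i : Fin n} (hi : i ∈ P.sub) :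
    Integrable (fun y => (y - P.cexp (P.obs i)) ^ 4) (P.law (P.obs i)) := by
  simp only [h.sub_cexp_eq hi]
  exact integrable_sub_pow_four (P.measurable_err i).aestronglyMeasurable
    aestronglyMeasurable_const (h.integrable_err i hi) (integrable_const _)

theorem integral_sub_cexp_pow_four_le (h : P.Bounded lam R C) {i : Fin n} (hi : i ∈ P.sub) :
    ∫ y, (y - P.cexp (P.obs i)) ^ 4 ∂(P.law (P.obs i)) ≤ 8 * (C + (1 + C) ^ 4) := by
  simp only [h.sub_cexp_eq hi]
  refine (integral_sub_pow_four_le (P.measurable_err i).aestronglyMeasurable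
    aestronglyMeasurable_const (h.integrable_err i hi) (integrable_const _)).trans ?_
  have h1 := h.integral_err i hi
  have h2 : (∫ y, P.err i y ∂(P.law (P.obs i))) ^ 4 ≤ (1 + C) ^ 4 := by
    rw [← Even.pow_abs (by decide : Even 4)]
    exact pow_le_pow_left₀ (abs_nonneg _) (h.abs_integral_err_le hi) 4
  simp only [integral_const, probReal_univ, one_smul]
  linarith

theorem memLp_sub_cexp (h : P.Bounded lam R C) {i : Fin n} (hi : i ∈ P.sub) :
    MemLp (fun y => y - P.cexp (P.obs i)) 2 (P.law (P.obs i)) :=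
  memLp_two_of_integrable_pow_four (by fun_prop) (h.integrable_sub_cexp_pow_four hi)

theorem variance_err (h : P.Bounded lam R C) {i : Fin n} (hi : i ∈ P.sub) :
    Var[P.err i; P.law (P.obs i)] = P.cvar (P.obs i) := by
  rw [variance_eq_integral (P.measurable_err i).aemeasurable, cvar]
  simp only [h.sub_cexp_eq hi]

theorem cvar_le (h : P.Bounded lam R C) {i : Fin n} (hi : i ∈ P.sub) :
    P.cvar (P.obs i) ≤ 1 + C := by
  rw [← h.variance_err hi]
  refine (variance_le_expectation_sq (P.measurable_err i).aestronglyMeasurable).trans ?_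
  simpa only [sq_abs, Pi.pow_apply] using integral_pow_le_of_integral_pow_four_le
    (P.measurable_err i).aestronglyMeasurable (h.integrable_err i hi) (h.integral_err i hi)
    (k := 2) (by norm_num)

theorem cvar_nonneg (P : Given p q n) (o : Obs p) : 0 ≤ P.cvar o :=
  integral_nonneg fun _ => sq_nonneg _

theorem variance_infl_mul_err (h : P.Bounded lam R C) {i : Fin n} (hi : i ∈ P.sub) :
    Var[fun Y => P.infl i * P.err i (Y i); P.condLaw] = P.infl i ^ 2 * P.cvar (P.obs i) := by
  rw [variance_const_mul, ← h.variance_err hi]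
  congr 1
  exact (measurePreserving_eval (fun i => P.law (P.obs i)) i).variance_fun_comp
    (P.measurable_err i).aemeasurable

theorem integrable_infl_mul_err_pow_four (h : P.Bounded lam R C) {i : Fin n} (hi : i ∈ P.sub) :
    Integrable (fun Y => (P.infl i * P.err i (Y i)) ^ 4) P.condLaw := by
  simp only [mul_pow]
  exact (P.integrable_condLaw (h.integrable_err i hi)).const_mul _

theorem infl_pow_four_le (h : P.Bounded lam R C) {i : Fin n} (hi : i ∈ P.sub) :
    P.infl i ^ 4 ≤ (R / lam ^ 2) ^ 2 := by
  have := pow_le_pow_left₀ (sq_nonneg _) (h.infl_sq_le hi) 2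
  rwa [← pow_mul] at this

theorem integral_infl_mul_err_pow_four_le (h : P.Bounded lam R C) {i : Fin n} (hi : i ∈ P.sub) :
    ∫ Y, (P.infl i * P.err i (Y i)) ^ 4 ∂P.condLaw ≤ (R / lam ^ 2) ^ 2 * C := by
  simp only [mul_pow]
  rw [integral_const_mul, P.integral_condLaw (f := fun y => P.err i y ^ 4)
    ((P.measurable_err i).pow_const 4)]
  exact mul_le_mul (h.infl_pow_four_le hi) (h.integral_err i hi)
    (integral_nonneg fun y => by positivity) (by positivity)

theorem sum_variance (h : P.Bounded lam R C) :
    P.size⁻¹ * ∑ i ∈ P.sub, Var[fun Y => P.infl i * P.err i (Y i); P.condLaw] = P.sd ^ 2 := by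
  rw [h.sd_sq, dotProduct_Del_mulVec]
  congr 1
  refine Finset.sum_congr rfl fun i hi => ?_
  rw [h.variance_infl_mul_err hi, infl]
  ring

/-! The estimation error of the coefficients -/

theorem integral_sum_sq (h : P.Bounded lam R C) (c : Fin n → ℝ) :
    Integrable (fun Y => (∑ i ∈ P.sub, c i * (Y i - P.cexp (P.obs i))) ^ 2) P.condLaw ∧
    ∫ Y, (∑ i ∈ P.sub, c i * (Y i - P.cexp (P.obs i))) ^ 2 ∂P.condLaw =
      ∑ i ∈ P.sub, c i ^ 2 * P.cvar (P.obs i) := by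
  have hm : ∀ i ∈ P.sub, MemLp (fun Y : Fin n → ℝ => c i * (Y i - P.cexp (P.obs i))) 2 P.condLaw :=
    fun i hi => ((h.memLp_sub_cexp hi).comp_measurePreserving
      (measurePreserving_eval (fun i => P.law (P.obs i)) i)).const_mul (c i)
  have hsum := memLp_finsetSum P.sub hm
  refine ⟨hsum.integrable_sq, ?_⟩
  have h0 : ∀ i ∈ P.sub, ∫ Y, c i * (Y i - P.cexp (P.obs i)) ∂P.condLaw = 0 := fun i hi => by
    rw [integral_const_mul, P.integral_condLaw (f := fun y => y - P.cexp (P.obs i)) (by fun_prop),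
      h.integral_sub_cexp hi, mul_zero]
  have h1 := variance_of_integral_eq_zero hsum.1.aemeasurable (by
    rw [integral_finsetSum _ fun i hi => (hm i hi).integrable (by norm_num),
      Finset.sum_eq_zero h0])
  rw [← h1]
  have h2 := IndepFun.variance_sum hm fun i _ j _ hij =>
    (P.iIndepFun_condLaw (f := fun i y => c i * (y - P.cexp (P.obs i)))
      fun i => by fun_prop).indepFun hij
  rw [Finset.sum_fn] at h2
  rw [h2]
  refine Finset.sum_congr rfl fun i hi => ?_
  rw [variance_of_integral_eq_zero (hm i hi).1.aemeasurable (h0 i hi)]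
  simp only [mul_pow]
  rw [integral_const_mul, P.integral_condLaw (f := fun y => (y - P.cexp (P.obs i)) ^ 2)
    (by fun_prop), cvar]

/-- The squared distance of the estimated coefficients from the estimand is `O(1 / N)` in mean,
up to a bound that has this mean. -/
theorem exists_bound_lsq_sub_theta (h : P.Bounded lam R C) :
    ∃ Q : (Fin n → ℝ) → ℝ, Integrable Q P.condLaw ∧
      (∀ Y, 0 ≤ Q Y ∧ lam ^ 2 * ((P.lsq Y - P.theta) ⬝ᵥ (P.lsq Y - P.theta)) ≤ Q Y) ∧
      ∫ Y, Q Y ∂P.condLaw ≤ R * (1 + C) / P.size := by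
  -- V is the averaged score, equal to Γ applied to the estimation error. Its squared norm serves as
  -- Q: coercivity of Γ gives the pointwise bound and independence the mean.
  set V : (Fin n → ℝ) → Fin (q + 2) → ℝ := fun Y =>
    P.size⁻¹ • ∑ i ∈ P.sub, (Y i - P.cexp (P.obs i)) • P.reg i with hV
  have hVk : ∀ Y, V Y ⬝ᵥ V Y = P.size⁻¹ ^ 2 * ∑ k, (∑ i ∈ P.sub, P.reg i k *
      (Y i - P.cexp (P.obs i))) ^ 2 := by
    intro Y
    simp only [dotProduct, hV, Pi.smul_apply, Finset.sum_apply, smul_eq_mul, Finset.mul_sum _ _ (_ ^ 2)]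
    refine Finset.sum_congr rfl fun k _ => ?_
    rw [← sq, mul_pow]
    congr 2
    exact Finset.sum_congr rfl fun i _ => mul_comm _ _
  refine ⟨fun Y => V Y ⬝ᵥ V Y, ?_, fun Y => ⟨dotProduct_self_nonneg' _, ?_⟩, ?_⟩
  · simp only [hVk]
    exact (integrable_finsetSum _ fun k _ =>
      (h.integral_sum_sq fun i => P.reg i k).1).const_mul _
  · have h1 := sq_mul_dotProduct_self_le_of_quadForm_le h.lam_pos h.gam (P.lsq Y - P.theta)
    rw [theta, lsq_sub_lsq, Matrix.mulVec_mulVec, Matrix.mul_nonsing_inv _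
      ((Matrix.isUnit_iff_isUnit_det _).1 h.isUnit_Gam), Matrix.one_mulVec, ← lsq_sub_lsq] at h1
    exact h1
  · simp only [hVk]
    rw [integral_const_mul, integral_finsetSum _ fun k _ =>
      (h.integral_sum_sq fun i => P.reg i k).1]
    simp only [(h.integral_sum_sq _).2]
    rw [Finset.sum_comm]
    have h1 : ∑ i ∈ P.sub, ∑ k, P.reg i k ^ 2 * P.cvar (P.obs i) ≤
        P.sub.card • (R * (1 + C)) := by
      refine Finset.sum_le_card_nsmul _ _ _ fun i hi => ?_
      rw [← Finset.sum_mul]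
      refine mul_le_mul ?_ (h.cvar_le hi) (cvar_nonneg P _) h.R_nonneg
      refine le_trans (le_of_eq ?_) (h.reg i hi)
      exact Finset.sum_congr rfl fun k _ => sq _
    have hs := h.size_pos
    calc _ ≤ P.size⁻¹ ^ 2 * (P.sub.card • (R * (1 + C))) := by gcongr
      _ = P.size⁻¹ ^ 2 * (P.size * (R * (1 + C))) := by rw [nsmul_eq_mul, size]
      _ = _ := by field_simp

/-- The influence of the estimation error of the coefficients on the standard error. -/
theorem abs_sqrt_SigHat_sub_le (h : P.Bounded lam R C) {l : Fin n → Fin n}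
    (hl : ∀ i ∈ P.sub, l i ∈ P.sub) (Y : Fin n → ℝ) :
    |√(P.SigHat l Y 1 1) - √((2 * P.size)⁻¹ * ∑ i ∈ P.sub,
      (P.infl i * P.err i (Y i) - P.infl (l i) * P.err (l i) (Y (l i))) ^ 2)| ≤
      √(2 * (R / lam ^ 2) * R * ((P.lsq Y - P.theta) ⬝ᵥ (P.lsq Y - P.theta))) := by
  set D := P.lsq Y - P.theta with hD
  have hs := h.size_pos
  have h2s : 0 ≤ (2 * P.size)⁻¹ := by positivity
  rw [SigHat_one_one, Real.sqrt_mul h2s, Real.sqrt_mul h2s, ← mul_sub, abs_mul,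
    abs_of_nonneg (Real.sqrt_nonneg _)]
  -- Residuals are errors minus `reg`·D, so Minkowski's inequality isolates the matched differences
  -- of `infl`·(`reg`·D).
  have h1 := abs_sqrt_sum_sub_sq_sub_le P.sub
    (fun i => P.infl i * P.err i (Y i) - P.infl (l i) * P.err (l i) (Y (l i)))
    (fun i => P.infl i * (P.reg i ⬝ᵥ D) - P.infl (l i) * (P.reg (l i) ⬝ᵥ D))
  have h2 : ∀ i, P.resid Y i * P.infl i - P.resid Y (l i) * P.infl (l i) =
      (P.infl i * P.err i (Y i) - P.infl (l i) * P.err (l i) (Y (l i))) -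
        (P.infl i * (P.reg i ⬝ᵥ D) - P.infl (l i) * (P.reg (l i) ⬝ᵥ D)) := fun i => by
    rw [resid_eq, resid_eq]
    ring
  simp only [h2]
  refine (mul_le_mul_of_nonneg_left h1 (Real.sqrt_nonneg _)).trans ?_
  rw [← Real.sqrt_mul h2s]
  refine Real.sqrt_le_sqrt ?_
  have hterm : ∀ i ∈ P.sub, (P.infl i * (P.reg i ⬝ᵥ D)) ^ 2 ≤ R / lam ^ 2 * (R * (D ⬝ᵥ D)) := by
    intro i hi
    rw [mul_pow]
    refine mul_le_mul (h.infl_sq_le hi) ?_ (sq_nonneg _) (div_nonneg h.R_nonneg (sq_nonneg _))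
    exact (dotProduct_sq_le _ _).trans
      (mul_le_mul_of_nonneg_right (h.reg i hi) (dotProduct_self_nonneg' _))
  have hsum : ∑ i ∈ P.sub, (P.infl i * (P.reg i ⬝ᵥ D) - P.infl (l i) * (P.reg (l i) ⬝ᵥ D)) ^ 2 ≤
      P.sub.card • (4 * (R / lam ^ 2 * (R * (D ⬝ᵥ D)))) := by
    refine Finset.sum_le_card_nsmul _ _ _ fun i hi => ?_
    have a1 := hterm i hi
    have a2 := hterm _ (hl i hi)
    nlinarith [sq_nonneg (P.infl i * (P.reg i ⬝ᵥ D) + P.infl (l i) * (P.reg (l i) ⬝ᵥ D))]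
  calc _ ≤ (2 * P.size)⁻¹ * (P.sub.card • (4 * (R / lam ^ 2 * (R * (D ⬝ᵥ D))))) :=
        mul_le_mul_of_nonneg_left hsum h2s
    _ = (2 * P.size)⁻¹ * (P.size * (4 * (R / lam ^ 2 * (R * (D ⬝ᵥ D))))) := by
        rw [nsmul_eq_mul, size]
    _ = _ := by field_simp; ring

end Bounded

end Given

/-! ### From regular conditional moments to uniform bounds and close matched moments -/

namespace Given

variable {p q n : ℕ} {P : Given p q n}

theorem moment_obs_eq (j k : Fin (q + 2)) (a b c : ℕ) (i : Fin n) :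
    P.moment j k a b c (P.obs i) =
      P.reg i j ^ a * P.reg i k ^ b * ∫ y, P.err i y ^ c ∂(P.law (P.obs i)) :=
  integral_const_mul _ _

/-- Exponents (2, 2, 0) with j = k bound Z_j⁴, hence Z_j² through t² ≤ 1 + t⁴. Exponents (2, 2, 4)
on the constant regressor give the fourth moment of the error. -/
theorem bounded_of_momentRegular {ψ : Ctrl p → Ctrl p → ℝ} {M lam : ℝ} (hM : 0 ≤ M)
    (h : P.MomentRegular ψ M) (hs : 0 < P.size) (hlam : 0 < lam)
    (hG : ∀ x, lam * (x ⬝ᵥ x) ≤ x ⬝ᵥ P.Gam *ᵥ x) (hD : ∀ x, lam * (x ⬝ᵥ x) ≤ x ⬝ᵥ P.Del *ᵥ x) :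
    P.Bounded lam ((q + 2) * (1 + M)) M where
  size_pos := hs
  lam_pos := hlam
  gam := hG
  del := hD
  reg i hi := by
    have h1 : ∀ j ∈ (Finset.univ : Finset (Fin (q + 2))), P.reg i j * P.reg i j ≤ 1 + M := by
      intro j _
      have h2 := (le_abs_self _).trans
        (h.bounded j j 2 2 0 (by norm_num) (by norm_num) (by norm_num) i hi)
      rw [moment_obs_eq] at h2
      simp only [pow_zero, integral_const, probReal_univ, smul_eq_mul, mul_one] at h2
      nlinarith [sq_nonneg (P.reg i j ^ 2 - 1)]
    have := Finset.sum_le_card_nsmul _ _ _ h1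
    simpa [dotProduct, mul_add] using this
  integrable_err i hi := by
    have := h.integrable 0 0 2 2 4 (by norm_num) (by norm_num) (by norm_num) i hi
    simpa [Z, err, reg] using this
  integral_err i hi := by
    have := (le_abs_self _).trans
      (h.bounded 0 0 2 2 4 (by norm_num) (by norm_num) (by norm_num) i hi)
    rw [moment_obs_eq] at this
    simpa [reg_zero] using this

namespace Bounded

variable {lam R C : ℝ}

theorem abs_slope_le (h : P.Bounded lam R C) (j : Fin (q + 2)) : |P.slope j| ≤ lam⁻¹ := by
  have h1 : P.slope j ^ 2 ≤ P.slope ⬝ᵥ P.slope := by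
    rw [sq]
    exact Finset.single_le_sum (f := fun j => P.slope j * P.slope j)
      (fun i _ => mul_self_nonneg _) (Finset.mem_univ j)
  have h2 := h1.trans h.slope_dotProduct_slope_le
  rw [← inv_pow] at h2
  exact abs_le_of_sq_le_sq h2 (inv_pos.2 h.lam_pos).le

/-- Expanding `infl` in the components of `slope` turns the mean into a combination, with bounded
coefficients, of moments that are Lipschitz within an arm. The second moment is treated likewise by
a double sum. -/
theorem abs_integral_infl_mul_err_sub_le (h : P.Bounded lam R C) {ψ : Ctrl p → Ctrl p → ℝ} {M : ℝ}
    (hr : P.MomentRegular ψ M) {d : Bool} {i i' : Fin n} (hi : i ∈ P.arm d) (hi' : i' ∈ P.arm d) :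
    |∫ Y, P.infl i * P.err i (Y i) ∂P.condLaw - ∫ Y, P.infl i' * P.err i' (Y i') ∂P.condLaw| ≤
      (q + 2) * lam⁻¹ * (M * ψ (P.X i) (P.X i')) := by
  have h1 : ∀ i, ∫ Y, P.infl i * P.err i (Y i) ∂P.condLaw =
      ∑ j, P.slope j * P.moment j 0 1 0 1 (P.obs i) := by
    intro i
    rw [integral_const_mul, P.integral_condLaw (P.measurable_err i), infl, dotProduct,
      Finset.sum_mul]
    refine Finset.sum_congr rfl fun j _ => ?_
    rw [moment_obs_eq]
    simp only [pow_one, pow_zero, mul_one]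
    ring
  rw [h1, h1, ← Finset.sum_sub_distrib]
  refine (Finset.abs_sum_le_sum_abs _ _).trans ?_
  have h2 : ∀ j ∈ (Finset.univ : Finset (Fin (q + 2))),
      |P.slope j * P.moment j 0 1 0 1 (P.obs i) - P.slope j * P.moment j 0 1 0 1 (P.obs i')| ≤
        lam⁻¹ * (M * ψ (P.X i) (P.X i')) := by
    intro j _
    rw [← mul_sub, abs_mul]
    exact mul_le_mul (h.abs_slope_le j)
      (hr.lipschitz j 0 1 0 1 (by norm_num) (by norm_num) (by norm_num) d i hi i' hi')
      (abs_nonneg _) (inv_pos.2 h.lam_pos).le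
  refine (Finset.sum_le_card_nsmul _ _ _ h2).trans (le_of_eq ?_)
  simp
  ring

theorem abs_integral_infl_mul_err_sq_sub_le (h : P.Bounded lam R C) {ψ : Ctrl p → Ctrl p → ℝ}
    {M : ℝ} (hr : P.MomentRegular ψ M) {d : Bool} {i i' : Fin n} (hi : i ∈ P.arm d)
    (hi' : i' ∈ P.arm d) :
    |∫ Y, (P.infl i * P.err i (Y i)) ^ 2 ∂P.condLaw -
      ∫ Y, (P.infl i' * P.err i' (Y i')) ^ 2 ∂P.condLaw| ≤
      (q + 2) * ((q + 2) * (lam⁻¹ * lam⁻¹ * (M * ψ (P.X i) (P.X i')))) := by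
  have h1 : ∀ i, ∫ Y, (P.infl i * P.err i (Y i)) ^ 2 ∂P.condLaw =
      ∑ j, ∑ k, P.slope j * P.slope k * P.moment j k 1 1 2 (P.obs i) := by
    intro i
    simp only [mul_pow]
    rw [integral_const_mul, P.integral_condLaw (f := fun y => P.err i y ^ 2)
      ((P.measurable_err i).pow_const 2), infl, dotProduct, sq, Finset.sum_mul_sum, Finset.sum_mul]
    refine Finset.sum_congr rfl fun j _ => ?_
    rw [Finset.sum_mul]
    refine Finset.sum_congr rfl fun k _ => ?_
    rw [moment_obs_eq]
    simp only [pow_one]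
    ring
  rw [h1, h1, ← Finset.sum_sub_distrib]
  refine (Finset.abs_sum_le_sum_abs _ _).trans ?_
  have h2 : ∀ j ∈ (Finset.univ : Finset (Fin (q + 2))),
      |∑ k, P.slope j * P.slope k * P.moment j k 1 1 2 (P.obs i) -
        ∑ k, P.slope j * P.slope k * P.moment j k 1 1 2 (P.obs i')| ≤
        (q + 2) * (lam⁻¹ * lam⁻¹ * (M * ψ (P.X i) (P.X i'))) := by
    intro j _
    rw [← Finset.sum_sub_distrib]
    refine (Finset.abs_sum_le_sum_abs _ _).trans ?_
    have h3 : ∀ k ∈ (Finset.univ : Finset (Fin (q + 2))),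
        |P.slope j * P.slope k * P.moment j k 1 1 2 (P.obs i) -
          P.slope j * P.slope k * P.moment j k 1 1 2 (P.obs i')| ≤
          lam⁻¹ * lam⁻¹ * (M * ψ (P.X i) (P.X i')) := by
      intro k _
      have hl0 := (inv_pos.2 h.lam_pos).le
      rw [← mul_sub, abs_mul, abs_mul]
      exact mul_le_mul (mul_le_mul (h.abs_slope_le j) (h.abs_slope_le k) (abs_nonneg _) hl0)
        (hr.lipschitz j k 1 1 2 (by norm_num) (by norm_num) (by norm_num) d i hi i' hi')
        (abs_nonneg _) (mul_nonneg hl0 hl0)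
    refine (Finset.sum_le_card_nsmul _ _ _ h3).trans (le_of_eq ?_)
    simp
  refine (Finset.sum_le_card_nsmul _ _ _ h2).trans (le_of_eq ?_)
  simp

end Bounded

end Given

/-- The matching estimator of the asymptotic standard deviation is consistent. -/
theorem tendsto_measureReal_sqrt_SigHat {p q : ℕ} (P : ∀ n, Given p q n)
    (hlarge : Tendsto (fun n => (P n).sub.card) atTop atTop) {lam R C M : ℝ} (hlam : 0 < lam)
    (hR : 0 < R) (hC : 0 ≤ C) (hM : 0 ≤ M) (hb : ∀ᶠ n in atTop, (P n).Bounded lam R C)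
    {ψ : Ctrl p → Ctrl p → ℝ} (hψ : IsMetric ψ) {K : ℝ} (hdom : ∀ x y, ψ x y ≤ K * dist x y)
    (hreg : ∀ᶠ n in atTop, (P n).MomentRegular ψ M) {κ : ℝ} (hκ : 0 < κ) (l : ∀ n, Fin n → Fin n)
    (hl : ∀ᶠ n in atTop, (P n).IsMatch ψ κ (l n)) {B : ℕ}
    (hB : ∀ᶠ n in atTop, ∀ j, ((P n).sub.filter fun i => l n i = j).card ≤ B)
    (ε : ℝ) (hε : 0 < ε) :
    Tendsto (fun n => (P n).condLaw.real {Y | ε ≤ |√((P n).SigHat (l n) Y 1 1) - (P n).sd|})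
      atTop (𝓝 0) := by
  have hbad : ∀ η > 0, ∃ N : ℕ, ∀ᶠ n in atTop, ((P n).sub.filter fun i =>
      ¬(|∫ Y, ((P n).infl (l n i) * (P n).err (l n i) (Y (l n i))) ^ 2 ∂(P n).condLaw -
          ∫ Y, ((P n).infl i * (P n).err i (Y i)) ^ 2 ∂(P n).condLaw| ≤ η ∧
        |∫ Y, (P n).infl i * (P n).err i (Y i) ∂(P n).condLaw -
          ∫ Y, (P n).infl (l n i) * (P n).err (l n i) (Y (l n i)) ∂(P n).condLaw| ≤ η)).card ≤ N := by
    intro η hη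
    set L₁ : ℝ := (q + 2) * lam⁻¹ * M with hL₁
    set L₂ : ℝ := (q + 2) * ((q + 2) * (lam⁻¹ * lam⁻¹ * M)) with hL₂
    have hL₁0 : 0 ≤ L₁ := by positivity
    have hL₂0 : 0 ≤ L₂ := by positivity
    obtain ⟨N, hN⟩ := Given.exists_card_not_close_match_le M hκ
      (show 0 < η / (L₁ + L₂ + 1) by positivity) hψ hdom
    refine ⟨N, ?_⟩
    filter_upwards [hb, hreg, hl] with n hb hreg hl
    refine le_trans (Finset.card_le_card ?_) (hN (P n) (l n) hl hreg.diam)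
    intro i hi
    rw [Finset.mem_filter] at hi ⊢
    refine ⟨hi.1, fun hclose => hi.2 ?_⟩
    obtain ⟨hd, hc⟩ := hclose
    have m1 : i ∈ (P n).arm ((P n).obs i).2 := (P n).mem_arm.2 ⟨hi.1, rfl⟩
    have m2 : l n i ∈ (P n).arm ((P n).obs i).2 := (P n).mem_arm.2 ⟨(hl i hi.1).1, hd⟩
    have b1 := hb.abs_integral_infl_mul_err_sub_le hreg m1 m2
    have b2 := hb.abs_integral_infl_mul_err_sq_sub_le hreg m1 m2
    have hψ0 := hψ.nonneg ((P n).X i) ((P n).X (l n i))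
    have hle : (L₁ + L₂ + 1) * ψ ((P n).X i) ((P n).X (l n i)) ≤ η := by
      rw [le_div_iff₀ (by positivity)] at hc
      linarith
    have p1 := mul_nonneg hL₁0 hψ0
    have p2 := mul_nonneg hL₂0 hψ0
    constructor
    · rw [abs_sub_comm]
      refine b2.trans ?_
      calc _ = L₂ * ψ ((P n).X i) ((P n).X (l n i)) := by rw [hL₂]; ring
        _ ≤ _ := by nlinarith
    · refine b1.trans ?_
      calc _ = L₁ * ψ ((P n).X i) ((P n).X (l n i)) := by rw [hL₁]; ring
        _ ≤ _ := by nlinarith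
  have hc : 0 < lam / R := div_pos hlam hR
  -- The tolerance ε/2·√(lam/R) for variances becomes ε/2 for standard deviations, as the asymptotic
  -- variance is at least lam/R.
  have hconv := tendsto_measureReal_matched_difference (fun n => (P n).condLaw)
    (fun n => (P n).sub) (fun n i Y => (P n).infl i * (P n).err i (Y i))
    (fun n i => (((P n).measurable_err i).comp (measurable_pi_apply i)).const_mul _)
    (fun n => (P n).iIndepFun_condLaw fun i => ((P n).measurable_err i).const_mul _)
    hlarge l (by filter_upwards [hl] with n hl i hi using ⟨(hl i hi).1, (hl i hi).2.1⟩)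
    (C := (R / lam ^ 2) ^ 2 * C) (by positivity)
    (by filter_upwards [hb] with n hb i hi using
      ⟨hb.integrable_infl_mul_err_pow_four hi, hb.integral_infl_mul_err_pow_four_le hi⟩)
    hB hbad (ε / 2 * √(lam / R)) (by positivity)
  set K₂ : ℝ := 2 * (R / lam ^ 2) * R with hK₂
  have hK₂0 : 0 < K₂ := by positivity
  -- Chosen so that Q < t keeps the effect of estimating the coefficients below ε/2.
  set t : ℝ := (ε / 2) ^ 2 * (lam ^ 2 / K₂) with ht
  have ht0 : 0 < t := by positivity
  have hNt : Tendsto (fun n => ((P n).sub.card : ℝ)) atTop atTop :=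
    tendsto_natCast_atTop_atTop.comp hlarge
  have hrem : Tendsto (fun n => R * (1 + C) / t * ((P n).sub.card : ℝ)⁻¹) atTop (𝓝 0) := by
    simpa using (tendsto_inv_atTop_zero.comp hNt).const_mul (R * (1 + C) / t)
  have hsum := hconv.add hrem
  rw [add_zero] at hsum
  refine squeeze_zero' (Eventually.of_forall fun n => measureReal_nonneg) ?_ hsum
  filter_upwards [hb, hl] with n hb hl
  obtain ⟨Q, hQi, hQ, hQE⟩ := hb.exists_bound_lsq_sub_theta
  have hsub : {Y | ε ≤ |√((P n).SigHat (l n) Y 1 1) - (P n).sd|} ⊆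
      {Y | ε / 2 * √(lam / R) ≤ |(2 * ((P n).sub.card : ℝ))⁻¹ * ∑ i ∈ (P n).sub,
        ((P n).infl i * (P n).err i (Y i) -
          (P n).infl (l n i) * (P n).err (l n i) (Y (l n i))) ^ 2 -
        ((P n).sub.card : ℝ)⁻¹ * ∑ i ∈ (P n).sub,
          Var[fun Y => (P n).infl i * (P n).err i (Y i); (P n).condLaw]|} ∪ {Y | t ≤ Q Y} := by
    intro Y hY
    by_contra hcon
    simp only [Set.mem_union, Set.mem_ofPred_eq, not_or, not_le] at hcon hY
    obtain ⟨h1, h2⟩ := hcon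
    have hsv := hb.sum_variance
    rw [Given.size] at hsv
    rw [hsv, hb.sd_sq] at h1
    set T := (2 * ((P n).sub.card : ℝ))⁻¹ * ∑ i ∈ (P n).sub,
        ((P n).infl i * (P n).err i (Y i) -
          (P n).infl (l n i) * (P n).err (l n i) (Y (l n i))) ^ 2 with hT
    have hT0 : 0 ≤ T := mul_nonneg (by positivity) (Finset.sum_nonneg fun _ _ => sq_nonneg _)
    have h3 : |√T - (P n).sd| < ε / 2 := by
      refine (abs_sqrt_sub_le hT0 hc hb.le_slope_Del_slope).trans_lt ?_
      rwa [div_lt_iff₀ (Real.sqrt_pos.2 hc)]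
    have h4 := hb.abs_sqrt_SigHat_sub_le (fun i hi => (hl i hi).1) Y
    rw [Given.size, ← hT] at h4
    have h5 : √(2 * (R / lam ^ 2) * R *
        (((P n).lsq Y - (P n).theta) ⬝ᵥ ((P n).lsq Y - (P n).theta))) < ε / 2 := by
      rw [Real.sqrt_lt' (by positivity), ← hK₂]
      have h6 := (hQ Y).2.trans_lt h2
      have h7 : K₂ * (((P n).lsq Y - (P n).theta) ⬝ᵥ ((P n).lsq Y - (P n).theta)) =
          K₂ / lam ^ 2 * (lam ^ 2 *
            (((P n).lsq Y - (P n).theta) ⬝ᵥ ((P n).lsq Y - (P n).theta))) := by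
        field_simp
      rw [h7]
      calc _ < K₂ / lam ^ 2 * t := by gcongr
        _ = _ := by rw [ht]; field_simp
    have h8 := abs_sub_le (√((P n).SigHat (l n) Y 1 1)) (√T) (P n).sd
    linarith
  refine (measureReal_mono hsub).trans ((measureReal_union_le _ _).trans ?_)
  refine add_le_add le_rfl ?_
  have hmarkov := mul_meas_ge_le_integral_of_nonneg (ae_of_all _ fun Y => (hQ Y).1) hQi t
  have hsz := hb.size_pos
  have h9 := hmarkov.trans hQE
  rw [mul_comm, ← le_div_iff₀ ht0] at h9
  refine h9.trans (le_of_eq ?_)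
  rw [Given.size]
  ring

/-! ### The normal distribution function and its quantiles -/

theorem Phi_monotone : Monotone Phi := fun _ _ h => monotone_cdf _ h

/-- No atom means no jump from the left; right-continuity holds for every distribution function. -/
theorem continuous_Phi : Continuous Phi := by
  have hns := nullSingletonClass_gaussianReal (μ := 0) (v := 1) one_ne_zero
  rw [continuous_iff_continuousAt]
  intro z
  have h1 : (cdf (gaussianReal 0 1)).measure {z} = 0 := by
    rw [measure_cdf]
    exact measure_singleton z
  rw [StieltjesFunction.measure_singleton, ENNReal.ofReal_eq_zero] at h1
  have h2 : Function.leftLim (cdf (gaussianReal 0 1)) z = cdf (gaussianReal 0 1) z :=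
    le_antisymm ((monotone_cdf _).leftLim_le le_rfl) (by linarith)
  have h3 := (monotone_cdf (gaussianReal 0 1)).continuousAt_iff_leftLim_eq_rightLim (x := z)
  rw [StieltjesFunction.rightLim_eq] at h3
  exact h3.2 h2

theorem Phi_quantile {a : ℝ} (h0 : 0 < a) (h1 : a < 1) : Phi (quantile a) = a := by
  have hbot : Tendsto Phi atBot (𝓝 0) := tendsto_cdf_atBot _
  have htop : Tendsto Phi atTop (𝓝 1) := tendsto_cdf_atTop _
  obtain ⟨x, hx⟩ := (hbot.eventually_lt_const h0).exists
  obtain ⟨y, hy⟩ := (htop.eventually_const_lt h1).exists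
  obtain ⟨z, hz⟩ := mem_range_of_exists_le_of_exists_ge continuous_Phi ⟨x, hx.le⟩ ⟨y, hy.le⟩
  have hbdd : BddBelow {z : ℝ | a ≤ Phi z} := ⟨x, fun u hu => by
    by_contra hux
    exact absurd (hu.trans (Phi_monotone (not_le.1 hux).le)) (not_le.2 hx)⟩
  have hclosed : IsClosed {z : ℝ | a ≤ Phi z} := isClosed_le continuous_const continuous_Phi
  refine le_antisymm ?_ (hclosed.csInf_mem ⟨z, hz.ge⟩ hbdd)
  exact (Phi_monotone (csInf_le hbdd hz.ge)).trans hz.le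

/-- Slutsky's lemma for a ratio, without dividing. -/
theorem tendsto_measureReal_le_mul {Ω : ℕ → Type*} [∀ n, MeasurableSpace (Ω n)]
    (μ : ∀ n, Measure (Ω n)) [∀ n, IsProbabilityMeasure (μ n)] (S r : ∀ n, Ω n → ℝ)
    (hS : ∀ z, Tendsto (fun n => (μ n).real {ω | S n ω ≤ z}) atTop (𝓝 (Phi z)))
    (hr : ∀ ε > 0, Tendsto (fun n => (μ n).real {ω | ε ≤ |r n ω - 1|}) atTop (𝓝 0)) (z : ℝ) :
    Tendsto (fun n => (μ n).real {ω | S n ω ≤ z * r n ω}) atTop (𝓝 (Phi z)) := by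
  have hshift : ∀ ε > 0, ∀ n, (μ n).real {ω | S n ω ≤ z - |z| * ε} ≤
      (μ n).real {ω | S n ω ≤ z * r n ω} + (μ n).real {ω | ε ≤ |r n ω - 1|} ∧
      (μ n).real {ω | S n ω ≤ z * r n ω} ≤
      (μ n).real {ω | S n ω ≤ z + |z| * ε} + (μ n).real {ω | ε ≤ |r n ω - 1|} := by
    intro ε _ n
    have key : ∀ ω, ω ∉ {ω | ε ≤ |r n ω - 1|} → |z * r n ω - z| ≤ |z| * ε := by
      intro ω hω
      have hω' : |r n ω - 1| ≤ ε := (not_le.1 hω).le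
      rw [show z * r n ω - z = z * (r n ω - 1) by ring, abs_mul]
      exact mul_le_mul_of_nonneg_left hω' (abs_nonneg _)
    constructor
    · refine (measureReal_mono fun ω hω => ?_).trans (measureReal_union_le _ _)
      by_cases h : ω ∈ {ω | ε ≤ |r n ω - 1|}
      · exact Or.inr h
      · left
        have h1 := abs_le.1 (key ω h)
        have h2 : S n ω ≤ z - |z| * ε := hω
        change S n ω ≤ z * r n ω
        linarith
    · refine (measureReal_mono fun ω hω => ?_).trans (measureReal_union_le _ _)
      by_cases h : ω ∈ {ω | ε ≤ |r n ω - 1|}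
      · exact Or.inr h
      · left
        have h1 := abs_le.1 (key ω h)
        have h2 : S n ω ≤ z * r n ω := hω
        change S n ω ≤ z + |z| * ε
        linarith
  have hc1 : Tendsto (fun ε => Phi (z - |z| * ε)) (𝓝[>] 0) (𝓝 (Phi z)) := by
    have : Continuous fun ε => Phi (z - |z| * ε) := continuous_Phi.comp (by fun_prop)
    simpa using (this.tendsto 0).mono_left nhdsWithin_le_nhds
  have hc2 : Tendsto (fun ε => Phi (z + |z| * ε)) (𝓝[>] 0) (𝓝 (Phi z)) := by
    have : Continuous fun ε => Phi (z + |z| * ε) := continuous_Phi.comp (by fun_prop)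
    simpa using (this.tendsto 0).mono_left nhdsWithin_le_nhds
  rw [tendsto_order]
  constructor
  · intro a ha
    obtain ⟨ε, hε, hεpos⟩ := ((hc1.eventually_const_lt ha).and self_mem_nhdsWithin).exists
    have h1 := (hS (z - |z| * ε)).sub (hr ε hεpos)
    rw [sub_zero] at h1
    filter_upwards [h1.eventually_const_lt hε] with n hn
    linarith [(hshift ε hεpos n).1]
  · intro a ha
    obtain ⟨ε, hε, hεpos⟩ := ((hc2.eventually_lt_const ha).and self_mem_nhdsWithin).exists
    have h1 := (hS (z + |z| * ε)).add (hr ε hεpos)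
    rw [add_zero] at h1
    filter_upwards [h1.eventually_lt_const hε] with n hn
    linarith [(hshift ε hεpos n).2]

/-! ### Asymptotic normality of the studentized estimator -/

/-- The event is stated with a product, since the t-ratio has no meaning where the standard error
vanishes. That event has vanishing probability and is split off later. -/
theorem tendsto_measureReal_betaHat {p q : ℕ} (P : ∀ n, Given p q n)
    (hlarge : Tendsto (fun n => (P n).sub.card) atTop atTop) {lam R C : ℝ} (hlam : 0 < lam)
    (hR : 0 < R) (hb : ∀ᶠ n in atTop, (P n).Bounded lam R C) (l : ∀ n, Fin n → Fin n)
    (hsd : ∀ ε > 0, Tendsto (fun n => (P n).condLaw.real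
      {Y | ε ≤ |√((P n).SigHat (l n) Y 1 1) - (P n).sd|}) atTop (𝓝 0)) :
    (∀ z, Tendsto (fun n => (P n).condLaw.real
      {Y | (P n).betaHat Y - (P n).theta 1 ≤ z * (P n).se (l n) Y}) atTop (𝓝 (Phi z))) ∧
    Tendsto (fun n => (P n).condLaw.real {Y | (P n).se (l n) Y ≤ 0}) atTop (𝓝 0) := by
  have hc : 0 < √(lam / R) := Real.sqrt_pos.2 (div_pos hlam hR)
  have hS := tendsto_measureReal_normalized_sum_le (fun n => (P n).condLaw) (fun n => (P n).sub)
    (fun n i Y => (P n).infl i * (Y i - (P n).cexp ((P n).obs i)))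
    (fun n i => by fun_prop)
    (fun n => (P n).iIndepFun_condLaw (f := fun i y => (P n).infl i *
      (y - (P n).cexp ((P n).obs i))) fun i => by fun_prop)
    hlarge (C := (R / lam ^ 2) ^ 2 * (8 * (C + (1 + C) ^ 4))) (div_pos hlam hR)
    (by
      filter_upwards [hb] with n hb i hi
      rw [integral_const_mul, (P n).integral_condLaw (f := fun y => y - (P n).cexp ((P n).obs i))
        (by fun_prop), hb.integral_sub_cexp hi, mul_zero])
    (by
      filter_upwards [hb] with n hb i hi
      simp only [mul_pow]
      refine ⟨((P n).integrable_condLaw (hb.integrable_sub_cexp_pow_four hi)).const_mul _, ?_⟩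
      rw [integral_const_mul, (P n).integral_condLaw
        (f := fun y => (y - (P n).cexp ((P n).obs i)) ^ 4) (by fun_prop)]
      exact mul_le_mul (hb.infl_pow_four_le hi) (hb.integral_sub_cexp_pow_four_le hi)
        (integral_nonneg fun y => by positivity) (by positivity))
    (fun n => (P n).sd * √(P n).size) (fun n => mul_nonneg (Real.sqrt_nonneg _) (Real.sqrt_nonneg _))
    (by
      filter_upwards [hb] with n hb
      have hs := hb.size_pos
      rw [mul_pow, Real.sq_sqrt hs.le, ← hb.sum_variance, mul_comm,
        mul_inv_cancel_left₀ hs.ne']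
      refine Finset.sum_congr rfl fun i hi => ?_
      rw [hb.variance_infl_mul_err hi]
      simp only [mul_pow]
      rw [integral_const_mul, (P n).integral_condLaw
        (f := fun y => (y - (P n).cexp ((P n).obs i)) ^ 2) (by fun_prop), Given.cvar])
    (by
      filter_upwards [hb] with n hb
      rw [mul_pow, Real.sq_sqrt hb.size_pos.le, hb.sd_sq]
      exact mul_le_mul_of_nonneg_right hb.le_slope_Del_slope hb.size_pos.le)
  constructor
  · intro z
    have hr : ∀ ε > 0, Tendsto (fun n => (P n).condLaw.real
        {Y | ε ≤ |√((P n).SigHat (l n) Y 1 1) / (P n).sd - 1|}) atTop (𝓝 0) := by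
      intro ε hε
      refine squeeze_zero' (Eventually.of_forall fun n => measureReal_nonneg) ?_
        (hsd (ε * √(lam / R)) (mul_pos hε hc))
      filter_upwards [hb] with n hb
      refine measureReal_mono fun Y hY => ?_
      have hY' : ε ≤ |√((P n).SigHat (l n) Y 1 1) / (P n).sd - 1| := hY
      change ε * √(lam / R) ≤ |√((P n).SigHat (l n) Y 1 1) - (P n).sd|
      have hp := hb.sd_pos
      rw [div_sub_one hp.ne', abs_div, abs_of_pos hp, le_div_iff₀ hp] at hY'
      exact (mul_le_mul_of_nonneg_left hb.sqrt_le_sd hε.le).trans hY'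
    have hfin := tendsto_measureReal_le_mul (fun n => (P n).condLaw) _ _ hS hr z
    refine hfin.congr' ?_
    filter_upwards [hb] with n hb
    congr 1
    ext Y
    have hp := hb.sd_pos
    have hs := hb.size_pos
    have hsq := Real.sqrt_pos.2 hs
    have e1 : (P n).size⁻¹ = (√(P n).size)⁻¹ * (√(P n).size)⁻¹ := by
      rw [← mul_inv, Real.mul_self_sqrt hs.le]
    simp only [Set.mem_ofPred_eq]
    rw [(P n).betaHat_sub_theta, Given.se, e1, mul_inv, mul_comm (P n).sd⁻¹, mul_assoc,
      mul_assoc, ← mul_div_assoc, ← mul_div_assoc, ← div_eq_inv_mul, ← div_eq_inv_mul,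
      ← div_eq_inv_mul, ← div_eq_inv_mul, div_div, div_div]
    rw [div_le_div_iff₀ (by positivity) (by positivity), div_le_div_iff₀ (by positivity) (by positivity)]
    constructor
    · intro h
      refine le_of_mul_le_mul_right ?_ hp
      nlinarith
    · intro h
      refine le_of_mul_le_mul_right ?_ hsq
      nlinarith
  · refine squeeze_zero' (Eventually.of_forall fun n => measureReal_nonneg) ?_ (hsd _ hc)
    filter_upwards [hb] with n hb
    refine measureReal_mono fun Y hY => ?_
    have hsq := Real.sqrt_pos.2 hb.size_pos
    have h1 : √((P n).SigHat (l n) Y 1 1) / √(P n).size ≤ 0 := hY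
    have h2 : √((P n).SigHat (l n) Y 1 1) ≤ 0 := by
      rw [div_le_iff₀ hsq, zero_mul] at h1
      exact h1
    have h3 : √((P n).SigHat (l n) Y 1 1) = 0 := le_antisymm h2 (Real.sqrt_nonneg _)
    -- A vanishing standard error would put the estimate at distance `sd`, at least √(lam/R), from
    -- its limit.
    change √(lam / R) ≤ |√((P n).SigHat (l n) Y 1 1) - (P n).sd|
    rw [h3, zero_sub, abs_neg, abs_of_pos hb.sd_pos]
    exact hb.sqrt_le_sd

theorem le_liminf_of_tendsto_of_le {f g : ℕ → ℝ} {L : ℝ} (hf : Tendsto f atTop (𝓝 L))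
    (h : ∀ᶠ n in atTop, f n ≤ g n) (hg : ∀ n, g n ≤ 1) : L ≤ liminf g atTop := by
  rw [← hf.liminf_eq]
  exact liminf_le_liminf h hf.isBoundedUnder_ge
    (isCoboundedUnder_ge_of_le atTop hg)

theorem limsup_le_of_tendsto_of_le {f g : ℕ → ℝ} {L : ℝ} (hf : Tendsto f atTop (𝓝 L))
    (h : ∀ᶠ n in atTop, g n ≤ f n) (hg : ∀ n, 0 ≤ g n) : limsup g atTop ≤ L := by
  rw [← hf.limsup_eq]
  exact limsup_le_limsup h (isCoboundedUnder_le_of_le atTop hg) hf.isBoundedUnder_le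

/-- From asymptotic normality and a bound on the bias to stochastic bounds for the shifted
t-statistics. -/
theorem stochastic_bounds_of_tendsto {p q : ℕ} (P : ∀ n, Given p q n) (l : ∀ n, Fin n → Fin n)
    (hN : ∀ z, Tendsto (fun n => (P n).condLaw.real
      {Y | (P n).betaHat Y - (P n).theta 1 ≤ z * (P n).se (l n) Y}) atTop (𝓝 (Phi z)))
    (hse : Tendsto (fun n => (P n).condLaw.real {Y | (P n).se (l n) Y ≤ 0}) atTop (𝓝 0))
    (v : ℕ → ℝ) (hbias : ∀ᶠ n in atTop, |(P n).theta 1 - (P n).tau| ≤ v n / √(P n).size)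
    (τ₀ : ℕ → ℝ) (hτ : ∀ᶠ n in atTop, (P n).tau = τ₀ n) (z : ℝ) :
    Phi z ≤ liminf (fun n => (P n).condLaw.real
      {Y | (P n).tStat (l n) (τ₀ n) Y - v n / (√(P n).size * (P n).se (l n) Y) ≤ z}) atTop ∧
    limsup (fun n => (P n).condLaw.real
      {Y | (P n).tStat (l n) (τ₀ n) Y + v n / (√(P n).size * (P n).se (l n) Y) ≤ z}) atTop ≤
        Phi z := by
  constructor
  · have h := (hN z).sub hse
    rw [sub_zero] at h
    refine le_liminf_of_tendsto_of_le h ?_ fun n => measureReal_le_one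
    filter_upwards [hbias, hτ] with n hbias hτ
    rw [sub_le_iff_le_add]
    refine (measureReal_mono fun Y hY => ?_).trans (measureReal_union_le _ _)
    by_cases hpos : (P n).se (l n) Y ≤ 0
    · exact Or.inr hpos
    -- For a positive standard error the bias bound lets the shift by v/√N compensate θ₁ - τ.
    left
    push Not at hpos
    have hY' : (P n).betaHat Y - (P n).theta 1 ≤ z * (P n).se (l n) Y := hY
    have hb := (abs_le.1 hbias).2
    change ((P n).betaHat Y - τ₀ n) / (P n).se (l n) Y -
      v n / (√(P n).size * (P n).se (l n) Y) ≤ z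
    rw [← div_div, ← sub_div, div_le_iff₀ hpos, ← hτ]
    linarith
  · have h := (hN z).add hse
    rw [add_zero] at h
    refine limsup_le_of_tendsto_of_le h ?_ fun n => measureReal_nonneg
    filter_upwards [hbias, hτ] with n hbias hτ
    refine (measureReal_mono fun Y hY => ?_).trans (measureReal_union_le _ _)
    by_cases hpos : (P n).se (l n) Y ≤ 0
    · exact Or.inr hpos
    left
    push Not at hpos
    have hY' : ((P n).betaHat Y - τ₀ n) / (P n).se (l n) Y +
      v n / (√(P n).size * (P n).se (l n) Y) ≤ z := hY
    have hb := (abs_le.1 hbias).1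
    change (P n).betaHat Y - (P n).theta 1 ≤ z * (P n).se (l n) Y
    rw [← div_div, ← add_div, div_le_iff₀ hpos, ← hτ] at hY'
    linarith

/-- From asymptotic normality and a bound on the bias to the coverage of robustified intervals. -/
theorem coverage_of_tendsto {p q : ℕ} (P : ∀ n, Given p q n) (l : ∀ n, Fin n → Fin n)
    (hN : ∀ z, Tendsto (fun n => (P n).condLaw.real
      {Y | (P n).betaHat Y - (P n).theta 1 ≤ z * (P n).se (l n) Y}) atTop (𝓝 (Phi z)))
    (hse : Tendsto (fun n => (P n).condLaw.real {Y | (P n).se (l n) Y ≤ 0}) atTop (𝓝 0))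
    (mc : ℕ → ℝ) (hbias : ∀ᶠ n in atTop, |(P n).theta 1 - (P n).tau| ≤ mc n)
    {α : ℝ} (h0 : 0 < α) (h1 : α < 1) :
    1 - α ≤ liminf (fun n => (P n).condLaw.real
      {Y | (P n).tau ∈ (P n).robustCI (l n) α (mc n) Y}) atTop := by
  have hlow : Phi (quantile (α / 2)) = α / 2 := Phi_quantile (by linarith) (by linarith)
  have hhigh : Phi (quantile (1 - α / 2)) = 1 - α / 2 := Phi_quantile (by linarith) (by linarith)
  -- The interval is open at its lower end, so strict inequality is needed there. Levels b below the
  -- quantile provide it; then b increases to the quantile.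
  have hlt : ∀ b < quantile (1 - α / 2), Phi b - α / 2 ≤ liminf (fun n => (P n).condLaw.real
      {Y | (P n).tau ∈ (P n).robustCI (l n) α (mc n) Y}) atTop := by
    intro b hb
    have h := ((hN b).sub (hN (quantile (α / 2)))).sub hse
    rw [sub_zero, hlow] at h
    refine le_liminf_of_tendsto_of_le h ?_ fun n => measureReal_le_one
    filter_upwards [hbias] with n hbias
    rw [sub_sub, sub_le_iff_le_add]
    refine (measureReal_mono fun Y hY => ?_).trans ((measureReal_union_le _ _).trans
      (add_le_add le_rfl (measureReal_union_le _ _)))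
    by_cases hpos : (P n).se (l n) Y ≤ 0
    · exact Or.inr (Or.inr hpos)
    by_cases hq : (P n).betaHat Y - (P n).theta 1 ≤ quantile (α / 2) * (P n).se (l n) Y
    · exact Or.inr (Or.inl hq)
    left
    push Not at hpos hq
    have hY' : (P n).betaHat Y - (P n).theta 1 ≤ b * (P n).se (l n) Y := hY
    have hb' := mul_lt_mul_of_pos_right hb hpos
    obtain ⟨hb1, hb2⟩ := abs_le.1 hbias
    exact ⟨by linarith, by linarith⟩
  have hc : Tendsto (fun b => Phi b - α / 2) (𝓝[<] (quantile (1 - α / 2))) (𝓝 (1 - α)) := by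
    have h := ((continuous_Phi.tendsto (quantile (1 - α / 2))).sub_const (α / 2)).mono_left
      (nhdsWithin_le_nhds (s := Set.Iio (quantile (1 - α / 2))))
    rw [hhigh, show 1 - α / 2 - α / 2 = 1 - α by ring] at h
    exact h
  refine le_of_tendsto hc ?_
  filter_upwards [self_mem_nhdsWithin] with b hb using hlt b hb

end DesignPhase

/-! ### Asymptotic inference under local misspecification -/

theorem corollary4 {p q : ℕ}
    -- subsample, covariate function and conditional law, as functions of controls and treatments
    (S : Setup p q)
    -- the realized controls and treated statuses of a sample of `n` units, for each `n`
    (w : ∀ n : ℕ, Fin n → Obs p)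
    -- the conditional means in the definitions exist
    (hint : ∀ᶠ n : ℕ in atTop, ∀ i ∈ (S.given (w n)).sub,
      Integrable (fun y : ℝ => y) ((S.given (w n)).law (w n i)) ∧
      Integrable (fun y : ℝ => y) ((S.given (w n)).law ((w n i).1, false)))
    -- the subsample becomes large
    (hlarge : Tendsto (fun n : ℕ => (S.given (w n)).sub.card) atTop atTop)
    -- bounded second moments of `‖Z U‖`
    (hsecond : ∃ M : ℝ, ∀ᶠ n : ℕ in atTop, ∀ i ∈ (S.given (w n)).sub,
      (S.given (w n)).momentZU 2 (w n i) ≤ ENNReal.ofReal M)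
    -- the design matrix is asymptotically nonsingular
    (hGam : ∃ lam : ℝ, 0 < lam ∧
      (lam : EReal) ≤ liminf (fun n : ℕ => (lambdaMin (S.given (w n)).Gam : EReal)) atTop)
    -- so is the middle matrix of the asymptotic variance
    (hDel : ∃ lam : ℝ, 0 < lam ∧
      (lam : EReal) ≤ liminf (fun n : ℕ => (lambdaMin (S.given (w n)).Del : EReal)) atTop)
    -- bounded moments of `‖Z U‖` of order `2 + δ`
    (δ : ℝ) (hδ : 0 < δ)
    (hlyap : ∃ M : ℝ, ∀ᶠ n : ℕ in atTop, ∀ i ∈ (S.given (w n)).sub,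
      (S.given (w n)).momentZU (2 + δ) (w n i) ≤ ENNReal.ofReal M)
    -- the matching metric, and regularity of the conditional moments with respect to it
    (ψ : Ctrl p → Ctrl p → ℝ) (hψ : IsMetric ψ)
    (hdom : ∃ K : ℝ, ∀ x y, ψ x y ≤ K * dist x y)
    (hreg : ∃ M : ℝ, ∀ᶠ n : ℕ in atTop, (S.given (w n)).MomentRegular ψ M)
    -- the matches
    (κ : ℝ) (hκ : 0 < κ)
    (l : ∀ n : ℕ, Fin n → Fin n)
    (hl : ∀ᶠ n : ℕ in atTop, (S.given (w n)).IsMatch ψ κ (l n))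
    -- either `ψ` comes from a norm and there are no ties, or no unit is matched too many times
    (huse : ((∃ N : Seminorm ℝ (Ctrl p), ∀ x y, ψ x y = N (x - y)) ∧
        ∀ᶠ n : ℕ in atTop, (S.given (w n)).NoTies ψ κ (l n)) ∨
      ∃ K : ℕ, ∀ᶠ n : ℕ in atTop, ∀ j : Fin n,
        (Finset.filter (fun i => l n i = j) (S.given (w n)).sub).card ≤ K)
    -- imbalance and misspecification
    (B : BalanceMetric p)
    (m : ∀ _ : ℕ, Fin B.dim → ℝ)
    (hm : ∀ᶠ n : ℕ in atTop, B.IsMisspec (S.given (w n)) (m n))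
    -- local misspecification
    (v : ∀ n : ℕ, (Fin n → Obs p) → ℝ) (hv : ∀ n w', 0 < v n w')
    (hloc : ∀ᶠ n : ℕ in atTop,
      m n ⬝ᵥ B.imbalance (S.given (w n)) = v n (w n) / √(S.given (w n)).size) :
    -- stochastic bounds for the shifted t-statistics under the null hypothesis
    (∀ τ₀ : ∀ n : ℕ, (Fin n → Obs p) → ℝ,
      (∀ᶠ n : ℕ in atTop, (S.given (w n)).tau = τ₀ n (w n)) →
      ∀ z : ℝ,
        Phi z ≤ liminf (fun n : ℕ => (S.given (w n)).condLaw.real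
          {Y | (S.given (w n)).tStat (l n) (τ₀ n (w n)) Y -
            v n (w n) / (√(S.given (w n)).size * (S.given (w n)).se (l n) Y) ≤ z}) atTop ∧
        limsup (fun n : ℕ => (S.given (w n)).condLaw.real
          {Y | (S.given (w n)).tStat (l n) (τ₀ n (w n)) Y +
            v n (w n) / (√(S.given (w n)).size * (S.given (w n)).se (l n) Y) ≤ z}) atTop ≤ Phi z) ∧
    -- asymptotic conditional coverage of the robustified intervals
    (∀ α : ℝ, 0 < α → α < 1 → ∀ m' : ∀ _ : ℕ, Fin B.dim → ℝ,
      (∀ᶠ n : ℕ in atTop, ∀ j, m n j ≤ m' n j) →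
      1 - α ≤ liminf (fun n : ℕ => (S.given (w n)).condLaw.real
        {Y | (S.given (w n)).tau ∈ (S.given (w n)).robustCI (l n) α
          (m' n ⬝ᵥ B.imbalance (S.given (w n))) Y}) atTop) := by
  have hcard : ∀ᶠ n : ℕ in atTop, 0 < (S.given (w n)).sub.card := hlarge.eventually_gt_atTop 0
  have hsize : ∀ᶠ n : ℕ in atTop, 0 < (S.given (w n)).size := by
    filter_upwards [hcard] with n hn
    exact Nat.cast_pos.2 hn
  obtain ⟨lam₁, hlam₁, hGam⟩ := hGam
  obtain ⟨lam₂, hlam₂, hDel⟩ := hDel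
  obtain ⟨M, hreg⟩ := hreg
  obtain ⟨K, hdom⟩ := hdom
  have hM : 0 ≤ M := by
    obtain ⟨n, hn, hr⟩ := (hcard.and hreg).exists
    obtain ⟨i, hi⟩ := Finset.card_pos.1 hn
    exact (abs_nonneg _).trans
      (hr.bounded 0 0 0 0 0 (by norm_num) (by norm_num) (by norm_num) i hi)
  obtain ⟨K', hmult⟩ : ∃ K' : ℕ, ∀ᶠ n : ℕ in atTop, ∀ j : Fin n,
      (Finset.filter (fun i => l n i = j) (S.given (w n)).sub).card ≤ K' := by
    rcases huse with ⟨⟨N, hN⟩, hties⟩ | h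
    · obtain ⟨K', hK'⟩ := exists_card_matched_le hκ.le hψ hdom N hN
      refine ⟨K', ?_⟩
      filter_upwards [hl, hties] with n hl hties
      exact hK' _ (l n) hl hties
    · exact h
  -- One constant serves both matrices; the halves come from passing from the liminf to all large n.
  set lam := min (lam₁ / 2) (lam₂ / 2) with hlam
  have hlam0 : 0 < lam := lt_min (half_pos hlam₁) (half_pos hlam₂)
  have hG : ∀ᶠ n : ℕ in atTop, ∀ x, lam * (x ⬝ᵥ x) ≤ x ⬝ᵥ (S.given (w n)).Gam *ᵥ x := by
    filter_upwards [eventually_quadForm_le_of_liminf_lambdaMin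
      (fun n => (S.given (w n)).isHermitian_Gam) hlam₁ hGam] with n hn x
    exact (mul_le_mul_of_nonneg_right (min_le_left _ _) (dotProduct_self_nonneg' x)).trans (hn x)
  have hD : ∀ᶠ n : ℕ in atTop, ∀ x, lam * (x ⬝ᵥ x) ≤ x ⬝ᵥ (S.given (w n)).Del *ᵥ x := by
    filter_upwards [eventually_quadForm_le_of_liminf_lambdaMin
      (fun n => (S.given (w n)).isHermitian_Del) hlam₂ hDel] with n hn x
    exact (mul_le_mul_of_nonneg_right (min_le_right _ _) (dotProduct_self_nonneg' x)).trans (hn x)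
  have hR : (0 : ℝ) < (q + 2) * (1 + M) := by positivity
  have hb : ∀ᶠ n : ℕ in atTop, (S.given (w n)).Bounded lam ((q + 2) * (1 + M)) M := by
    filter_upwards [hreg, hsize, hG, hD] with n hreg hsize hG hD
    exact Given.bounded_of_momentRegular hM hreg hsize hlam0 hG hD
  obtain ⟨hN, hse⟩ := tendsto_measureReal_betaHat (fun n => S.given (w n)) hlarge hlam0 hR hb l
    (tendsto_measureReal_sqrt_SigHat (fun n => S.given (w n)) hlarge hlam0 hR hM hM hb hψ hdom
      hreg hκ l hl hmult)
  -- Local misspecification with v > 0 supplies the positivity of m·c, which excludes the value 0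
  -- that stands for an infinite misspecification or imbalance.
  have hbias : ∀ᶠ n : ℕ in atTop, |(S.given (w n)).theta 1 - (S.given (w n)).tau| ≤
      m n ⬝ᵥ B.imbalance (S.given (w n)) := by
    filter_upwards [hsize, hG, hm, hloc] with n hsize hG hm hloc
    refine abs_theta_sub_tau_le B _ hlam0 hG hm ?_
    rw [hloc]
    exact div_pos (hv _ _) (Real.sqrt_pos.2 hsize)
  refine ⟨fun τ₀ hτ z => ?_, fun α hα0 hα1 m' hm' => ?_⟩
  · refine stochastic_bounds_of_tendsto (fun n => S.given (w n)) l hN hse (fun n => v n (w n)) ?_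
      (fun n => τ₀ n (w n)) hτ z
    filter_upwards [hbias, hloc] with n hbias hloc
    rwa [← hloc]
  · refine coverage_of_tendsto (fun n => S.given (w n)) l hN hse
      (fun n => m' n ⬝ᵥ B.imbalance (S.given (w n))) ?_ hα0 hα1
    filter_upwards [hbias, hm'] with n hbias hm'
    exact hbias.trans (Finset.sum_le_sum fun j _ =>
      mul_le_mul_of_nonneg_right (hm' j) (B.imbalance_nonneg _ j))
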